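/- Let $G$ be a finite simple graph with $n$ vertices. For $A\subseteq V(G)$ write $\overline A=V(G)\setminus A$. Two sets $X,Y\subseteq A$ are *1-neighbor equivalent over $A$* if $\min(1,|X\cap N(u)|)=\min(1,|Y\cap N(u)|)$ for all $u\in\overline A$; let $\mathsf{nec}_1(A)$ be the number of equivalence classes of this relation on the subsets of $A$, and $\mathsf{s\text{-}nec}_1(A)=\max(\mathsf{nec}_1(A),\mathsf{nec}_1(\overline A))$. A *rooted layout* of $G$ is a pair $(T,\delta)$ of a rooted binary tree $T$ (every internal node has exactly two children) and a bijection $\delta$ between $V(G)$ and the leaves of $T$. For a node $x$ of $T$ let $V_x$ be the set of vertices mapped to leaves below $x$ (a leaf is below itself), and let $\mathsf{s\text{-}nec}_1(T,\delta)=\max_{x\in V(T)}\mathsf{s\text{-}nec}_1(V_x)$. Given a weight function $\mathsf w:V(G)\to\mathbb{Q}$ and a set of terminals $K\subseteq V(G)$, a *minimum node-weighted Steiner tree* for $(G,K)$ is a set $S$ with $K\subseteq S\subseteq V(G)$ such that $G[S]$ is connected (in particular nonempty), and such that $\sum_{v\in S}\mathsf w(v)$ is minimum among all such sets. Let $\omega$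 be the exponent of matrix multiplication over a field $F$ (any fixed field), that is, the infimum of the reals $\tau$ such that the rank (bilinear complexity) of the $m\times m$ matrix multiplication over $F$ is $O(m^{\tau})$. **Corollary 4.4.** There exists an algorithm that, given an $n$-vertex graph $G$ with a weight function $\mathsf w:V(G)\to\mathbb{Q}$, a subset $K\subseteq V(G)$ and a rooted layout $(T,\delta)$ of $G$, computes a minimum node-weighted Steiner tree for $(G,K)$, or reports that no set containing $K$ induces a connected subgraph, in time $$O\bigl(\mathsf{s\text{-}nec}_1(T,\delta)^{2\omega+5}\cdot\log(\mathsf{s\text{-}nec}_1(T,\delta)+1)\cdot n^{3}\bigr),$$ where the constant in the $O$ does not depend on the input. Here an algorithm is a program of a random access machine with unit cost, with addition, truncated subtraction, comparison and indirect addressing on natural numbers, and copying, addition and comparison on the weights. Vertices are numbered $0,\dots,n-1$; $G$ is given by its adjacency matrix, $K$ by its indicator vector, $\mathsf w$ by the list of its values, and $(T,\delta)$ by the post-order listing of the nodes of $T$. -/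

import Mathlib

/-! ### Rooted layouts -/

/-- Rooted binary trees in which every internal node has two children and every leaf carries an
element of `V`. -/
inductive LayoutTree (V : Type) : Type where
  | leaf (v : V) : LayoutTree V
  | node (l r : LayoutTree V) : LayoutTree V

namespace LayoutTree

/-- The labels of the leaves, from left to right. -/
def leaves {V : Type} : LayoutTree V → List V
  | leaf v => [v]
  | node l r => l.leaves ++ r.leaves

/-- The set of vertices at the leaves below the root of the (sub)tree: for the subtree hanging at
a node `x` of a layout this is `V_x`. -/
def leafSet {V : Type} (T : LayoutTree V) : Set V := {v | v ∈ T.leaves}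

/-- Labelling the leaves is a bijection between the leaves and `V`, so the tree is a rooted layout
of any graph with vertex set `V`. -/
def IsLayout {V : Type} (T : LayoutTree V) : Prop := T.leaves.Nodup ∧ ∀ v : V, v ∈ T.leaves

/-- The `f`-width of a layout: the maximum of `f (V_x)` over all nodes `x`. -/
def width {V : Type} (f : Set V → ℕ) : LayoutTree V → ℕ
  | leaf v => f (leafSet (leaf v))
  | node l r => max (f (leafSet (node l r))) (max (width f l) (width f r))

/-- The post-order listing of the nodes: a leaf labelled `v` is written `v + 1`, and an internal
node is written `0`, after its left and right subtrees. -/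
def postorder {n : ℕ} : LayoutTree (Fin n) → List ℕ
  | leaf v => [(v : ℕ) + 1]
  | node l r => l.postorder ++ r.postorder ++ [0]

end LayoutTree

/-! ### The `d`-neighbor equivalence -/

/-- The `d`-neighbor equivalence over `A`, on the subsets of `A`. -/
def neighborEquiv {V : Type} (G : SimpleGraph V) (d : ℕ) (A : Set V) : Setoid {X : Set V // X ⊆ A} where
  r X Y := ∀ u ∈ Aᶜ, min d (X.1 ∩ G.neighborSet u).ncard = min d (Y.1 ∩ G.neighborSet u).ncard
  iseqv :=
    { refl := fun _ _ _ => rfl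
      symm := fun h u hu => (h u hu).symm
      trans := fun h₁ h₂ u hu => (h₁ u hu).trans (h₂ u hu) }

/-- `nec_d(A)`: the number of equivalence classes of the `d`-neighbor equivalence over `A`. -/
noncomputable def nec {V : Type} (G : SimpleGraph V) (d : ℕ) (A : Set V) : ℕ :=
  Nat.card (Quotient (neighborEquiv G d A))

/-- `s-nec_d(A) = max (nec_d(A), nec_d(V ∖ A))`. -/
noncomputable def snec {V : Type} (G : SimpleGraph V) (d : ℕ) (A : Set V) : ℕ :=
  max (nec G d A) (nec G d Aᶜ)

/-! ### The exponent of matrix multiplication -/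

/-- The rank (bilinear complexity) of `m × m` matrix multiplication over `F`: the least `r` such
that `A * B = ∑ i < r, f_i(A) g_i(B) C_i` for linear forms `f_i, g_i` and matrices `C_i`. -/
noncomputable def matMulRank (F : Type*) [Field F] (m : ℕ) : ℕ :=
  sInf {r : ℕ | ∃ (f g : Fin r → Module.Dual F (Matrix (Fin m) (Fin m) F))
    (C : Fin r → Matrix (Fin m) (Fin m) F),
    ∀ A B : Matrix (Fin m) (Fin m) F, A * B = ∑ i, (f i A * g i B) • C i}

/-- The exponent of matrix multiplication over `F`. -/
noncomputable def matMulExponent (F : Type*) [Field F] : ℝ :=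
  sInf {τ : ℝ | (fun m : ℕ => (matMulRank F m : ℝ)) =O[Filter.atTop] fun m : ℕ => (m : ℝ) ^ τ}

/-! ### Random access machines

The usual random access machine with unit cost, written with structured control flow. It has
registers and arrays for natural numbers (used for indices and addresses) and for rational numbers
(used for the weights). A program is a finite object, so that it names only finitely many registers
and arrays; array cells are addressed indirectly, through a register. On natural numbers there are
addition, truncated subtraction and comparison, but no multiplication; on weights there are
addition and comparison. -/

/-- The contents of the memory. -/
structure RamState : Type where
  /-- the registers for natural numbers -/
  reg : ℕ → ℕ
  /-- the arrays of natural numbers: `mem m k` is the cell `k` of the array `m` -/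
  mem : ℕ → ℕ → ℕ
  /-- the registers for weights -/
  wreg : ℕ → ℚ
  /-- the arrays of weights -/
  wmem : ℕ → ℕ → ℚ

/-- The elementary tests. -/
inductive RamTest : Type where
  /-- register `i` is smaller than register `j` -/
  | lt (i j : ℕ) : RamTest
  /-- register `i` equals register `j` -/
  | eq (i j : ℕ) : RamTest
  /-- weight register `i` is smaller than weight register `j` -/
  | wlt (i j : ℕ) : RamTest

def RamTest.Holds (σ : RamState) : RamTest → Prop
  | lt i j => σ.reg i < σ.reg j
  | eq i j => σ.reg i = σ.reg j
  | wlt i j => σ.wreg i < σ.wreg j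

/-- The elementary instructions. -/
inductive RamInstr : Type where
  /-- register `r` := the constant `k` -/
  | const (r k : ℕ) : RamInstr
  /-- register `r` := register `a` -/
  | copy (r a : ℕ) : RamInstr
  /-- register `r` := register `a` + register `b` -/
  | add (r a b : ℕ) : RamInstr
  /-- register `r` := register `a` - register `b`, truncated at `0` -/
  | sub (r a b : ℕ) : RamInstr
  /-- register `r` := the cell of array `m` whose index is in register `i` -/
  | load (r m i : ℕ) : RamInstr
  /-- the cell of array `m` whose index is in register `i` := register `a` -/
  | store (m i a : ℕ) : RamInstr
  /-- weight register `r` := `0` -/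
  | wzero (r : ℕ) : RamInstr
  /-- weight register `r` := weight register `a` -/
  | wcopy (r a : ℕ) : RamInstr
  /-- weight register `r` := weight register `a` + weight register `b` -/
  | wadd (r a b : ℕ) : RamInstr
  /-- weight register `r` := the cell of weight array `m` whose index is in register `i` -/
  | wload (r m i : ℕ) : RamInstr
  /-- the cell of weight array `m` whose index is in register `i` := weight register `a` -/
  | wstore (m i a : ℕ) : RamInstr

/-- The effect of an elementary instruction. -/
def RamInstr.apply (σ : RamState) : RamInstr → RamState
  | const r k => { σ with reg := Function.update σ.reg r k }
  | copy r a => { σ with reg := Function.update σ.reg r (σ.reg a) }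
  | add r a b => { σ with reg := Function.update σ.reg r (σ.reg a + σ.reg b) }
  | sub r a b => { σ with reg := Function.update σ.reg r (σ.reg a - σ.reg b) }
  | load r m i => { σ with reg := Function.update σ.reg r (σ.mem m (σ.reg i)) }
  | store m i a =>
      { σ with mem := Function.update σ.mem m (Function.update (σ.mem m) (σ.reg i) (σ.reg a)) }
  | wzero r => { σ with wreg := Function.update σ.wreg r 0 }
  | wcopy r a => { σ with wreg := Function.update σ.wreg r (σ.wreg a) }
  | wadd r a b => { σ with wreg := Function.update σ.wreg r (σ.wreg a + σ.wreg b) }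
  | wload r m i => { σ with wreg := Function.update σ.wreg r (σ.wmem m (σ.reg i)) }
  | wstore m i a =>
      { σ with wmem := Function.update σ.wmem m (Function.update (σ.wmem m) (σ.reg i) (σ.wreg a)) }

/-- Programs: instructions, sequential composition, conditionals and while-loops. -/
inductive RamProg : Type where
  | instr (c : RamInstr) : RamProg
  | seq (P Q : RamProg) : RamProg
  | ite (b : RamTest) (P Q : RamProg) : RamProg
  | loop (b : RamTest) (P : RamProg) : RamProg

/-- `RamExec P σ t σ'`: started in the state `σ`, the program `P` halts after exactly `t` steps in
the state `σ'`. Every elementary instruction and every evaluation of a test is one step. -/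
inductive RamExec : RamProg → RamState → ℕ → RamState → Prop where
  | instr (c : RamInstr) (σ : RamState) : RamExec (.instr c) σ 1 (c.apply σ)
  | seq {P Q : RamProg} {σ σ₁ σ₂ : RamState} {t₁ t₂ : ℕ} :
      RamExec P σ t₁ σ₁ → RamExec Q σ₁ t₂ σ₂ → RamExec (.seq P Q) σ (t₁ + t₂) σ₂
  | ite_true {b : RamTest} {P Q : RamProg} {σ σ₁ : RamState} {t : ℕ} :
      b.Holds σ → RamExec P σ t σ₁ → RamExec (.ite b P Q) σ (t + 1) σ₁
  | ite_false {b : RamTest} {P Q : RamProg} {σ σ₁ : RamState} {t : ℕ} :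
      ¬ b.Holds σ → RamExec Q σ t σ₁ → RamExec (.ite b P Q) σ (t + 1) σ₁
  | loop_true {b : RamTest} {P : RamProg} {σ σ₁ σ₂ : RamState} {t₁ t₂ : ℕ} :
      b.Holds σ → RamExec P σ t₁ σ₁ → RamExec (.loop b P) σ₁ t₂ σ₂ →
      RamExec (.loop b P) σ (t₁ + t₂ + 1) σ₂
  | loop_false {b : RamTest} {P : RamProg} {σ : RamState} :
      ¬ b.Holds σ → RamExec (.loop b P) σ 1 σ

/-! ### The Node-Weighted Steiner Tree problem -/

/-- `S` contains all terminals and induces a connected (in particular nonempty) subgraph. -/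
def IsSteinerSet {V : Type} (G : SimpleGraph V) (K S : Finset V) : Prop :=
  K ⊆ S ∧ (G.induce (S : Set V)).Connected

/-- `S` is a minimum node-weighted Steiner tree for `(G, K)`. -/
def IsMinSteinerTree {V : Type} (G : SimpleGraph V) (K : Finset V) (w : V → ℚ) (S : Finset V) :
    Prop :=
  IsSteinerSet G K S ∧ ∀ S' : Finset V, IsSteinerSet G K S' → ∑ v ∈ S, w v ≤ ∑ v ∈ S', w v

open Classical in
/-- The encoding of an instance: register `0` holds the number `n` of vertices, array `0` the
adjacency matrix (row by row), array `1` the indicator vector of the terminals, array `2` the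
layout in post-order, and weight array `0` the weights. All the rest is zero. -/
noncomputable def steinerInput {n : ℕ} (G : SimpleGraph (Fin n)) (K : Finset (Fin n))
    (w : Fin n → ℚ) (T : LayoutTree (Fin n)) : RamState where
  reg := fun r => if r = 0 then n else 0
  mem := fun m k =>
    if m = 0 then (if ∃ i j : Fin n, k = (i : ℕ) * n + j ∧ G.Adj i j then 1 else 0)
    else if m = 1 then (if ∃ i : Fin n, k = i ∧ i ∈ K then 1 else 0)
    else if m = 2 then T.postorder.getD k 0
    else 0
  wreg := fun _ => 0
  wmem := fun m k => if m = 0 then (if h : k < n then w ⟨k, h⟩ else 0) else 0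

/-- The answer that a final state must give: register `0` is `1` and array `3` holds the indicator
vector of a minimum node-weighted Steiner tree, or else register `0` is `0` and no set contains the
terminals and induces a connected subgraph. -/
def IsSteinerOutput {n : ℕ} (G : SimpleGraph (Fin n)) (K : Finset (Fin n)) (w : Fin n → ℚ)
    (σ : RamState) : Prop :=
  (σ.reg 0 = 1 ∧ ∃ S : Finset (Fin n), IsMinSteinerTree G K w S ∧
    ∀ v : Fin n, σ.mem 3 v = if v ∈ S then 1 else 0) ∨
  (σ.reg 0 = 0 ∧ ¬ ∃ S : Finset (Fin n), IsSteinerSet G K S)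

/-! ### A program logic for random access machines -/

/-! Connectivity is replaced by a parity. Fix a vertex `r` that the solution is to contain. A cut of
`X` is a set `P ⊆ X` without edges to `X \ P` and with `r` not in `X \ P`. If `r ∈ X` and `X` has
`c` components there are `2 ^ (c - 1)` cuts, so their number is odd exactly when `X` is connected
(`card_cuts_ne_zero_iff`). Trying every `r`, with `insert r K` as the required set, loses nothing,
because a connected set is nonempty.

Let `A` be the vertex set below a node of the layout and let `X ⊆ A`. A cut of `X` interacts with
the rest of the graph only through the neighbors outside `A` of its two sides. Up to this
information there are at most `nec G 1 A ^ 2` cuts (`DistinctClasses.le_nec_sq`). The set `X` is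
summarized by the vector over `ZMod 2` that counts its cuts in each class (`cutVec`). When two
disjoint parts are joined, these vectors combine bilinearly (`IsJoinTable.cutVec_union`). So it
suffices to keep a list of sets such that the vector of every admissible set is spanned by vectors
of listed sets that are no heavier (`Represents`). Bilinearity carries this property through joins
(`Represents.join`). The parity of the number of cuts is a linear functional of the vector, so a
connected set forces a listed set with an odd number of cuts that is no heavier
(`Represents.exists_connected`). Gaussian elimination that always takes a pivot of minimum weight
shrinks a list to at most as many sets as there are classes (`pivotProg_run`, `reduceProg_run`).

Let `M` bound the numbers of classes and of listed sets at a node. A join forms at most `M ^ 2`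
unions. Evaluating the bilinear form on them and eliminating by hand costs `O(M ^ 4)`, and the table
of classes costs `O(M ^ 2 * (n + M))`. Over `n` rounds and `2 * n - 1` nodes this stays below a
constant times `M ^ 4 * n ^ 3`. With `M = 3 * s ^ 2`, where `s` is the width, the time is `O(s ^ 8 *
n ^ 3)`. No fast matrix multiplication is needed: the exponent is at least `2`
(`two_le_matMulExponent`), so the allowed power of `s` is at least `9`, and the logarithm is at
least `log 2`.

On the machine, sets and vectors are single integers. Bitwise conjunction is a loop over the bits,
using a table of powers of two that is built by doubling. -/

namespace RamState

/-- Overwrite a register. -/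
def setReg (σ : RamState) (r x : ℕ) : RamState := { σ with reg := Function.update σ.reg r x }

/-- Overwrite a memory cell. -/
def setMem (σ : RamState) (m i x : ℕ) : RamState :=
  { σ with mem := Function.update σ.mem m (Function.update (σ.mem m) i x) }

/-- Overwrite a weight register. -/
def setWreg (σ : RamState) (r : ℕ) (x : ℚ) : RamState :=
  { σ with wreg := Function.update σ.wreg r x }

/-- Overwrite a weight cell. -/
def setWmem (σ : RamState) (m i : ℕ) (x : ℚ) : RamState :=
  { σ with wmem := Function.update σ.wmem m (Function.update (σ.wmem m) i x) }

variable (σ : RamState) (r x m i k : ℕ) (q : ℚ)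

@[simp] theorem setReg_reg : (σ.setReg r x).reg k = if k = r then x else σ.reg k := by
  simp [setReg, Function.update_apply]
@[simp] theorem setReg_mem : (σ.setReg r x).mem = σ.mem := rfl
@[simp] theorem setReg_wreg : (σ.setReg r x).wreg = σ.wreg := rfl
@[simp] theorem setReg_wmem : (σ.setReg r x).wmem = σ.wmem := rfl
@[simp] theorem setMem_reg : (σ.setMem m i x).reg = σ.reg := rfl
@[simp] theorem setMem_mem : (σ.setMem m i x).mem k =
    if k = m then Function.update (σ.mem m) i x else σ.mem k := by
  simp [setMem, Function.update_apply]
@[simp] theorem setMem_wreg : (σ.setMem m i x).wreg = σ.wreg := rfl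
@[simp] theorem setMem_wmem : (σ.setMem m i x).wmem = σ.wmem := rfl
@[simp] theorem setWreg_reg : (σ.setWreg r q).reg = σ.reg := rfl
@[simp] theorem setWreg_mem : (σ.setWreg r q).mem = σ.mem := rfl
@[simp] theorem setWreg_wreg : (σ.setWreg r q).wreg k = if k = r then q else σ.wreg k := by
  simp [setWreg, Function.update_apply]
@[simp] theorem setWreg_wmem : (σ.setWreg r q).wmem = σ.wmem := rfl
@[simp] theorem setWmem_reg : (σ.setWmem m i q).reg = σ.reg := rfl
@[simp] theorem setWmem_mem : (σ.setWmem m i q).mem = σ.mem := rfl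
@[simp] theorem setWmem_wreg : (σ.setWmem m i q).wreg = σ.wreg := rfl
@[simp] theorem setWmem_wmem : (σ.setWmem m i q).wmem k =
    if k = m then Function.update (σ.wmem m) i q else σ.wmem k := by
  simp [setWmem, Function.update_apply]

end RamState

namespace RamInstr

variable (σ : RamState) (r k a b m i : ℕ)

@[simp] theorem apply_const : (const r k).apply σ = σ.setReg r k := rfl
@[simp] theorem apply_copy : (copy r a).apply σ = σ.setReg r (σ.reg a) := rfl
@[simp] theorem apply_add : (add r a b).apply σ = σ.setReg r (σ.reg a + σ.reg b) := rfl
@[simp] theorem apply_sub : (sub r a b).apply σ = σ.setReg r (σ.reg a - σ.reg b) := rfl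
@[simp] theorem apply_load : (load r m i).apply σ = σ.setReg r (σ.mem m (σ.reg i)) := rfl
@[simp] theorem apply_store : (store m i a).apply σ = σ.setMem m (σ.reg i) (σ.reg a) := rfl
@[simp] theorem apply_wzero : (wzero r).apply σ = σ.setWreg r 0 := rfl
@[simp] theorem apply_wcopy : (wcopy r a).apply σ = σ.setWreg r (σ.wreg a) := rfl
@[simp] theorem apply_wadd : (wadd r a b).apply σ = σ.setWreg r (σ.wreg a + σ.wreg b) := rfl
@[simp] theorem apply_wload : (wload r m i).apply σ = σ.setWreg r (σ.wmem m (σ.reg i)) := rfl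
@[simp] theorem apply_wstore : (wstore m i a).apply σ = σ.setWmem m (σ.reg i) (σ.wreg a) := rfl

/-- The instruction only writes to the listed registers, arrays, weight registers and weight
arrays. -/
def within (R A W B : List ℕ) : RamInstr → Bool
  | const r _ | copy r _ | add r _ _ | sub r _ _ | load r _ _ => R.contains r
  | store m _ _ => A.contains m
  | wzero r | wcopy r _ | wadd r _ _ | wload r _ _ => W.contains r
  | wstore m _ _ => B.contains m

end RamInstr

/-- The two states agree outside the listed registers, arrays, weight registers and weight
arrays. -/
structure Frame (R A W B : List ℕ) (σ σ' : RamState) : Prop where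
  reg : ∀ r, r ∉ R → σ'.reg r = σ.reg r
  mem : ∀ m, m ∉ A → σ'.mem m = σ.mem m
  wreg : ∀ r, r ∉ W → σ'.wreg r = σ.wreg r
  wmem : ∀ m, m ∉ B → σ'.wmem m = σ.wmem m

theorem Frame.rfl {R A W B : List ℕ} {σ : RamState} : Frame R A W B σ σ :=
  ⟨fun _ _ => Eq.refl _, fun _ _ => Eq.refl _, fun _ _ => Eq.refl _, fun _ _ => Eq.refl _⟩

theorem Frame.trans {R A W B : List ℕ} {σ σ' σ'' : RamState} (h : Frame R A W B σ σ')
    (h' : Frame R A W B σ' σ'') : Frame R A W B σ σ'' :=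
  ⟨fun r hr => (h'.reg r hr).trans (h.reg r hr), fun r hr => (h'.mem r hr).trans (h.mem r hr),
    fun r hr => (h'.wreg r hr).trans (h.wreg r hr), fun r hr => (h'.wmem r hr).trans (h.wmem r hr)⟩

theorem RamInstr.frame {R A W B : List ℕ} {c : RamInstr} (h : c.within R A W B = true)
    (σ : RamState) : Frame R A W B σ (c.apply σ) := by
  cases c <;> simp only [RamInstr.within, List.contains_iff_mem] at h <;> constructor <;>
    intro r hr <;> simp <;> rintro rfl <;> contradiction

namespace RamProg

/-- All writes of the program go to the listed registers, arrays, weight registers and weight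
arrays. -/
def within (R A W B : List ℕ) : RamProg → Bool
  | instr c => c.within R A W B
  | seq P Q | ite _ P Q => P.within R A W B && Q.within R A W B
  | loop _ P => P.within R A W B

/-- What a program can write is visible in its syntax, so a Boolean check settles everything it
leaves untouched. The correctness lemmas below then track only the cells that change. -/
theorem frame {R A W B : List ℕ} {P : RamProg} {σ σ' : RamState} {t : ℕ}
    (e : RamExec P σ t σ') (h : P.within R A W B = true) : Frame R A W B σ σ' := by
  induction e with
  | instr c σ => exact RamInstr.frame h σ
  | seq _ _ ih₁ ih₂ =>
    simp only [within, Bool.and_eq_true] at h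
    exact (ih₁ h.1).trans (ih₂ h.2)
  | ite_true _ _ ih => simp only [within, Bool.and_eq_true] at h; exact ih h.1
  | ite_false _ _ ih => simp only [within, Bool.and_eq_true] at h; exact ih h.2
  | loop_true _ _ _ ih₁ ih₂ => exact (ih₁ (by simpa [within] using h)).trans (ih₂ h)
  | loop_false _ => exact .rfl

/-- A sequence of instructions. -/
def block : List RamInstr → RamProg
  | [] => .instr (.copy 0 0)
  | c :: l => .seq (.instr c) (block l)

/-- `for c = 0, …, k - 1 do body`; register `61` must contain `1`. -/
def up (c k : ℕ) (body : RamProg) : RamProg :=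
  .seq (.instr (.const c 0)) (.loop (.lt c k) (.seq body (.instr (.add c c 61))))

/-- `while 0 < c do (c := c - 1; body)`; registers `60`, `61` must contain `0` and `1`. -/
def down (c : ℕ) (body : RamProg) : RamProg :=
  .loop (.lt 60 c) (.seq (.instr (.sub c c 61)) body)

end RamProg

/-- The effect of a sequence of instructions. -/
def exec : List RamInstr → RamState → RamState
  | [], σ => σ
  | c :: l, σ => exec l (c.apply σ)

@[simp] theorem exec_nil (σ : RamState) : exec [] σ = σ := rfl
@[simp] theorem exec_cons (c : RamInstr) (l : List RamInstr) (σ : RamState) :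
    exec (c :: l) σ = exec l (c.apply σ) := rfl

/-- Started in `σ`, the program halts within `T` steps in a state that satisfies `Q`. -/
def Run (P : RamProg) (σ : RamState) (T : ℕ) (Q : RamState → Prop) : Prop :=
  ∃ t σ', RamExec P σ t σ' ∧ t ≤ T ∧ Q σ'

/-! ### Proof rules for termination within a time bound -/

namespace Run

variable {P P' : RamProg} {σ : RamState} {T T' T₁ T₂ : ℕ} {Q Q' : RamState → Prop}

theorem mono (h : Run P σ T Q) (hT : T ≤ T') (hQ : ∀ σ', Q σ' → Q' σ') : Run P σ T' Q' := by
  obtain ⟨t, σ', e, ht, hq⟩ := h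
  exact ⟨t, σ', e, ht.trans hT, hQ _ hq⟩

theorem weaken (h : Run P σ T Q) (hT : T ≤ T') : Run P σ T' Q := h.mono hT fun _ h => h

theorem post (h : Run P σ T Q) (hQ : ∀ σ', Q σ' → Q' σ') : Run P σ T Q' := h.mono le_rfl hQ

theorem frame (R A W B : List ℕ) (hP : P.within R A W B = true) (h : Run P σ T Q) :
    Run P σ T fun σ' => Q σ' ∧ Frame R A W B σ σ' := by
  obtain ⟨t, σ', e, ht, hq⟩ := h
  exact ⟨t, σ', e, ht, hq, RamProg.frame e hP⟩

/-- The postcondition of the first program is itself a `Run` statement, so the intermediate state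
needs no description. -/
theorem seq (h : Run P σ T₁ fun σ' => Run P' σ' T₂ Q) : Run (.seq P P') σ (T₁ + T₂) Q := by
  obtain ⟨t, σ', e, ht, t', σ'', e', ht', hq⟩ := h
  exact ⟨_, _, e.seq e', add_le_add ht ht', hq⟩

theorem seq' (h : Run P σ T₁ Q) (h' : ∀ σ', Q σ' → Run P' σ' T₂ Q') :
    Run (.seq P P') σ (T₁ + T₂) Q' :=
  seq (h.post h')

theorem instr {c : RamInstr} (h : Q (c.apply σ)) : Run (.instr c) σ 1 Q :=
  ⟨1, _, .instr c σ, le_rfl, h⟩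

/-- The additional step is the copy of register `0` to itself that stands for the empty program. -/
theorem block {l : List RamInstr} (h : Q (exec l σ)) : Run (.block l) σ (l.length + 1) Q := by
  induction l generalizing σ with
  | nil =>
    refine instr ?_
    have : (RamInstr.copy 0 0).apply σ = σ := by simp [RamInstr.apply]
    rwa [this]
  | cons c l ih => exact (seq (instr (ih h))).weaken (by simp; omega)

theorem block_seq {l : List RamInstr} (h : Run P (exec l σ) T Q) :
    Run (.seq (.block l) P) σ (l.length + 1 + T) Q :=
  seq (block h)

theorem ite {b : RamTest} (h : b.Holds σ → Run P σ T Q) (h' : ¬ b.Holds σ → Run P' σ T Q) :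
    Run (.ite b P P') σ (T + 1) Q := by
  by_cases hb : b.Holds σ
  · obtain ⟨t, σ', e, ht, hq⟩ := h hb
    exact ⟨_, _, .ite_true hb e, by omega, hq⟩
  · obtain ⟨t, σ', e, ht, hq⟩ := h' hb
    exact ⟨_, _, .ite_false hb e, by omega, hq⟩

theorem loop_step {b : RamTest} (hb : b.Holds σ)
    (h : Run P σ T₁ fun σ' => Run (.loop b P) σ' T₂ Q) : Run (.loop b P) σ (T₁ + T₂ + 1) Q := by
  obtain ⟨t, σ', e, ht, t', σ'', e', ht', hq⟩ := h
  exact ⟨_, _, .loop_true hb e e', by omega, hq⟩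

theorem loop_end {b : RamTest} (hb : ¬ b.Holds σ) (h : Q σ) : Run (.loop b P) σ 1 Q :=
  ⟨_, _, .loop_false hb, le_rfl, h⟩

theorem seq_le (T₁ : ℕ) (h : Run P σ T₁ Q) (hT : T₁ ≤ T) (h' : ∀ σ', Q σ' → Run P' σ' (T - T₁) Q') :
    Run (.seq P P') σ T Q' :=
  (seq' h h').weaken (by omega)

theorem block_seq_le {l : List RamInstr} (hT : l.length + 1 ≤ T)
    (h : Run P (exec l σ) (T - (l.length + 1)) Q) : Run (.seq (.block l) P) σ T Q :=
  (block_seq h).weaken (by omega)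

theorem block_le {l : List RamInstr} (hT : l.length + 1 ≤ T) (h : Q (exec l σ)) :
    Run (.block l) σ T Q :=
  (block h).weaken hT

theorem ite_le {b : RamTest} (hT : 1 ≤ T) (h : b.Holds σ → Run P σ (T - 1) Q)
    (h' : ¬ b.Holds σ → Run P' σ (T - 1) Q) : Run (.ite b P P') σ T Q :=
  (ite h h').weaken (by omega)

/-- The body writes neither the counter nor its limit, so the number of rounds is fixed at the
start; `hI` makes the invariant insensitive to the counter. Each round pays for a test and an
increment besides `b`, and the final `2` pays for the initialization and the failing test. -/
theorem up {c k N b : ℕ} {body : RamProg} (R A W B : List ℕ)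
    (hw : body.within R A W B = true)
    (hR : c ∉ R ∧ k ∉ R ∧ 61 ∉ R ∧ c ≠ k ∧ c ≠ 61)
    (I : ℕ → RamState → Prop) (hI : ∀ i σ x, I i σ → I i (σ.setReg c x))
    (hone : σ.reg 61 = 1) (hk : σ.reg k = N) (h0 : I 0 σ)
    (hb : ∀ i < N, ∀ σ', σ'.reg c = i → Frame (c :: R) A W B σ σ' → I i σ' →
      Run body σ' b (I (i + 1))) :
    Run (.up c k body) σ (N * (b + 2) + 2) fun σ' => I N σ' ∧ Frame (c :: R) A W B σ σ' := by
  obtain ⟨hc, hkR, h1, hck, hc1⟩ := hR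
  have hck' : k ≠ c := Ne.symm hck
  have hc1' : 61 ≠ c := Ne.symm hc1
  have key : ∀ d i σ', i + d = N → σ'.reg c = i → Frame (c :: R) A W B σ σ' → I i σ' →
      Run (.loop (.lt c k) (.seq body (.instr (.add c c 61)))) σ' (d * (b + 2) + 1)
        fun σ' => I N σ' ∧ Frame (c :: R) A W B σ σ' := by
    intro d
    induction d with
    | zero =>
      intro i σ' hi hr hf h
      have : σ'.reg k = N := by rw [hf.reg k (by simp [hck', hkR]), hk]
      obtain rfl : i = N := by omega
      exact (loop_end (by simp [RamTest.Holds, this, hr]) ⟨h, hf⟩).weaken (by simp)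
    | succ d ih =>
      intro i σ' hi hr hf h
      have : σ'.reg k = N := by rw [hf.reg k (by simp [hck', hkR]), hk]
      have h1' : σ'.reg 61 = 1 := by rw [hf.reg 61 (by simp [hc1', h1]), hone]
      refine (loop_step (T₁ := b + 1) (T₂ := d * (b + 2) + 1)
        (by simp [RamTest.Holds, this, hr]; omega) ?_).weaken (by ring_nf; omega)
      refine seq' ((hb i (by omega) σ' hr hf h).frame R A W B hw) ?_
      rintro σ'' ⟨hi', hf'⟩
      refine instr ?_
      simp only [RamInstr.apply_add, hf'.reg c hc, hf'.reg 61 h1, h1', hr]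
      refine ih (i + 1) _ (by omega) (by simp) ?_ (hI _ _ _ hi')
      have hff : Frame (c :: R) A W B σ' (σ''.setReg c (i + 1)) :=
        ⟨fun r hr => by
          simp only [List.mem_cons, not_or] at hr
          simp [hr.1, hf'.reg r hr.2], fun r hr => by simp [hf'.mem r hr],
          fun r hr => by simp [hf'.wreg r hr], fun r hr => by simp [hf'.wmem r hr]⟩
      exact hf.trans hff
  refine (seq (T₁ := 1) (instr ?_)).weaken (T := 1 + (N * (b + 2) + 1)) (by omega)
  simp only [RamInstr.apply_const]
  refine key N 0 _ (by omega) (by simp) ?_ (hI _ _ _ h0)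
  exact ⟨fun r hr => by
    simp only [List.mem_cons, not_or] at hr
    simp [hr.1], fun r hr => by simp, fun r hr => by simp, fun r hr => by simp⟩

/-- The counter is decremented before the body, so the body sees `i` and takes the invariant from `i
+ 1` to `i`. This suits the treatment of bits from the highest to the lowest. -/
theorem down {c N b : ℕ} {body : RamProg} (R A W B : List ℕ)
    (hw : body.within R A W B = true)
    (hR : c ∉ R ∧ 60 ∉ R ∧ 61 ∉ R ∧ c ≠ 60 ∧ c ≠ 61)
    (I : ℕ → RamState → Prop) (hI : ∀ i σ x, I i σ → I i (σ.setReg c x))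
    (hzero : σ.reg 60 = 0) (hone : σ.reg 61 = 1) (hN : σ.reg c = N) (h0 : I N σ)
    (hb : ∀ i < N, ∀ σ', σ'.reg c = i → Frame (c :: R) A W B σ σ' → I (i + 1) σ' →
      Run body σ' b (I i)) :
    Run (.down c body) σ (N * (b + 2) + 1) fun σ' => I 0 σ' ∧ Frame (c :: R) A W B σ σ' := by
  obtain ⟨hc, hkR, h1, hck, hc1⟩ := hR
  have hck' : 60 ≠ c := Ne.symm hck
  have hc1' : 61 ≠ c := Ne.symm hc1
  have key : ∀ i σ', i ≤ N → σ'.reg c = i → Frame (c :: R) A W B σ σ' → I i σ' →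
      Run (.down c body) σ' (i * (b + 2) + 1)
        fun σ' => I 0 σ' ∧ Frame (c :: R) A W B σ σ' := by
    intro i
    induction i with
    | zero =>
      intro σ' hi hr hf h
      have : σ'.reg 60 = 0 := by rw [hf.reg 60 (by simp [hck', hkR]), hzero]
      exact (loop_end (by simp [RamTest.Holds, this, hr]) ⟨h, hf⟩).weaken (by simp)
    | succ i ih =>
      intro σ' hi hr hf h
      have : σ'.reg 60 = 0 := by rw [hf.reg 60 (by simp [hck', hkR]), hzero]
      have h1' : σ'.reg 61 = 1 := by rw [hf.reg 61 (by simp [hc1', h1]), hone]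
      refine (loop_step (T₁ := 1 + b) (T₂ := i * (b + 2) + 1)
        (by simp [RamTest.Holds, this, hr]) ?_).weaken (by ring_nf; omega)
      refine seq (instr ?_)
      simp only [RamInstr.apply_sub, h1', hr, Nat.add_sub_cancel]
      have hff : Frame (c :: R) A W B σ (σ'.setReg c i) := hf.trans
        ⟨fun r hr => by
          simp only [List.mem_cons, not_or] at hr
          simp [hr.1], fun r hr => by simp, fun r hr => by simp, fun r hr => by simp⟩
      refine ((hb i (by omega) _ (by simp) hff (hI _ _ _ h)).frame R A W B hw).post ?_
      rintro σ'' ⟨hi', hf'⟩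
      refine ih σ'' (by omega) (by rw [hf'.reg c hc]; simp) ?_ hi'
      refine hff.trans ⟨fun r hr => ?_, hf'.mem, hf'.wreg, hf'.wmem⟩
      simp only [List.mem_cons, not_or] at hr
      exact hf'.reg r hr.2
  exact key N σ le_rfl hN .rfl h0

end Run

/-! ### Integers as bit vectors -/

theorem and_two_pow_add {i a b : ℕ} (ha : a < 2 ^ i) (hb : b < 2 ^ i) :
    (2 ^ i + a) &&& (2 ^ i + b) = 2 ^ i + (a &&& b) := by
  have hab : a &&& b < 2 ^ i := Nat.and_lt_two_pow _ hb
  apply Nat.eq_of_testBit_eq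
  intro j
  rw [Nat.testBit_and]
  rcases lt_trichotomy j i with h | rfl | h
  · simp [Nat.testBit_two_pow_add_gt h]
  · simp [Nat.testBit_two_pow_add_eq, Nat.testBit_lt_two_pow, ha, hb, hab]
  · have h2 : 2 ^ (i + 1) ≤ 2 ^ j := Nat.pow_le_pow_right (by norm_num) h
    rw [pow_succ] at h2
    rw [Nat.testBit_lt_two_pow (x := 2 ^ i + a) (by omega),
      Nat.testBit_lt_two_pow (x := 2 ^ i + (a &&& b)) (by omega), Bool.false_and]

/-- The bits of `a` from position `i` on vanish and mask whatever the summand `2 ^ i` changes. -/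
theorem and_two_pow_add_right {i a b : ℕ} (ha : a < 2 ^ i) :
    a &&& (2 ^ i + b) = a &&& b := by
  apply Nat.eq_of_testBit_eq
  intro j
  rw [Nat.testBit_and, Nat.testBit_and]
  rcases lt_or_ge j i with h | h
  · rw [Nat.testBit_two_pow_add_gt h]
  · rw [Nat.testBit_lt_two_pow (ha.trans_le (Nat.pow_le_pow_right (by norm_num) h))]
    simp

/-- Register `3` := the bitwise conjunction of the registers `0` and `1`, which have at most as
many bits as register `2` says. -/
def andProg : RamProg :=
  .seq (.block [.const 3 0]) (.down 2 (.seq (.block [.load 4 4 2])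
    (.ite (.lt 0 4)
      (.ite (.lt 1 4) (.block []) (.block [.sub 1 1 4]))
      (.seq (.block [.sub 0 0 4])
        (.ite (.lt 1 4) (.block []) (.block [.sub 1 1 4, .add 3 3 4]))))))

/-- Leading bits are peeled off by comparison with `2 ^ i`. The invariant is that both remainders
are below `2 ^ i` and that the part collected so far plus the conjunction of the remainders is `x
&&& y`. -/
theorem andProg_run {σ : RamState} {x y k : ℕ} (hz : σ.reg 60 = 0) (ho : σ.reg 61 = 1)
    (hx : σ.reg 0 = x) (hy : σ.reg 1 = y) (hk : σ.reg 2 = k) (hxk : x < 2 ^ k) (hyk : y < 2 ^ k)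
    (hP : ∀ i < k, σ.mem 4 i = 2 ^ i) :
    Run andProg σ (k * 11 + 3) fun σ' => σ'.reg 3 = x &&& y ∧ Frame [0, 1, 2, 3,
        4] [] [] [] σ σ' := by
  refine Run.frame [0, 1, 2, 3, 4] [] [] [] rfl ?_
  refine Run.weaken (Run.block_seq (T := k * 11 + 1) (((Run.down (N := k)
      (b := 9) [0, 1, 3, 4] [] [] [] rfl (by decide)
    (fun i τ => τ.reg 0 < 2 ^ i ∧ τ.reg 1 < 2 ^ i ∧ τ.reg 3 + (τ.reg 0 &&& τ.reg 1) = x &&& y)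
    ?_ ?_ ?_ ?_ ?_ ?_).post ?_).weaken ?_)) (by simp; omega)
  · intro i σ x h; simpa using h
  · simpa using hz
  · simpa using ho
  · simpa using hk
  · simpa [hx, hy] using ⟨hxk, hyk⟩
  · rintro i hi τ hτ hf ⟨h0, h1, h3⟩
    have hp : τ.mem 4 i = 2 ^ i := by simp [hf.mem, hP i hi]
    rw [pow_succ] at h0 h1
    refine Run.weaken (Run.block_seq (Run.ite (T := 6) (fun hb => ?_) (fun hb => ?_))) (by simp)
    · simp [RamTest.Holds, hτ, hp] at hb
      refine (Run.ite (T := 2) (fun hb' => ?_) (fun hb' => ?_)).weaken (by simp)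
      · simp [RamTest.Holds, hτ, hp] at hb'
        exact (Run.block (by simp [hb, hb', h3])).weaken (by simp)
      · simp [RamTest.Holds, hτ, hp] at hb'
        refine Run.block ?_
        obtain ⟨b, hbe⟩ := Nat.exists_eq_add_of_le hb'
        rw [hbe, and_two_pow_add_right hb] at h3
        simp [hτ, hp, hb, hbe, h3]; omega
    · simp [RamTest.Holds, hτ, hp] at hb
      obtain ⟨a, ha⟩ := Nat.exists_eq_add_of_le hb
      refine Run.weaken (Run.block_seq (Run.ite (T := 3) (fun hb' => ?_) (fun hb' => ?_))) (by simp)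
      · simp [RamTest.Holds, hτ, hp] at hb'
        rw [ha, Nat.and_comm, and_two_pow_add_right hb', Nat.and_comm] at h3
        exact (Run.block (by simp [hτ, hp, ha, hb', h3]; omega)).weaken (by simp)
      · simp [RamTest.Holds, hτ, hp] at hb'
        obtain ⟨b, hbe⟩ := Nat.exists_eq_add_of_le hb'
        rw [ha, hbe, and_two_pow_add (by omega) (by omega)] at h3
        exact (Run.block (by simp [hτ, hp, ha, hbe]; omega)).weaken (by simp)
  · rintro τ ⟨⟨h0, h1, h3⟩, -⟩
    simp at h0 h1
    simpa [h0, h1] using h3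
  · simp

/-- Array `arr` := the bits of register `0`, which has at most as many bits as register `2`
says. -/
def unpackProg (arr : ℕ) : RamProg :=
  .down 2 (.seq (.block [.load 4 4 2]) (.ite (.lt 0 4) (.block [.store arr 2 60])
    (.block [.sub 0 0 4, .store arr 2 61])))

/-- The same peeling: the remainder agrees with `x` below position `i`, and the cells from `i` on
are final. -/
theorem unpackProg_run {arr : ℕ} (harr : arr ≠ 4) {σ : RamState} {x k : ℕ} (hz : σ.reg 60 = 0)
    (ho : σ.reg 61 = 1)
    (hx : σ.reg 0 = x) (hk : σ.reg 2 = k) (hxk : x < 2 ^ k)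
    (hP : ∀ i < k, σ.mem 4 i = 2 ^ i) :
    Run (unpackProg arr) σ (k * 8 + 1) fun σ' => (∀ i < k, σ'.mem arr i = (x.testBit i).toNat) ∧
      Frame [0, 2, 4] [arr] [] [] σ σ' := by
  refine Run.frame [0, 2, 4] [arr] [] [] (by simp [unpackProg, RamProg.down, RamProg.block,
      RamProg.within, RamInstr.within]) ?_
  refine ((Run.down (N := k) (b := 6) [0, 4] [arr] [] [] (by simp [RamProg.block, RamProg.within,
      RamInstr.within]) (by decide)
    (fun i τ => τ.reg 0 < 2 ^ i ∧ (∀ j < i, (τ.reg 0).testBit j = x.testBit j) ∧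
      ∀ j < k, i ≤ j → τ.mem arr j = (x.testBit j).toNat)
    ?_ hz ho hk ?_ ?_).post ?_).weaken ?_
  · intro i σ x h; simpa using h
  · simp [hx, hxk]; omega
  · rintro i hi τ hτ hf ⟨h0, h1, h3⟩
    have hp : τ.mem 4 i = 2 ^ i := by rw [hf.mem _ (by simpa using harr.symm), hP i hi]
    have h60 : τ.reg 60 = 0 := by simp [hf.reg, hz]
    have h61 : τ.reg 61 = 1 := by simp [hf.reg, ho]
    rw [pow_succ] at h0
    have h1i := h1 i (by omega)
    refine Run.weaken (Run.block_seq (Run.ite (T := 3) (fun hb => ?_) (fun hb => ?_))) (by simp)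
    · simp [RamTest.Holds, hτ, hp] at hb
      refine (Run.block ?_).weaken (by simp)
      rw [Nat.testBit_lt_two_pow hb] at h1i
      simp [hτ, h60, hb]
      refine ⟨fun j hj => h1 j (by omega), fun j hj hij => ?_⟩
      by_cases hji : j = i
      · subst hji; simp [← h1i]
      · simp [hji, h3 j hj (by omega)]
    · simp [RamTest.Holds, hτ, hp] at hb
      obtain ⟨a, ha⟩ := Nat.exists_eq_add_of_le hb
      have hai : a < 2 ^ i := by omega
      rw [ha, Nat.testBit_two_pow_add_eq, Nat.testBit_lt_two_pow hai] at h1i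
      refine (Run.block ?_).weaken (by simp)
      simp [hτ, h61, ha, hp, hai]
      refine ⟨fun j hj => ?_, fun j hj hij => ?_⟩
      · rw [← h1 j (by omega), ha, Nat.testBit_two_pow_add_gt hj]
      by_cases hji : j = i
      · subst hji; simp [← h1i]
      · simp [hji, h3 j hj (by omega)]
  · rintro τ ⟨⟨h0, h1, h3⟩, -⟩
    exact fun i hi => h3 i hi (by omega)
  · simp

/-- Register `3` := the integer with the bits `1, …, m` of array `19`, where `m` is in register
`20`. -/
def packProg : RamProg :=
  .seq (.block [.const 3 0]) (.up 4 20 (.seq (.block [.add 5 4 61, .load 5 19 5])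
    (.ite (.eq 5 61) (.block [.load 5 4 4, .add 3 3 5]) (.block []))))

/-- Bit `i` comes from cell `i + 1`, because cell `0` will collect the contributions of incompatible
pairs and must be ignored. -/
theorem packProg_run {σ : RamState} {m : ℕ} {b : ℕ → Bool} (ho : σ.reg 61 = 1)
    (hm : σ.reg 20 = m) (hT : ∀ i < m, σ.mem 19 (i + 1) = (b i).toNat)
    (hP : ∀ i < m, σ.mem 4 i = 2 ^ i) :
    Run packProg σ (m * 9 + 4) fun σ' => (σ'.reg 3 < 2 ^ m ∧
      ∀ i < m, (σ'.reg 3).testBit i = b i) ∧ Frame [0, 3, 4, 5] [] [] [] σ σ' := by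
  refine Run.frame [0, 3, 4, 5] [] [] [] rfl ?_
  refine Run.weaken (Run.block_seq ((Run.up (N := m) (b := 7) [0, 3, 5] [] [] [] rfl (by decide)
    (fun i τ => τ.reg 3 < 2 ^ i ∧ ∀ j < i, (τ.reg 3).testBit j = b j)
    ?_ ?_ ?_ ?_ ?_).post ?_)) (by simp; omega)
  · intro i σ x h; simpa using h
  · simpa using ho
  · simpa using hm
  · simp
  · rintro i hi τ hτ hf ⟨h0, h1⟩
    have hp : τ.mem 4 i = 2 ^ i := by simp [hf.mem, hP i hi]
    have ht : τ.mem 19 (i + 1) = (b i).toNat := by simp [hf.mem, hT i hi]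
    have h61 : τ.reg 61 = 1 := by simp [hf.reg, ho]
    refine Run.weaken (Run.block_seq (Run.ite (T := 3) (fun hb => ?_) (fun hb => ?_))) (by simp)
    · simp [RamTest.Holds, hτ, h61, ht] at hb
      refine (Run.block ?_).weaken (by simp)
      simp [hτ, hp, add_comm _ (2 ^ i)]
      refine ⟨by rw [pow_succ]; omega, fun j hj => ?_⟩
      rcases Nat.lt_or_eq_of_le hj with h | rfl
      · rw [Nat.testBit_two_pow_add_gt h, h1 j h]
      · rw [Nat.testBit_two_pow_add_eq, Nat.testBit_lt_two_pow h0, hb]; rfl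
    · simp [RamTest.Holds, hτ, h61, ht] at hb
      refine (Run.block ?_).weaken (by simp)
      simp
      refine ⟨by rw [pow_succ]; omega, fun j hj => ?_⟩
      rcases Nat.lt_or_eq_of_le hj with h | rfl
      · exact h1 j h
      · rw [Nat.testBit_lt_two_pow h0, hb]
  · rintro τ ⟨h, -⟩
    exact h

/-! ### Consistent cuts -/

section Cuts

set_option linter.unusedSectionVars false

variable {V : Type*} [Fintype V] [DecidableEq V] (G : SimpleGraph V)

open Classical in
/-- The neighbors of `S` outside `A`. -/
noncomputable def outNbrs (A S : Finset V) : Finset V :=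
  Finset.univ.filter fun u => u ∉ A ∧ ∃ x ∈ S, G.Adj x u

/-- No edge joins `P` and `Q`. -/
def NoEdge (P Q : Finset V) : Prop := ∀ x ∈ P, ∀ y ∈ Q, ¬ G.Adj x y

open Classical in
/-- The sides that contain `r` of the consistent cuts of `X`, if `r` is in `X`, and the sides of
all consistent cuts otherwise. -/
noncomputable def cuts (r : V) (X : Finset V) : Finset (Finset V) :=
  X.powerset.filter fun P => NoEdge G P (X \ P) ∧ r ∉ X \ P

variable {G}

theorem mem_outNbrs {A S : Finset V} {u : V} :
    u ∈ outNbrs G A S ↔ u ∉ A ∧ ∃ x ∈ S, G.Adj x u := by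
  simp [outNbrs]

theorem mem_cuts {r : V} {X P : Finset V} :
    P ∈ cuts G r X ↔ P ⊆ X ∧ NoEdge G P (X \ P) ∧ r ∉ X \ P := by
  simp [cuts]

theorem NoEdge.symm {P Q : Finset V} (h : NoEdge G P Q) : NoEdge G Q P :=
  fun x hx y hy ha => h y hy x hx ha.symm

theorem NoEdge.mono {P Q P' Q' : Finset V} (h : NoEdge G P Q) (hP : P' ⊆ P) (hQ : Q' ⊆ Q) :
    NoEdge G P' Q' :=
  fun x hx y hy => h x (hP hx) y (hQ hy)

theorem disjoint_outNbrs_iff {A P Q : Finset V} (hQ : Disjoint A Q) :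
    Disjoint (outNbrs G A P) Q ↔ NoEdge G P Q := by
  rw [Finset.disjoint_left]
  constructor
  · intro h x hx y hy ha
    exact h (mem_outNbrs.2 ⟨Finset.disjoint_right.1 hQ hy, x, hx, ha⟩) hy
  · intro h u hu huQ
    obtain ⟨-, x, hx, ha⟩ := mem_outNbrs.1 hu
    exact h x hx u huQ ha

/-- This allows the outside neighbors of a union to be computed from stored neighbor sets, without
another look at the graph. -/
theorem outNbrs_union {A B P Q : Finset V} :
    outNbrs G (A ∪ B) (P ∪ Q) = (outNbrs G A P ∪ outNbrs G B Q) \ (A ∪ B) := by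
  ext u
  simp only [mem_outNbrs, Finset.mem_union, Finset.mem_sdiff, not_or, or_and_right, exists_or]
  by_cases hA : u ∈ A <;> by_cases hB : u ∈ B <;> simp [hA, hB]

/-- Cuts are even in number unless the set is connected. -/
theorem card_cuts_ne_zero_iff {r : V} {X : Finset V} (hr : r ∈ X) :
    ((cuts G r X).card : ZMod 2) ≠ 0 ↔ (G.induce (X : Set V)).Connected := by
  classical
  constructor
  · intro hodd
    rw [SimpleGraph.connected_iff_exists_forall_reachable]
    refine ⟨⟨r, hr⟩, ?_⟩
    by_contra hcon
    push Not at hcon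
    obtain ⟨y, hy⟩ := hcon
    -- `D` is the part of `X` that `r` does not reach. No edge of `X` leaves it and it avoids `r`,
    -- so exchanging sides on `D` maps cuts to cuts. As `D` is nonempty, this involution has no
    -- fixed point and the cuts cancel in pairs.
    set D : Finset V := X.filter fun v => ∃ h : v ∈ (X : Set V),
      ¬ (G.induce (X : Set V)).Reachable ⟨r, hr⟩ ⟨v, h⟩ with hD
    have hyD : (y : V) ∈ D := by simp only [hD, Finset.mem_filter]; exact ⟨y.2, y.2, hy⟩
    have hDX : D ⊆ X := Finset.filter_subset _ _
    have hrD : r ∉ D := by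
      simp only [hD, Finset.mem_filter, not_and, not_exists, not_not]
      intro _ _; exact SimpleGraph.Reachable.refl _
    have hDc : ∀ u ∈ X, ∀ v ∈ X, G.Adj u v → (u ∈ D ↔ v ∈ D) := by
      have : ∀ u ∈ X, ∀ v ∈ X, G.Adj u v → u ∈ D → v ∈ D := by
        intro u hu v hv ha hD'
        simp only [hD, Finset.mem_filter] at hD' ⊢
        obtain ⟨_, h, hn⟩ := hD'
        refine ⟨hv, hv, fun hre => hn (hre.trans ?_)⟩
        exact SimpleGraph.Adj.reachable (by simpa using ha.symm)
      intro u hu v hv ha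
      exact ⟨this u hu v hv ha, this v hv u hu ha.symm⟩
    apply hodd
    have : ∑ P ∈ cuts G r X, (1 : ZMod 2) = 0 := by
      refine Finset.sum_involution (fun P _ => symmDiff P D) ?_ ?_ ?_ ?_
      · intro _ _; decide
      · intro P _ _ h
        have : D = ⊥ := symmDiff_eq_left.1 h
        rw [this] at hyD
        simp at hyD
      · intro P hP
        rw [mem_cuts] at hP ⊢
        obtain ⟨hPX, hPe, hPr⟩ := hP
        refine ⟨?_, ?_, ?_⟩
        · intro v hv
          rcases Finset.mem_symmDiff.1 hv with h | h
          · exact hPX h.1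
          · exact hDX h.1
        · intro u hu v hv ha
          rw [Finset.mem_sdiff] at hv
          have huX : u ∈ X := by
            rcases Finset.mem_symmDiff.1 hu with h | h
            · exact hPX h.1
            · exact hDX h.1
          have h1 := hDc u huX v hv.1 ha
          have h2 : u ∈ P → v ∈ P := fun hu => by
            by_contra hv'
            exact hPe u hu v (Finset.mem_sdiff.2 ⟨hv.1, hv'⟩) ha
          have h3 : v ∈ P → u ∈ P := fun hu => by
            by_contra hv'
            exact hPe v hu u (Finset.mem_sdiff.2 ⟨huX, hv'⟩) ha.symm
          simp only [Finset.mem_symmDiff] at hu hv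
          tauto
        · simp only [Finset.mem_sdiff, Finset.mem_symmDiff] at hPr ⊢
          tauto
      · intro P _; simp
    simpa using this
  · intro hcon
    -- Membership in the side of `r` propagates along walks, so a connected set has one cut only.
    have : cuts G r X = {X} := by
      ext P
      rw [mem_cuts, Finset.mem_singleton]
      constructor
      · rintro ⟨hPX, hPe, hPr⟩
        refine hPX.antisymm fun v hv => ?_
        have hrP : r ∈ P := by
          by_contra h
          exact hPr (Finset.mem_sdiff.2 ⟨hr, h⟩)
        obtain ⟨p⟩ := hcon.preconnected ⟨r, hr⟩ ⟨v, hv⟩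
        have : ∀ a b : (X : Set V), (G.induce (X : Set V)).Walk a b → (a : V) ∈ P →
            (b : V) ∈ P := by
          intro a b p
          induction p with
          | nil => exact id
          | @cons u v w h p ih =>
            intro hu
            refine ih ?_
            by_contra hv
            exact hPe _ hu v (Finset.mem_sdiff.2 ⟨v.2, hv⟩) (by simpa using h)
        exact this _ _ p hrP
      · rintro rfl
        simp [NoEdge]
    simp [this]

/-! ### Classes of cuts and cut vectors -/

/-- The number modulo two of the cuts of `X` in each class of pairs of sets. -/
noncomputable def cutVec (G : SimpleGraph V) (r : V) (κ : Finset V → Finset V → ℕ) (X : Finset V) :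
    ℕ → ZMod 2 :=
  ∑ P ∈ cuts G r X, Pi.single (κ P (X \ P)) 1

theorem cutVec_apply {r : V} {κ : Finset V → Finset V → ℕ} {X : Finset V} {p : ℕ} :
    cutVec G r κ X p = ∑ P ∈ cuts G r X, if κ P (X \ P) = p then 1 else 0 := by
  simp [cutVec, Pi.single_apply, eq_comm]

/-- `κ` assigns to any two sets that are not joined by an edge a pair `(S₁ i, S₂ i)` of sets with
the same neighbors outside `A`. -/
structure IsClassifier (G : SimpleGraph V) (A : Finset V) (m : ℕ) (S₁ S₂ : ℕ → Finset V)
    (κ : Finset V → Finset V → ℕ) : Prop where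
  subset₁ : ∀ p < m, S₁ p ⊆ A
  subset₂ : ∀ p < m, S₂ p ⊆ A
  lt : ∀ P ⊆ A, ∀ Q ⊆ A, Disjoint P Q → NoEdge G P Q → κ P Q < m
  nbrs₁ : ∀ P ⊆ A, ∀ Q ⊆ A, Disjoint P Q → NoEdge G P Q →
    outNbrs G A (S₁ (κ P Q)) = outNbrs G A P
  nbrs₂ : ∀ P ⊆ A, ∀ Q ⊆ A, Disjoint P Q → NoEdge G P Q →
    outNbrs G A (S₂ (κ P Q)) = outNbrs G A Q

/-- Every cut has exactly one class, and it is below `m`, so the coordinates together count each cut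
once. This makes the parity of the number of cuts a linear functional of the vector. -/
theorem IsClassifier.sum_cutVec {A X : Finset V} {m : ℕ} {S₁ S₂ : ℕ → Finset V}
    {κ : Finset V → Finset V → ℕ} (h : IsClassifier G A m S₁ S₂ κ) (r : V) (hX : X ⊆ A) :
    ∑ p ∈ Finset.range m, cutVec G r κ X p = (cuts G r X).card := by
  simp_rw [cutVec_apply]
  rw [Finset.sum_comm]
  rw [Finset.card_eq_sum_ones, Nat.cast_sum]
  refine Finset.sum_congr rfl fun P hP => ?_
  rw [mem_cuts] at hP
  have := h.lt P (hP.1.trans hX) (X \ P) (Finset.sdiff_subset.trans hX) Finset.disjoint_sdiff hP.2.1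
  simp [this]

/-- The table `J` gives for two compatible pairs of sets the class of their union, plus one, and
`0` for incompatible ones. -/
structure IsJoinTable (G : SimpleGraph V) (A B : Finset V) (ma mb m : ℕ)
    (S₁ S₂ T₁ T₂ U₁ U₂ : ℕ → Finset V) (J : ℕ → ℕ → ℕ) : Prop where
  subset₁ : ∀ r < m, U₁ r ⊆ A ∪ B
  subset₂ : ∀ r < m, U₂ r ⊆ A ∪ B
  pos_iff : ∀ p < ma, ∀ q < mb, 0 < J p q ↔
    Disjoint (outNbrs G A (S₁ p)) (T₂ q) ∧ Disjoint (outNbrs G A (S₂ p)) (T₁ q)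
  le : ∀ p < ma, ∀ q < mb, J p q ≤ m
  nbrs₁ : ∀ p < ma, ∀ q < mb, 0 < J p q →
    outNbrs G (A ∪ B) (U₁ (J p q - 1)) = outNbrs G (A ∪ B) (S₁ p ∪ T₁ q)
  nbrs₂ : ∀ p < ma, ∀ q < mb, 0 < J p q →
    outNbrs G (A ∪ B) (U₂ (J p q - 1)) = outNbrs G (A ∪ B) (S₂ p ∪ T₂ q)

/-- The classes of the unions. -/
def joinClass (A B : Finset V) (J : ℕ → ℕ → ℕ) (κa κb : Finset V → Finset V → ℕ)
    (P Q : Finset V) : ℕ :=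
  J (κa (P ∩ A) (Q ∩ A)) (κb (P ∩ B) (Q ∩ B)) - 1

/-! ### Joining two disjoint sets of vertices -/

section Join

variable {A B : Finset V} {ma mb m : ℕ} {S₁ S₂ T₁ T₂ U₁ U₂ : ℕ → Finset V}
  {κa κb : Finset V → Finset V → ℕ} {J : ℕ → ℕ → ℕ}

/-- Testing representatives is as good as testing the sets themselves. Whether edges join a subset
of `A` to a subset of `B` depends only on the outside neighbors of the former, so it may be
exchanged for its representative; by symmetry so may the latter. -/
theorem IsJoinTable.pos_iff_noEdge (hJ : IsJoinTable G A B ma mb m S₁ S₂ T₁ T₂ U₁ U₂ J)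
    (ha : IsClassifier G A ma S₁ S₂ κa) (hb : IsClassifier G B mb T₁ T₂ κb) (hAB : Disjoint A B)
    {P Q P' Q' : Finset V} (hP : P ⊆ A) (hQ : Q ⊆ A) (hd : Disjoint P Q) (he : NoEdge G P Q)
    (hP' : P' ⊆ B) (hQ' : Q' ⊆ B) (hd' : Disjoint P' Q') (he' : NoEdge G P' Q') :
    0 < J (κa P Q) (κb P' Q') ↔ NoEdge G P Q' ∧ NoEdge G Q P' := by
  have hp := ha.lt P hP Q hQ hd he
  have hq := hb.lt P' hP' Q' hQ' hd' he'
  have key : ∀ {S T P Q : Finset V}, S ⊆ A → T ⊆ B → P ⊆ A → Q ⊆ B →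
      outNbrs G A S = outNbrs G A P → outNbrs G B T = outNbrs G B Q →
      (Disjoint (outNbrs G A S) T ↔ NoEdge G P Q) := by
    intro S T P Q hS hT hP hQ h1 h2
    rw [h1, disjoint_outNbrs_iff (hAB.mono_right hT)]
    refine Iff.trans ⟨NoEdge.symm, NoEdge.symm⟩ ?_
    rw [← disjoint_outNbrs_iff (A := B) (hAB.symm.mono_right hP), h2,
      disjoint_outNbrs_iff (hAB.symm.mono_right hP)]
    exact ⟨NoEdge.symm, NoEdge.symm⟩
  rw [hJ.pos_iff _ hp _ hq,
    key (ha.subset₁ _ hp) (hb.subset₂ _ hq) hP hQ' (ha.nbrs₁ P hP Q hQ hd he)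
      (hb.nbrs₂ _ hP' _ hQ' hd' he'),
    key (ha.subset₂ _ hp) (hb.subset₁ _ hq) hQ hP' (ha.nbrs₂ P hP Q hQ hd he)
      (hb.nbrs₁ _ hP' _ hQ' hd' he')]

theorem union_inter_split {A B P : Finset V} (hP : P ⊆ A ∪ B) : (P ∩ A) ∪ (P ∩ B) = P := by
  rw [← Finset.inter_union_distrib_left, Finset.inter_eq_left.2 hP]

/-- A pair without joining edges restricts to such pairs in `A` and in `B`, and these are
compatible. Hence the table entry is positive and the subtraction in `joinClass` is not truncated.
-/
theorem IsJoinTable.isClassifier (hJ : IsJoinTable G A B ma mb m S₁ S₂ T₁ T₂ U₁ U₂ J)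
    (ha : IsClassifier G A ma S₁ S₂ κa) (hb : IsClassifier G B mb T₁ T₂ κb) (hAB : Disjoint A B) :
    IsClassifier G (A ∪ B) m U₁ U₂ (joinClass A B J κa κb) := by
  have key : ∀ P ⊆ A ∪ B, ∀ Q ⊆ A ∪ B, Disjoint P Q → NoEdge G P Q →
      joinClass A B J κa κb P Q < m ∧
      outNbrs G (A ∪ B) (U₁ (joinClass A B J κa κb P Q)) = outNbrs G (A ∪ B) P ∧
      outNbrs G (A ∪ B) (U₂ (joinClass A B J κa κb P Q)) = outNbrs G (A ∪ B) Q := by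
    intro P hP Q hQ hd he
    have iA : ∀ {P : Finset V}, P ∩ A ⊆ A := by intro P; exact Finset.inter_subset_right
    have iB : ∀ {P : Finset V}, P ∩ B ⊆ B := by intro P; exact Finset.inter_subset_right
    have iP : ∀ {P A : Finset V}, P ∩ A ⊆ P := by intro P A; exact Finset.inter_subset_left
    have hda : Disjoint (P ∩ A) (Q ∩ A) := hd.mono iP iP
    have hdb : Disjoint (P ∩ B) (Q ∩ B) := hd.mono iP iP
    have hea : NoEdge G (P ∩ A) (Q ∩ A) := he.mono iP iP
    have heb : NoEdge G (P ∩ B) (Q ∩ B) := he.mono iP iP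
    have hp := ha.lt _ iA _ iA hda hea
    have hq := hb.lt _ iB _ iB hdb heb
    have hpos := (hJ.pos_iff_noEdge ha hb hAB iA iA hda hea iB iB hdb heb).2
      ⟨he.mono iP iP, he.symm.mono iP iP⟩
    have hle := hJ.le _ hp _ hq
    refine ⟨?_, ?_, ?_⟩
    · unfold joinClass; omega
    · rw [joinClass, hJ.nbrs₁ _ hp _ hq hpos, outNbrs_union,
        ha.nbrs₁ _ iA _ iA hda hea, hb.nbrs₁ _ iB _ iB hdb heb, ← outNbrs_union,
        union_inter_split hP]
    · rw [joinClass, hJ.nbrs₂ _ hp _ hq hpos, outNbrs_union,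
        ha.nbrs₂ _ iA _ iA hda hea, hb.nbrs₂ _ iB _ iB hdb heb, ← outNbrs_union,
        union_inter_split hQ]
  exact ⟨hJ.subset₁, hJ.subset₂, fun P hP Q hQ hd he => (key P hP Q hQ hd he).1,
    fun P hP Q hQ hd he => (key P hP Q hQ hd he).2.1,
    fun P hP Q hQ hd he => (key P hP Q hQ hd he).2.2⟩

/-- The bilinear map that a join table induces on vectors. -/
def joinForm (ma mb : ℕ) (J : ℕ → ℕ → ℕ) :
    (ℕ → ZMod 2) →ₗ[ZMod 2] (ℕ → ZMod 2) →ₗ[ZMod 2] (ℕ → ZMod 2) :=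
  LinearMap.mk₂ (ZMod 2)
    (fun x y r => ∑ p ∈ Finset.range ma, ∑ q ∈ Finset.range mb,
      if J p q = r + 1 then x p * y q else 0)
    (fun x x' y => by
      ext r; simp only [Pi.add_apply, ← Finset.sum_add_distrib]
      refine Finset.sum_congr rfl fun p _ => Finset.sum_congr rfl fun q _ => ?_
      split_ifs <;> ring)
    (fun c x y => by
      ext r; simp only [Pi.smul_apply, smul_eq_mul, Finset.mul_sum]
      refine Finset.sum_congr rfl fun p _ => Finset.sum_congr rfl fun q _ => ?_
      split_ifs <;> ring)
    (fun x y y' => by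
      ext r; simp only [Pi.add_apply, ← Finset.sum_add_distrib]
      refine Finset.sum_congr rfl fun p _ => Finset.sum_congr rfl fun q _ => ?_
      split_ifs <;> ring)
    (fun c x y => by
      ext r; simp only [Pi.smul_apply, smul_eq_mul, Finset.mul_sum]
      refine Finset.sum_congr rfl fun p _ => Finset.sum_congr rfl fun q _ => ?_
      split_ifs <;> ring)

theorem joinForm_apply (x y : ℕ → ZMod 2) (r : ℕ) :
    joinForm ma mb J x y r = ∑ p ∈ Finset.range ma, ∑ q ∈ Finset.range mb,
      if J p q = r + 1 then x p * y q else 0 := rfl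

/-- The cuts of `X ∪ Y` correspond to the pairs of a cut of `X` and a cut of `Y` for which no edge
runs between opposite sides. This last condition says that the table entry is positive, so the cuts
in a class are counted by a sum of products. -/
theorem IsJoinTable.cutVec_union (hJ : IsJoinTable G A B ma mb m S₁ S₂ T₁ T₂ U₁ U₂ J)
    (ha : IsClassifier G A ma S₁ S₂ κa) (hb : IsClassifier G B mb T₁ T₂ κb) (hAB : Disjoint A B)
    (r : V) {X Y : Finset V} (hX : X ⊆ A) (hY : Y ⊆ B) :
    cutVec G r (joinClass A B J κa κb) (X ∪ Y) =
      joinForm ma mb J (cutVec G r κa X) (cutVec G r κb Y) := by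
  ext i
  have hcX : ∀ {P}, P ∈ cuts G r X → P ⊆ A ∧ X \ P ⊆ A ∧ κa P (X \ P) < ma := fun {P} hP => by
    rw [mem_cuts] at hP
    have h1 := hP.1.trans hX
    have h2 : X \ P ⊆ A := Finset.sdiff_subset.trans hX
    exact ⟨h1, h2, ha.lt _ h1 _ h2 Finset.disjoint_sdiff hP.2.1⟩
  have hcY : ∀ {P}, P ∈ cuts G r Y → P ⊆ B ∧ Y \ P ⊆ B ∧ κb P (Y \ P) < mb := fun {P} hP => by
    rw [mem_cuts] at hP
    have h1 := hP.1.trans hY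
    have h2 : Y \ P ⊆ B := Finset.sdiff_subset.trans hY
    exact ⟨h1, h2, hb.lt _ h1 _ h2 Finset.disjoint_sdiff hP.2.1⟩
  have hXY : Disjoint X Y := hAB.mono hX hY
  -- the right-hand side counts pairs of cuts
  have hR : joinForm ma mb J (cutVec G r κa X) (cutVec G r κb Y) i =
      ∑ P ∈ cuts G r X, ∑ Q ∈ cuts G r Y,
        if J (κa P (X \ P)) (κb Q (Y \ Q)) = i + 1 then 1 else 0 := by
    rw [joinForm_apply]
    simp_rw [cutVec_apply, Finset.sum_mul_sum]
    have : ∀ p ∈ Finset.range ma, ∀ q ∈ Finset.range mb,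
        (if J p q = i + 1 then ∑ P ∈ cuts G r X, ∑ Q ∈ cuts G r Y,
          (if κa P (X \ P) = p then (1 : ZMod 2) else 0) * (if κb Q (Y \ Q) = q then 1 else 0)
          else 0) = ∑ P ∈ cuts G r X, ∑ Q ∈ cuts G r Y,
            if κa P (X \ P) = p then (if κb Q (Y \ Q) = q then
              (if J (κa P (X \ P)) (κb Q (Y \ Q)) = i + 1 then 1 else 0) else 0) else 0 := by
      intro p _ q _
      split_ifs with h
      · refine Finset.sum_congr rfl fun P _ => Finset.sum_congr rfl fun Q _ => ?_
        split_ifs <;> simp_all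
      · symm
        refine Finset.sum_eq_zero fun P _ => Finset.sum_eq_zero fun Q _ => ?_
        split_ifs <;> simp_all
    rw [Finset.sum_congr rfl fun p hp => Finset.sum_congr rfl (this p hp)]
    have hcomm : ∀ p, ∑ q ∈ Finset.range mb, ∑ P ∈ cuts G r X, ∑ Q ∈ cuts G r Y,
        (if κa P (X \ P) = p then (if κb Q (Y \ Q) = q then
          (if J (κa P (X \ P)) (κb Q (Y \ Q)) = i + 1 then (1 : ZMod 2) else 0) else 0) else 0) =
        ∑ P ∈ cuts G r X, ∑ Q ∈ cuts G r Y, ∑ q ∈ Finset.range mb,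
        (if κa P (X \ P) = p then (if κb Q (Y \ Q) = q then
          (if J (κa P (X \ P)) (κb Q (Y \ Q)) = i + 1 then (1 : ZMod 2) else 0) else 0) else 0) :=
              by
      intro p
      rw [Finset.sum_comm]
      exact Finset.sum_congr rfl fun P _ => Finset.sum_comm
    simp_rw [hcomm]
    rw [Finset.sum_comm]
    refine Finset.sum_congr rfl fun P hP => ?_
    rw [Finset.sum_comm]
    refine Finset.sum_congr rfl fun Q hQ => ?_
    rw [Finset.sum_eq_single (κa P (X \ P)), Finset.sum_eq_single (κb Q (Y \ Q))]
    · simp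
    · intro q _ hq; simp [Ne.symm hq]
    · intro h; exact absurd (Finset.mem_range.2 (hcY hQ).2.2) h
    · intro p _ hp
      simp [Ne.symm hp]
    · intro h; exact absurd (Finset.mem_range.2 (hcX hP).2.2) h
  rw [hR, cutVec_apply, ← Finset.sum_product', ← Finset.sum_filter, ← Finset.sum_filter]
  have hJc : ∀ P ∈ cuts G r X, ∀ Q ∈ cuts G r Y,
      (0 < J (κa P (X \ P)) (κb Q (Y \ Q)) ↔ NoEdge G P (Y \ Q) ∧ NoEdge G (X \ P) Q) := by
    intro P hP Q hQ
    exact hJ.pos_iff_noEdge ha hb hAB (hcX hP).1 (hcX hP).2.1 Finset.disjoint_sdiff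
      (mem_cuts.1 hP).2.1 (hcY hQ).1 (hcY hQ).2.1 Finset.disjoint_sdiff (mem_cuts.1 hQ).2.1
  have hsplit : ∀ P ∈ cuts G r X, ∀ Q ∈ cuts G r Y, (P ∪ Q) ∩ A = P ∧ (P ∪ Q) ∩ B = Q ∧
      ((X ∪ Y) \ (P ∪ Q)) ∩ A = X \ P ∧ ((X ∪ Y) \ (P ∪ Q)) ∩ B = Y \ Q := by
    intro P hP Q hQ
    have hPX := (mem_cuts.1 hP).1
    have hQY := (mem_cuts.1 hQ).1
    have hA : ∀ v ∈ A, v ∉ B := fun v hv => Finset.disjoint_left.1 hAB hv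
    refine ⟨?_, ?_, ?_, ?_⟩ <;> ext v <;>
      simp only [Finset.mem_union, Finset.mem_inter, Finset.mem_sdiff] <;>
      have h1 := @hPX v <;> have h2 := @hQY v <;> have h3 := hA v <;> have h4 := @hX v <;>
      have h5 := @hY v <;> tauto
  symm
  refine Finset.sum_bij' (fun PQ _ => PQ.1 ∪ PQ.2) (fun R _ => (R ∩ A, R ∩ B)) ?_ ?_ ?_ ?_ ?_
  · rintro ⟨P, Q⟩ h
    simp only [Finset.mem_filter, Finset.mem_product] at h ⊢
    obtain ⟨⟨hP, hQ⟩, hJi⟩ := h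
    obtain ⟨h1, h2, h3, h4⟩ := hsplit P hP Q hQ
    have hn := (hJc P hP Q hQ).1 (by omega)
    refine ⟨?_, ?_⟩
    · rw [mem_cuts] at hP hQ ⊢
      refine ⟨Finset.union_subset_union hP.1 hQ.1, ?_, ?_⟩
      · intro x hx y hy hxy
        have hy' : y ∈ X \ P ∨ y ∈ Y \ Q := by
          simp only [Finset.mem_union, Finset.mem_sdiff] at hy ⊢; tauto
        rcases Finset.mem_union.1 hx with hx | hx <;> rcases hy' with hy | hy
        · exact hP.2.1 x hx y hy hxy
        · exact hn.1 x hx y hy hxy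
        · exact hn.2 y hy x hx hxy.symm
        · exact hQ.2.1 x hx y hy hxy
      · have h1 := hP.2.2
        have h2 := hQ.2.2
        simp only [Finset.mem_union, Finset.mem_sdiff] at h1 h2 ⊢; tauto
    · rw [joinClass, h1, h2, h3, h4]; omega
  · intro R hR
    simp only [Finset.mem_filter, Finset.mem_product] at hR ⊢
    obtain ⟨hRc, hRi⟩ := hR
    rw [mem_cuts] at hRc
    have hA : ∀ v ∈ A, v ∉ B := fun v hv => Finset.disjoint_left.1 hAB hv
    have e1 : ((X ∪ Y) \ R) ∩ A = X \ (R ∩ A) := by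
      ext v
      have h4 := @hX v; have h5 := @hY v; have h6 := hA v;
      simp only [Finset.mem_union, Finset.mem_inter, Finset.mem_sdiff]; tauto
    have e2 : ((X ∪ Y) \ R) ∩ B = Y \ (R ∩ B) := by
      ext v
      have h4 := @hX v; have h5 := @hY v; have h6 := hA v;
      simp only [Finset.mem_union, Finset.mem_inter, Finset.mem_sdiff]; tauto
    have c1 : R ∩ A ∈ cuts G r X := by
      rw [mem_cuts, ← e1]
      refine ⟨?_, hRc.2.1.mono Finset.inter_subset_left Finset.inter_subset_left, ?_⟩
      · intro v hv
        rw [Finset.mem_inter] at hv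
        rcases Finset.mem_union.1 (hRc.1 hv.1) with h | h
        · exact h
        · exact absurd (hY h) (hA v hv.2)
      · exact fun h => hRc.2.2 (Finset.mem_inter.1 h).1
    have c2 : R ∩ B ∈ cuts G r Y := by
      rw [mem_cuts, ← e2]
      refine ⟨?_, hRc.2.1.mono Finset.inter_subset_left Finset.inter_subset_left, ?_⟩
      · intro v hv
        rw [Finset.mem_inter] at hv
        rcases Finset.mem_union.1 (hRc.1 hv.1) with h | h
        · exact absurd hv.2 (hA v (hX h))
        · exact h
      · exact fun h => hRc.2.2 (Finset.mem_inter.1 h).1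
    refine ⟨⟨c1, c2⟩, ?_⟩
    have := (hJc _ c1 _ c2).2 ⟨by
      rw [← e2]; exact hRc.2.1.mono Finset.inter_subset_left Finset.inter_subset_left, by
      rw [← e1]; exact hRc.2.1.symm.mono Finset.inter_subset_left Finset.inter_subset_left⟩
    rw [joinClass, e1, e2] at hRi
    omega
  · rintro ⟨P, Q⟩ h
    simp only [Finset.mem_filter, Finset.mem_product] at h
    obtain ⟨h1, h2, -, -⟩ := hsplit P h.1.1 Q h.1.2
    simp [h1, h2]
  · intro R hR
    simp only [Finset.mem_filter, mem_cuts] at hR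
    exact union_inter_split (hR.1.1.trans (Finset.union_subset_union hX hY))
  · intro _ _; rfl

end Join

/-! ### Lists of sets that represent all others -/

/-- The sets `X 0, …, X (L - 1)` contain the required vertices of `A`, and their cut vectors
generate the cut vector of any other such set, without exceeding its weight. -/
structure Represents (G : SimpleGraph V) (w : V → ℚ) (r : V) (K A : Finset V)
    (κ : Finset V → Finset V → ℕ) (L : ℕ) (X : ℕ → Finset V) : Prop where
  subset : ∀ e < L, X e ⊆ A
  required : ∀ e < L, K ∩ A ⊆ X e
  span : ∀ Y ⊆ A, K ∩ A ⊆ Y → cutVec G r κ Y ∈ Submodule.span (ZMod 2)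
    {x | ∃ e < L, ∑ v ∈ X e, w v ≤ ∑ v ∈ Y, w v ∧ cutVec G r κ (X e) = x}

/-- Split a set into its parts in `A` and `B`. Each part is spanned by listed vectors that are no
heavier, so by bilinearity the whole is spanned by products of such vectors, and weights add up,
whatever their signs. Through `hspan` only some of the unions have to be kept. -/
theorem Represents.join {w : V → ℚ} {r : V} {K A B : Finset V} {ma mb m La Lb L : ℕ}
    {S₁ S₂ T₁ T₂ U₁ U₂ : ℕ → Finset V} {κa κb : Finset V → Finset V → ℕ} {J : ℕ → ℕ → ℕ}
    {X Y Z : ℕ → Finset V} (hJ : IsJoinTable G A B ma mb m S₁ S₂ T₁ T₂ U₁ U₂ J)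
    (ha : IsClassifier G A ma S₁ S₂ κa) (hb : IsClassifier G B mb T₁ T₂ κb) (hAB : Disjoint A B)
    (hX : Represents G w r K A κa La X) (hY : Represents G w r K B κb Lb Y)
    (hZ : ∀ e < L, ∃ i < La, ∃ j < Lb, Z e = X i ∪ Y j)
    (hspan : ∀ i < La, ∀ j < Lb,
      joinForm ma mb J (cutVec G r κa (X i)) (cutVec G r κb (Y j)) ∈ Submodule.span (ZMod 2)
        {x | ∃ e < L, ∑ v ∈ Z e, w v ≤ ∑ v ∈ X i ∪ Y j, w v ∧
          cutVec G r (joinClass A B J κa κb) (Z e) = x}) :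
    Represents G w r K (A ∪ B) (joinClass A B J κa κb) L Z where
  subset e he := by
    obtain ⟨i, hi, j, hj, h⟩ := hZ e he
    rw [h]
    exact Finset.union_subset_union (hX.subset i hi) (hY.subset j hj)
  required e he := by
    obtain ⟨i, hi, j, hj, h⟩ := hZ e he
    rw [h, Finset.inter_union_distrib_left]
    exact Finset.union_subset_union (hX.required i hi) (hY.required j hj)
  span W hW hK := by
    have hWA : W ∩ A ⊆ A := Finset.inter_subset_right
    have hWB : W ∩ B ⊆ B := Finset.inter_subset_right
    have hsum : ∀ {P Q : Finset V}, P ⊆ A → Q ⊆ B →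
        ∑ v ∈ P ∪ Q, w v = ∑ v ∈ P, w v + ∑ v ∈ Q, w v := fun hP hQ =>
      Finset.sum_union (hAB.mono hP hQ)
    have h1 := hX.span (W ∩ A) hWA fun v hv => Finset.mem_inter.2
      ⟨hK (Finset.inter_subset_inter_left Finset.subset_union_left hv),
        (Finset.mem_inter.1 hv).2⟩
    have h2 := hY.span (W ∩ B) hWB fun v hv => Finset.mem_inter.2
      ⟨hK (Finset.inter_subset_inter_left Finset.subset_union_right hv),
        (Finset.mem_inter.1 hv).2⟩
    have h3 := Submodule.apply_mem_map₂ (joinForm ma mb J) h1 h2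
    rw [Submodule.map₂_span_span, ← hJ.cutVec_union ha hb hAB r hWA hWB,
      union_inter_split hW] at h3
    refine (Submodule.span_le.2 ?_) h3
    rintro _ ⟨_, ⟨i, hi, hwi, rfl⟩, _, ⟨j, hj, hwj, rfl⟩, rfl⟩
    refine Submodule.span_mono ?_ (hspan i hi j hj)
    rintro x ⟨e, he, hwe, rfl⟩
    refine ⟨e, he, hwe.trans ?_, rfl⟩
    rw [hsum (hX.subset i hi) (hY.subset j hj), ← union_inter_split hW, hsum hWA hWB]
    exact add_le_add hwi hwj

/-- Some represented set of at most the same weight is connected. -/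
theorem Represents.exists_connected {w : V → ℚ} {r : V} {K A : Finset V} {m L : ℕ}
    {S₁ S₂ X : ℕ → Finset V} {κ : Finset V → Finset V → ℕ} (ha : IsClassifier G A m S₁ S₂ κ)
    (hX : Represents G w r K A κ L X) {Y : Finset V} (hY : Y ⊆ A) (hK : K ⊆ Y) (hr : r ∈ K)
    (hc : (G.induce (Y : Set V)).Connected) :
    ∃ e < L, ∑ v ∈ X e, w v ≤ ∑ v ∈ Y, w v ∧ ((cuts G r (X e)).card : ZMod 2) ≠ 0 := by
  by_contra! hcon
  have h := hX.span Y hY (Finset.inter_subset_left.trans hK)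
  refine (card_cuts_ne_zero_iff (hK hr)).2 hc ?_
  rw [← ha.sum_cutVec r hY]
  -- The sum of the coordinates is the parity of the number of cuts. If it vanished at every listed
  -- set that is no heavier than `Y`, it would vanish at `Y`.
  have hle : Submodule.span (ZMod 2)
      {x | ∃ e < L, ∑ v ∈ X e, w v ≤ ∑ v ∈ Y, w v ∧ cutVec G r κ (X e) = x} ≤
      LinearMap.ker (∑ p ∈ Finset.range m, LinearMap.proj p : (ℕ → ZMod 2) →ₗ[ZMod 2] ZMod 2) := by
    rw [Submodule.span_le]
    rintro _ ⟨e, he, hw, rfl⟩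
    simp only [SetLike.mem_coe, LinearMap.mem_ker, LinearMap.sum_apply, LinearMap.proj_apply]
    rw [ha.sum_cutVec r (hX.subset e he)]
    exact hcon e he hw
  simpa using hle h

end Cuts

/-! ### Sets of vertices as integers -/

/-- A sum is the sum without carries plus the carries. This serves where there are no carries
(`testBit_code_ind`) and expresses `^^^` by operations that the machine can perform (`xor_eq_sub`).
-/
theorem add_eq_xor_add_two_mul_and (a b : ℕ) : a + b = (a ^^^ b) + 2 * (a &&& b) := by
  induction a using Nat.strong_induction_on generalizing b with
  | _ a ih =>
    rcases Nat.eq_zero_or_pos a with rfl | ha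
    · simp
    · have h := ih (a / 2) (by omega) (b / 2)
      rw [← Nat.xor_div_two, ← Nat.and_div_two] at h
      have h1 := Nat.xor_mod_two_eq (m := a) (n := b)
      have h2 : (a &&& b) % 2 = (a % 2) * (b % 2) := by
        have := Nat.and_mod_two_pow (a := a) (b := b) (n := 1)
        rw [pow_one] at this
        rw [this]
        rcases Nat.mod_two_eq_zero_or_one a with h | h <;>
          rcases Nat.mod_two_eq_zero_or_one b with h' | h' <;> simp [h, h']
      have h3 := Nat.div_add_mod a 2
      have h4 := Nat.div_add_mod b 2
      have h5 := Nat.div_add_mod (a &&& b) 2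
      have h6 := Nat.div_add_mod (a ^^^ b) 2
      rcases Nat.mod_two_eq_zero_or_one a with h7 | h7 <;>
        rcases Nat.mod_two_eq_zero_or_one b with h8 | h8 <;> rw [h7, h8] at h2 <;>
        generalize a &&& b = y at h h1 h2 h5 h6 ⊢ <;>
        generalize a ^^^ b = z at h h1 h2 h5 h6 ⊢ <;> omega

/-- The bits of an integer. -/
def bitVec (x : ℕ) (i : ℕ) : ZMod 2 := if x.testBit i then 1 else 0

theorem bitVec_xor (x y : ℕ) : bitVec (x ^^^ y) = bitVec x + bitVec y := by
  ext i
  simp only [bitVec, Pi.add_apply, Nat.testBit_xor]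
  cases x.testBit i <;> cases y.testBit i <;> simp
  decide

theorem bitVec_zero : bitVec 0 = 0 := by
  ext i; simp [bitVec]

/-! ### Subsets of `Fin n` as integers below `2 ^ n` -/

section Code

variable {n : ℕ}

/-- The integer whose bits indicate the elements of a set. -/
def code (S : Finset (Fin n)) : ℕ := ∑ v ∈ S, 2 ^ (v : ℕ)

@[simp] theorem code_empty : code (∅ : Finset (Fin n)) = 0 := rfl

@[simp] theorem code_singleton (v : Fin n) : code {v} = 2 ^ (v : ℕ) := by simp [code]

theorem code_union {S T : Finset (Fin n)} (h : Disjoint S T) : code (S ∪ T) = code S + code T :=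
  Finset.sum_union h

/-- Inserting a new element adds a power of two at a bit that is not set, so no carry arises. -/
theorem testBit_code_ind (S : Finset (Fin n)) :
    ∀ i, (code S).testBit i = true ↔ ∃ v ∈ S, (v : ℕ) = i := by
  induction S using Finset.induction_on with
  | empty => simp
  | insert a S ha ih =>
    intro i
    have h0 : (code S).testBit a = false := by
      rw [← Bool.not_eq_true, ih]
      rintro ⟨v, hv, hva⟩
      exact ha (Fin.ext hva ▸ hv)
    have h1 : 2 ^ (a : ℕ) &&& code S = 0 := by simp [Nat.two_pow_and, h0]
    have h2 : code (insert a S) = 2 ^ (a : ℕ) + code S := Finset.sum_insert ha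
    rw [h2, add_eq_xor_add_two_mul_and, h1, mul_zero, add_zero, Nat.testBit_xor,
      Nat.testBit_two_pow]
    by_cases hi : (a : ℕ) = i
    · subst hi; simp [h0]
    · simp [hi, ih]

@[simp] theorem testBit_code (S : Finset (Fin n)) (v : Fin n) :
    (code S).testBit v = decide (v ∈ S) := by
  rw [Bool.eq_iff_iff, testBit_code_ind]
  simp only [decide_eq_true_eq]
  exact ⟨fun ⟨u, hu, h⟩ => Fin.ext h ▸ hu, fun h => ⟨v, h, rfl⟩⟩

theorem testBit_code_of_le (S : Finset (Fin n)) {i : ℕ} (hi : n ≤ i) :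
    (code S).testBit i = false := by
  rw [← Bool.not_eq_true, testBit_code_ind]
  rintro ⟨v, -, h⟩
  omega

theorem code_lt (S : Finset (Fin n)) : code S < 2 ^ n :=
  Nat.lt_pow_two_of_testBit _ fun _ hi => testBit_code_of_le S hi

theorem code_eq_of_testBit {x : ℕ} {S : Finset (Fin n)} (hx : x < 2 ^ n)
    (h : ∀ v : Fin n, x.testBit v = decide (v ∈ S)) : x = code S := by
  apply Nat.eq_of_testBit_eq
  intro i
  rcases lt_or_ge i n with hi | hi
  · rw [h ⟨i, hi⟩, ← testBit_code]
  · rw [testBit_code_of_le S hi,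
      Nat.testBit_lt_two_pow (hx.trans_le (Nat.pow_le_pow_right (by norm_num) hi))]

theorem code_and (S T : Finset (Fin n)) : code S &&& code T = code (S ∩ T) :=
  code_eq_of_testBit (Nat.and_lt_two_pow _ (code_lt T)) fun v => by
    rw [Nat.testBit_and]; simp

theorem code_sdiff (S T : Finset (Fin n)) : code (S \ T) = code S - (code S &&& code T) := by
  rw [code_and]
  have : code (S \ T ∪ S ∩ T) = code (S \ T) + code (S ∩ T) :=
    code_union (Finset.disjoint_sdiff_inter S T)
  rw [Finset.sdiff_union_inter] at this
  omega

theorem code_union' (S T : Finset (Fin n)) :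
    code (S ∪ T) = code S + code T - (code S &&& code T) := by
  have h : code (S ∪ T \ S) = code S + code (T \ S) := code_union Finset.disjoint_sdiff
  rw [Finset.union_sdiff_self_eq_union, code_sdiff, Nat.and_comm] at h
  have : code S &&& code T ≤ code T := Nat.and_le_right
  omega

theorem code_injective : Function.Injective (code (n := n)) := by
  intro S T h
  ext v
  have := congrArg (fun x => x.testBit v) h
  simpa using this

end Code

/-! ### Union and difference on the machine -/

section OrDiff

variable {n : ℕ}

/-- Register `x` := the union of the sets in the registers `x` and `y` without the set in
register `31`. -/
def orDiff (x y : ℕ) : RamProg :=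
  .seq (.block [.copy 0 x, .copy 1 y, .copy 2 62]) (.seq andProg
    (.seq (.block [.add x x y, .sub x x 3, .copy 0 x, .copy 1 31, .copy 2 62])
      (.seq andProg (.block [.sub x x 3]))))

/-- Union and difference both reduce to an intersection and subtractions, hence the two calls of
`andProg`. The two admitted choices of registers avoid those that `andProg` overwrites. -/
theorem orDiff_run {x y : ℕ} (hxy : x = 12 ∧ y = 16 ∨ x = 13 ∧ y = 17) {σ : RamState}
    {P Q M : Finset (Fin n)} (hz : σ.reg 60 = 0) (ho : σ.reg 61 = 1) (hn : σ.reg 62 = n)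
    (hP : σ.reg x = code P) (hQ : σ.reg y = code Q) (hM : σ.reg 31 = code M)
    (hT : ∀ i < n, σ.mem 4 i = 2 ^ i) :
    Run (orDiff x y) σ (n * 22 + 18) fun σ' => σ'.reg x = code ((P ∪ Q) \ M) ∧
      Frame [0, 1, 2, 3, 4, x] [] [] [] σ σ' := by
  refine Run.frame [0, 1, 2, 3, 4, x] [] [] [] ?_ ?_
  · rcases hxy with ⟨rfl, rfl⟩ | ⟨rfl, rfl⟩ <;> rfl
  have hlt := @code_lt n
  rcases hxy with ⟨rfl, rfl⟩ | ⟨rfl, rfl⟩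
  all_goals
    refine Run.block_seq_le (by simp) (Run.seq_le _ (andProg_run (x := code P) (y := code Q)
        (k := n)
      (by simpa using hz) (by simpa using ho) (by simpa using hP) (by simpa using hQ)
      (by simpa using hn) (hlt P) (hlt Q) (by simpa using hT)) (by simp; omega) ?_)
    rintro τ ⟨h3, hf⟩
    refine Run.block_seq_le (by simp; omega) (Run.seq_le _ (andProg_run (x := code (P ∪ Q))
        (y := code M) (k := n)
      ?_ ?_ ?_ ?_ ?_ (hlt _) (hlt _) ?_) (by simp; omega) ?_)
    · simp [hf.reg, hz]
    · simp [hf.reg, ho]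
    · simp [hf.reg, hP, hQ, h3, code_union']
    · simp [hf.reg, hM]
    · simp [hf.reg, hn]
    · simpa [hf.mem] using hT
    · rintro τ' ⟨h3', hf'⟩
      refine Run.block_le (by simp; omega) ?_
      simp [hf'.reg, hf.reg, hP, hQ, h3, h3', ← code_union', code_sdiff]

end OrDiff

/-! ### The table of the unions of pairs of sets -/

/-- The states, elements and stack slots with small indices and the table of the powers of two are
preserved. -/
structure Grow (fs fe sp : ℕ) (σ σ' : RamState) : Prop where
  st : ∀ a, 10 ≤ a → a < 14 → ∀ i < fs, σ'.mem a i = σ.mem a i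
  el : ∀ a, 14 ≤ a → a < 16 → ∀ i < fe, σ'.mem a i = σ.mem a i
  wt : ∀ i < fe, σ'.wmem 1 i = σ.wmem 1 i
  sl : ∀ a, 5 ≤ a → a < 10 → ∀ i < sp, σ'.mem a i = σ.mem a i
  pw : ∀ i, σ.mem 4 i = 2 ^ i → σ'.mem 4 i = 2 ^ i

theorem Grow.trans {fs fe sp fs' fe' sp' : ℕ} {σ σ' σ'' : RamState} (h : Grow fs fe sp σ σ')
    (h' : Grow fs' fe' sp' σ' σ'') (hs : fs ≤ fs') (he : fe ≤ fe') (hp : sp ≤ sp') :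
    Grow fs fe sp σ σ'' where
  st a ha ha' i hi := (h'.st a ha ha' i (by omega)).trans (h.st a ha ha' i hi)
  el a ha ha' i hi := (h'.el a ha ha' i (by omega)).trans (h.el a ha ha' i hi)
  wt i hi := (h'.wt i (by omega)).trans (h.wt i hi)
  sl a ha ha' i hi := (h'.sl a ha ha' i (by omega)).trans (h.sl a ha ha' i hi)
  pw i hi := h'.pw i (h.pw i hi)

/-- The cells `s, …, s + m - 1` of the arrays `10, …, 13` describe `m` pairs of sets and their
neighbors outside `A`. -/
def StateTable {n : ℕ} (G : SimpleGraph (Fin n)) (σ : RamState) (s m : ℕ) (A : Finset (Fin n))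
    (S₁ S₂ : ℕ → Finset (Fin n)) : Prop :=
  ∀ p < m, σ.mem 10 (s + p) = code (S₁ p) ∧ σ.mem 11 (s + p) = code (S₂ p) ∧
    σ.mem 12 (s + p) = code (outNbrs G A (S₁ p)) ∧ σ.mem 13 (s + p) = code (outNbrs G A (S₂ p))

theorem StateTable.congr {n : ℕ} {G : SimpleGraph (Fin n)} {σ σ' : RamState} {s m fs : ℕ}
    {A : Finset (Fin n)} {S₁ S₂ : ℕ → Finset (Fin n)} (h : StateTable G σ s m A S₁ S₂)
    (hm : s + m ≤ fs)
    (hst : ∀ a, 10 ≤ a → a < 14 → ∀ i < fs, σ'.mem a i = σ.mem a i) :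
    StateTable G σ' s m A S₁ S₂ := by
  intro p hp
  obtain ⟨h1, h2, h3, h4⟩ := h p hp
  have hlt : s + p < fs := by omega
  exact ⟨(hst 10 (by omega) (by omega) _ hlt).trans h1, (hst 11 (by omega)
      (by omega) _ hlt).trans h2,
    (hst 12 (by omega) (by omega) _ hlt).trans h3, (hst 13 (by omega) (by omega) _ hlt).trans h4⟩

/-- The pairs `(U₁ r, U₂ r)` have different neighbors outside `A`. -/
def DistinctClasses {n : ℕ} (G : SimpleGraph (Fin n)) (A : Finset (Fin n)) (m : ℕ)
    (U₁ U₂ : ℕ → Finset (Fin n)) : Prop :=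
  (∀ r < m, U₁ r ⊆ A ∧ U₂ r ⊆ A) ∧ ∀ i < m, ∀ j < m, outNbrs G A (U₁ i) = outNbrs G A (U₁ j) →
    outNbrs G A (U₂ i) = outNbrs G A (U₂ j) → i = j

/-- Register `18` := the index, plus one, of a pair with the neighbors in the registers `12` and
`13`, or else `0`. -/
def lookupProg : RamProg :=
  .seq (.block [.const 18 0]) (.up 8 20 (.seq (.block [.add 9 41 8, .load 0 12 9])
    (.ite (.eq 0 12) (.seq (.block [.load 1 13 9])
      (.ite (.eq 1 13) (.block [.add 18 8 61]) (.block []))) (.block []))))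

theorem lookupProg_run {σ : RamState} {m fs x y : ℕ} (ho : σ.reg 61 = 1) (hm : σ.reg 20 = m)
    (hfs : σ.reg 41 = fs) (hx : σ.reg 12 = x) (hy : σ.reg 13 = y) :
    Run lookupProg σ (m * 11 + 4) fun σ' =>
      ((σ'.reg 18 = 0 ∧ ∀ r < m, ¬ (σ.mem 12 (fs + r) = x ∧ σ.mem 13 (fs + r) = y)) ∨
        ∃ r < m, σ'.reg 18 = r + 1 ∧ σ.mem 12 (fs + r) = x ∧ σ.mem 13 (fs + r) = y) ∧
      Frame [0, 1, 8, 9, 18] [] [] [] σ σ' := by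
  refine Run.frame [0, 1, 8, 9, 18] [] [] [] rfl ?_
  refine Run.block_seq_le (by simp) (((Run.up (N := m) (b := 9) [0, 1, 9, 18] [] [] [] rfl
      (by decide)
    (fun i τ => (τ.reg 18 = 0 ∧ ∀ r < i, ¬ (σ.mem 12 (fs + r) = x ∧ σ.mem 13 (fs + r) = y)) ∨
        ∃ r < i, τ.reg 18 = r + 1 ∧ σ.mem 12 (fs + r) = x ∧ σ.mem 13 (fs + r) = y)
    ?_ ?_ ?_ ?_ ?_).post fun _ h => h.1).weaken ?_)
  · intro i σ x h; simpa using h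
  · simpa using ho
  · simpa using hm
  · simp
  · rintro i hi τ hτ hf h
    have h12 : τ.mem 12 = σ.mem 12 := by simp [hf.mem]
    have h13 : τ.mem 13 = σ.mem 13 := by simp [hf.mem]
    have hx' : τ.reg 12 = x := by simp [hf.reg, hx]
    have hy' : τ.reg 13 = y := by simp [hf.reg, hy]
    have hfs' : τ.reg 41 = fs := by simp [hf.reg, hfs]
    have ho' : τ.reg 61 = 1 := by simp [hf.reg, ho]
    have stay : ¬ (σ.mem 12 (fs + i) = x ∧ σ.mem 13 (fs + i) = y) →
        ((τ.reg 18 = 0 ∧ ∀ r < i + 1, ¬ (σ.mem 12 (fs + r) = x ∧ σ.mem 13 (fs + r) = y)) ∨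
        ∃ r < i + 1, τ.reg 18 = r + 1 ∧ σ.mem 12 (fs + r) = x ∧ σ.mem 13 (fs + r) = y) := by
      intro hne
      rcases h with ⟨h0, h⟩ | ⟨r, hr, h⟩
      · refine Or.inl ⟨h0, fun r hr => ?_⟩
        rcases Nat.lt_succ_iff_lt_or_eq.1 hr with hr | rfl
        · exact h r hr
        · exact hne
      · exact Or.inr ⟨r, by omega, h⟩
    refine Run.block_seq_le (by simp) (Run.ite_le (by simp) (fun hb => ?_) (fun hb => ?_))
    · simp [RamTest.Holds, hτ, h12, hfs', hx'] at hb
      refine Run.block_seq_le (by simp) (Run.ite_le (by simp) (fun hb' => ?_) (fun hb' => ?_))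
      · simp [RamTest.Holds, hτ, h13, hfs', hy'] at hb'
        refine Run.block_le (by simp) (Or.inr ⟨i, by omega, ?_⟩)
        simp [hτ, ho', hb, hb']
      · simp [RamTest.Holds, hτ, h13, hfs', hy'] at hb'
        refine Run.block_le (by simp) ?_
        simpa using stay fun h => hb' h.2
    · simp [RamTest.Holds, hτ, h12, hfs', hx'] at hb
      refine Run.block_le (by simp) ?_
      simpa using stay fun h => hb h.1
  · simp

/-- Add the union of the pairs `p` and `q` (registers `34` and `35`) to the table. -/
def mergeProg : RamProg :=
  .seq (.block [.add 8 23 34, .add 9 27 35, .load 10 10 8, .load 11 11 8, .load 12 12 8,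
    .load 13 13 8, .load 14 10 9, .load 15 11 9, .load 16 12 9, .load 17 13 9,
    .copy 0 12, .copy 1 15, .copy 2 62]) <|
  .seq andProg <| .seq (.block [.copy 18 3, .copy 0 13, .copy 1 14, .copy 2 62]) <|
  .seq andProg <| .seq (.block [.add 18 18 3]) <|
  .seq (.ite (.eq 18 60)
    (.seq (orDiff 12 16) <| .seq (orDiff 13 17) <| .seq lookupProg <|
      .seq (.ite (.eq 18 60) (.block [.add 9 41 20, .store 12 9 12, .store 13 9 13,
        .add 10 10 14, .store 10 9 10, .add 11 11 15, .store 11 9 11, .store 4 20 21,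
        .add 21 21 21, .add 20 20 61, .copy 18 20]) (.block [])) <|
      .block [.store 16 22 18])
    (.block [.store 16 22 60])) <|
  .block [.add 22 22 61]

section Pairs

variable {n : ℕ} (G : SimpleGraph (Fin n)) (A B : Finset (Fin n)) (ma mb fs : ℕ)
  (S₁ S₂ T₁ T₂ : ℕ → Finset (Fin n)) (σ₀ : RamState)

/-- The entry `v` of the table for the pairs `p` and `q` is correct. -/
def GoodEntry (m : ℕ) (U₁ U₂ : ℕ → Finset (Fin n)) (p q v : ℕ) : Prop :=
  (0 < v ↔ Disjoint (outNbrs G A (S₁ p)) (T₂ q) ∧ Disjoint (outNbrs G A (S₂ p)) (T₁ q)) ∧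
  v ≤ m ∧ (0 < v → outNbrs G (A ∪ B) (U₁ (v - 1)) = outNbrs G (A ∪ B) (S₁ p ∪ T₁ q) ∧
    outNbrs G (A ∪ B) (U₂ (v - 1)) = outNbrs G (A ∪ B) (S₂ p ∪ T₂ q))

/-- The contents of the memory after `t` pairs have been processed. -/
structure PairsInv (U₁ U₂ : ℕ → Finset (Fin n)) (t : ℕ) (σ : RamState) : Prop where
  pow : σ.reg 21 = 2 ^ σ.reg 20
  idx : σ.reg 22 = t
  distinct : DistinctClasses G (A ∪ B) (σ.reg 20) U₁ U₂
  table : StateTable G σ fs (σ.reg 20) (A ∪ B) U₁ U₂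
  pow_lt : ∀ r < σ.reg 20, σ.mem 4 r = 2 ^ r
  entry : ∀ p < ma, ∀ q < mb, p * mb + q < t →
    GoodEntry G A B S₁ S₂ T₁ T₂ (σ.reg 20) U₁ U₂ p q (σ.mem 16 (p * mb + q))
  st : ∀ a, 10 ≤ a → a < 14 → ∀ i < fs, σ.mem a i = σ₀.mem a i
  pw : ∀ i, σ₀.mem 4 i = 2 ^ i → σ.mem 4 i = 2 ^ i

variable {G A B ma mb fs S₁ S₂ T₁ T₂ σ₀}

theorem idx_inj {mb p q p' q' : ℕ} (hq : q < mb) (hq' : q' < mb)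
    (h : p * mb + q = p' * mb + q') : p = p' ∧ q = q' := by
  have h1 := congrArg (· / mb) h
  have h2 := congrArg (· % mb) h
  have hmb : 0 < mb := by omega
  simp [Nat.add_div_of_dvd_right, hmb, Nat.div_eq_of_lt, hq, hq', Nat.mod_eq_of_lt] at h1 h2
  exact ⟨h1, h2⟩

theorem idx_lt {mb p q p' q' : ℕ} (hq' : q' < mb)
    (h : p' * mb + q' < p * mb + q + 1) (hq : q < mb) : (p' * mb + q' < p * mb + q) ∨
        (p' = p ∧ q' = q) := by
  rcases Nat.lt_succ_iff_lt_or_eq.1 h with h | h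
  · exact Or.inl h
  · exact Or.inr (idx_inj hq' hq h)

theorem PairsInv.next {U₁ U₂ : ℕ → Finset (Fin n)} {p q v : ℕ} {σ σ' : RamState}
    (h : PairsInv G A B ma mb fs S₁ S₂ T₁ T₂ σ₀ U₁ U₂ (p * mb + q) σ) (hqm : q < mb)
    (hv : GoodEntry G A B S₁ S₂ T₁ T₂ (σ.reg 20) U₁ U₂ p q v)
    (h20 : σ'.reg 20 = σ.reg 20) (h21 : σ'.reg 21 = σ.reg 21) (h22 : σ'.reg 22 = σ.reg 22 + 1)
    (hmem : ∀ a, a ≠ 16 → σ'.mem a = σ.mem a)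
    (h16 : σ'.mem 16 = Function.update (σ.mem 16) (p * mb + q) v) :
    PairsInv G A B ma mb fs S₁ S₂ T₁ T₂ σ₀ U₁ U₂ (p * mb + q + 1) σ' where
  pow := by rw [h20, h21, h.pow]
  idx := by rw [h22, h.idx]
  distinct := by rw [h20]; exact h.distinct
  table := by
    rw [h20]
    exact h.table.congr le_rfl fun a ha ha' i _ => by rw [hmem a (by omega)]
  pow_lt r hr := by rw [h20] at hr; rw [hmem 4 (by omega), h.pow_lt r hr]
  entry p' hp' q' hq' hlt := by
    rw [h20, h16]
    rcases idx_lt hq' hlt hqm with hlt | ⟨rfl, rfl⟩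
    · rw [Function.update_of_ne (by omega)]
      exact h.entry p' hp' q' hq' hlt
    · rwa [Function.update_self]
  st a ha ha' i hi := by rw [hmem a (by omega), h.st a ha ha' i hi]
  pw i hi := by rw [hmem 4 (by omega), h.pw i hi]

/-- Earlier entries refer to earlier indices, so a new representative does not disturb them; by
`hne` it starts a new class. The table of powers is extended together with the classes, since
vectors now have one more bit. -/
theorem PairsInv.append {U₁ U₂ : ℕ → Finset (Fin n)} {t : ℕ} {P Q : Finset (Fin n)}
    {σ σ' : RamState} (h : PairsInv G A B ma mb fs S₁ S₂ T₁ T₂ σ₀ U₁ U₂ t σ)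
    (hP : P ⊆ A ∪ B) (hQ : Q ⊆ A ∪ B)
    (hne : ∀ r < σ.reg 20, ¬ (outNbrs G (A ∪ B) (U₁ r) = outNbrs G (A ∪ B) P ∧
      outNbrs G (A ∪ B) (U₂ r) = outNbrs G (A ∪ B) Q))
    (h20 : σ'.reg 20 = σ.reg 20 + 1) (h21 : σ'.reg 21 = σ.reg 21 + σ.reg 21)
    (h22 : σ'.reg 22 = σ.reg 22) (h16 : σ'.mem 16 = σ.mem 16)
    (h10 : σ'.mem 10 = Function.update (σ.mem 10) (fs + σ.reg 20) (code P))
    (h11 : σ'.mem 11 = Function.update (σ.mem 11) (fs + σ.reg 20) (code Q))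
    (h12 : σ'.mem 12 = Function.update (σ.mem 12) (fs + σ.reg 20) (code (outNbrs G (A ∪ B) P)))
    (h13 : σ'.mem 13 = Function.update (σ.mem 13) (fs + σ.reg 20) (code (outNbrs G (A ∪ B) Q)))
    (h4 : σ'.mem 4 = Function.update (σ.mem 4) (σ.reg 20) (σ.reg 21)) :
    PairsInv G A B ma mb fs S₁ S₂ T₁ T₂ σ₀ (Function.update U₁ (σ.reg 20) P)
      (Function.update U₂ (σ.reg 20) Q) t σ' where
  pow := by rw [h20, h21, h.pow]; ring
  idx := by rw [h22, h.idx]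
  distinct := by
    rw [h20]
    refine ⟨fun r hr => ?_, fun i hi j hj => ?_⟩
    · rcases Nat.lt_succ_iff_lt_or_eq.1 hr with hr | rfl
      · simpa [hr.ne] using h.distinct.1 r hr
      · simpa using ⟨hP, hQ⟩
    · rcases Nat.lt_succ_iff_lt_or_eq.1 hi with hi | rfl <;>
        rcases Nat.lt_succ_iff_lt_or_eq.1 hj with hj | rfl
      · simpa [hi.ne, hj.ne] using h.distinct.2 i hi j hj
      · intro h1 h2
        simp [hi.ne] at h1 h2
        exact absurd ⟨h1, h2⟩ (hne i hi)
      · intro h1 h2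
        simp [hj.ne] at h1 h2
        exact absurd ⟨h1.symm, h2.symm⟩ (hne j hj)
      · intros; rfl
  table := by
    rw [h20]
    intro r hr
    rw [h10, h11, h12, h13]
    rcases Nat.lt_succ_iff_lt_or_eq.1 hr with hr | rfl
    · simpa [hr.ne] using h.table r hr
    · simp
  pow_lt r hr := by
    rw [h20] at hr
    rw [h4]
    rcases Nat.lt_succ_iff_lt_or_eq.1 hr with hr | rfl
    · simpa [hr.ne] using h.pow_lt r hr
    · simp [h.pow]
  entry p hp q hq hlt := by
    rw [h20, h16]
    obtain ⟨e1, e2, e3⟩ := h.entry p hp q hq hlt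
    refine ⟨e1, by omega, fun hpos => ?_⟩
    have : σ.mem 16 (p * mb + q) - 1 ≠ σ.reg 20 := by omega
    simpa [this] using e3 hpos
  st a ha ha' i hi := by
    rw [← h.st a ha ha' i hi]
    have : i ≠ fs + σ.reg 20 := by omega
    interval_cases a <;> simp [h10, h11, h12, h13, this]
  pw i hi := by
    have := h.pw i hi
    rw [h4]
    by_cases hi : i = σ.reg 20
    · subst hi; simp [h.pow]
    · simpa [hi] using this

/-- Two pairs are compatible when the sum of the codes of two intersections is zero. In that case
the neighbors of the unions come from `outNbrs_union` and are searched for among the known classes;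
`hM` bounds the length of this search. -/
theorem mergeProg_run {U₁ U₂ : ℕ → Finset (Fin n)} {σ : RamState} {M p q s₀ s₁ : ℕ}
    (hAB : Disjoint A B) (hz : σ.reg 60 = 0) (ho : σ.reg 61 = 1) (hn : σ.reg 62 = n)
    (hfs : σ.reg 41 = fs) (hs₀ : σ.reg 23 = s₀) (hs₁ : σ.reg 27 = s₁)
    (hmask : σ.reg 31 = code (A ∪ B)) (hp : σ.reg 34 = p) (hq : σ.reg 35 = q)
    (hpm : p < ma) (hqm : q < mb)
    (hS : StateTable G σ s₀ ma A S₁ S₂) (hT : StateTable G σ s₁ mb B T₁ T₂)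
    (hSA : ∀ p < ma, S₁ p ⊆ A ∧ S₂ p ⊆ A) (hTB : ∀ p < mb, T₁ p ⊆ B ∧ T₂ p ⊆ B)
    (hP : ∀ i < n, σ₀.mem 4 i = 2 ^ i)
    (hM : ∀ m U₁ U₂, DistinctClasses G (A ∪ B) m U₁ U₂ → m ≤ M)
    (h : PairsInv G A B ma mb fs S₁ S₂ T₁ T₂ σ₀ U₁ U₂ (p * mb + q) σ) :
    Run mergeProg σ (66 * n + 11 * M + 100) fun σ' =>
      ∃ U₁ U₂, PairsInv G A B ma mb fs S₁ S₂ T₁ T₂ σ₀ U₁ U₂ (p * mb + q + 1) σ' := by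
  have hP' : ∀ i < n, σ.mem 4 i = 2 ^ i := fun i hi => h.pw i (hP i hi)
  obtain ⟨a1, a2, a3, a4⟩ := hS p hpm
  obtain ⟨b1, b2, b3, b4⟩ := hT q hqm
  have hlt := @code_lt n
  have hmM := hM _ _ _ h.distinct
  refine Run.block_seq_le (by simp) (Run.seq_le _ (andProg_run (x := code (outNbrs G A (S₁ p)))
    (y := code (T₂ q)) (k := n) ?_ ?_ ?_ ?_ ?_ (hlt _) (hlt _) ?_) (by simp; omega) ?_)
  · simp [hz]
  · simp [ho]
  · simp [hs₀, hp, a3]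
  · simp [hs₁, hq, b2]
  · simp [hn]
  · simpa using hP'
  rintro τ₁ ⟨h3, f1⟩
  refine Run.block_seq_le (by simp; omega) (Run.seq_le _ (andProg_run (x := code (outNbrs G A
      (S₂ p)))
    (y := code (T₁ q)) (k := n) ?_ ?_ ?_ ?_ ?_ (hlt _) (hlt _) ?_) (by simp; omega) ?_)
  · simp [f1.reg, hz]
  · simp [f1.reg, ho]
  · simp [f1.reg, hs₀, hp, a4]
  · simp [f1.reg, hs₁, hq, b1]
  · simp [f1.reg, hn]
  · simpa [f1.mem] using hP'
  rintro τ₂ ⟨h3', f2⟩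
  have e18 : τ₂.reg 18 = code (outNbrs G A (S₁ p) ∩ T₂ q) := by
    simp [f2.reg, h3, code_and]
  rw [code_and] at h3'
  refine Run.block_seq_le (by simp; omega) ?_
  set τ₃ := exec [RamInstr.add 18 18 3] τ₂ with hτ₃
  have c18 : τ₃.reg 18 = code (outNbrs G A (S₁ p) ∩ T₂ q) + code (outNbrs G A (S₂ p) ∩ T₁ q) := by
    simp [hτ₃, e18, h3']
  have r10 : τ₃.reg 10 = code (S₁ p) := by simp [hτ₃, f2.reg, f1.reg, hs₀, hp, a1]
  have r11 : τ₃.reg 11 = code (S₂ p) := by simp [hτ₃, f2.reg, f1.reg, hs₀, hp, a2]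
  have r12 : τ₃.reg 12 = code (outNbrs G A (S₁ p)) := by simp [hτ₃, f2.reg, f1.reg, hs₀, hp, a3]
  have r13 : τ₃.reg 13 = code (outNbrs G A (S₂ p)) := by simp [hτ₃, f2.reg, f1.reg, hs₀, hp, a4]
  have r14 : τ₃.reg 14 = code (T₁ q) := by simp [hτ₃, f2.reg, f1.reg, hs₁, hq, b1]
  have r15 : τ₃.reg 15 = code (T₂ q) := by simp [hτ₃, f2.reg, f1.reg, hs₁, hq, b2]
  have r16 : τ₃.reg 16 = code (outNbrs G B (T₁ q)) := by simp [hτ₃, f2.reg, f1.reg, hs₁, hq, b3]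
  have r17 : τ₃.reg 17 = code (outNbrs G B (T₂ q)) := by simp [hτ₃, f2.reg, f1.reg, hs₁, hq, b4]
  have hmem : τ₃.mem = σ.mem := by
    ext a i; simp [hτ₃, f2.mem, f1.mem]
  have hreg : ∀ r, 20 ≤ r → τ₃.reg r = σ.reg r := by
    intro r hr
    have : ∀ k < 20, r ≠ k := by intro k hk; omega
    simp [hτ₃, f2.reg, f1.reg, this]
  have hcompat : τ₃.reg 18 = 0 ↔
      Disjoint (outNbrs G A (S₁ p)) (T₂ q) ∧ Disjoint (outNbrs G A (S₂ p)) (T₁ q) := by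
    rw [c18, Nat.add_eq_zero_iff, Finset.disjoint_iff_inter_eq_empty,
      Finset.disjoint_iff_inter_eq_empty, ← code_empty, code_injective.eq_iff,
          code_injective.eq_iff]
  clear_value τ₃
  refine Run.seq_le (T₁ := 44 * n + 11 * M + 60)
    (Q := fun σ' => ∃ U₁ U₂, PairsInv G A B ma mb fs S₁ S₂ T₁ T₂ σ₀ U₁ U₂ (p * mb + q + 1)
      (σ'.setReg 22 (σ'.reg 22 + 1)) ∧ σ'.reg 61 = 1) ?_ (by simp; omega) ?_
  · have d60 : τ₃.reg 60 = 0 := (hreg 60 (by norm_num)).trans hz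
    have d61 : τ₃.reg 61 = 1 := (hreg 61 (by norm_num)).trans ho
    have d62 : τ₃.reg 62 = n := (hreg 62 (by norm_num)).trans hn
    have d31 : τ₃.reg 31 = code (A ∪ B) := (hreg 31 (by norm_num)).trans hmask
    have d41 : τ₃.reg 41 = fs := (hreg 41 (by norm_num)).trans hfs
    have d20 := hreg 20 le_rfl
    have d21 := hreg 21 (by norm_num)
    have d22 := hreg 22 (by norm_num)
    have hP₃ : ∀ i < n, τ₃.mem 4 i = 2 ^ i := by simpa [hmem] using hP'
    refine Run.ite_le (by omega) (fun hb => ?_) (fun hb => ?_)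
    · simp only [RamTest.Holds, d60] at hb
      have hcomp := hcompat.1 hb
      refine Run.seq_le _ (orDiff_run (Or.inl ⟨rfl, rfl⟩) d60 d61 d62 r12 r16 d31 hP₃) (by omega) ?_
      rintro τ₄ ⟨g12, f4⟩
      refine Run.seq_le _ (orDiff_run (n := n) (P := outNbrs G A (S₂ p)) (Q := outNbrs G B (T₂ q))
        (M := A ∪ B) (Or.inr ⟨rfl, rfl⟩) ?_ ?_ ?_ ?_ ?_ ?_ ?_) (by omega) ?_
      · simp [f4.reg, d60]
      · simp [f4.reg, d61]
      · simp [f4.reg, d62]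
      · simp [f4.reg, r13]
      · simp [f4.reg, r17]
      · simp [f4.reg, d31]
      · simpa [f4.mem] using hP₃
      rintro τ₅ ⟨g13, f5⟩
      rw [← outNbrs_union] at g12 g13
      have g12' : τ₅.reg 12 = code (outNbrs G (A ∪ B) (S₁ p ∪ T₁ q)) := by simp [f5.reg, g12]
      refine Run.seq_le _ (lookupProg_run (m := σ.reg 20) (fs := fs) ?_ ?_ ?_ g12' g13) ?_ ?_
      · simp [f4.reg, f5.reg, d61]
      · simp [f4.reg, f5.reg, d20]
      · simp [f4.reg, f5.reg, d41]
      · omega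
      rintro τ₆ ⟨h18, f6⟩
      have m6 : τ₆.mem = σ.mem := by ext a i; simp [f4.mem, f5.mem, f6.mem, hmem]
      have m5 : τ₅.mem = σ.mem := by ext a i; simp [f4.mem, f5.mem, hmem]
      have x10 : τ₆.reg 10 = code (S₁ p) := by simp [f4.reg, f5.reg, f6.reg, r10]
      have x11 : τ₆.reg 11 = code (S₂ p) := by simp [f4.reg, f5.reg, f6.reg, r11]
      have x12 : τ₆.reg 12 = code (outNbrs G (A ∪ B) (S₁ p ∪ T₁ q)) := by simp [f6.reg, g12']
      have x13 : τ₆.reg 13 = code (outNbrs G (A ∪ B) (S₂ p ∪ T₂ q)) := by simp [f6.reg, g13]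
      have x14 : τ₆.reg 14 = code (T₁ q) := by simp [f4.reg, f5.reg, f6.reg, r14]
      have x15 : τ₆.reg 15 = code (T₂ q) := by simp [f4.reg, f5.reg, f6.reg, r15]
      have x20 : τ₆.reg 20 = σ.reg 20 := by simp [f4.reg, f5.reg, f6.reg, d20]
      have x21 : τ₆.reg 21 = σ.reg 21 := by simp [f4.reg, f5.reg, f6.reg, d21]
      have x22 : τ₆.reg 22 = σ.reg 22 := by simp [f4.reg, f5.reg, f6.reg, d22]
      have x41 : τ₆.reg 41 = fs := by simp [f4.reg, f5.reg, f6.reg, d41]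
      have x60 : τ₆.reg 60 = 0 := by simp [f4.reg, f5.reg, f6.reg, d60]
      have x61 : τ₆.reg 61 = 1 := by simp [f4.reg, f5.reg, f6.reg, d61]
      clear f4 f5 f6
      have hmatch : ∀ r < σ.reg 20,
          (τ₅.mem 12 (fs + r) = code (outNbrs G (A ∪ B) (S₁ p ∪ T₁ q)) ∧
            τ₅.mem 13 (fs + r) = code (outNbrs G (A ∪ B) (S₂ p ∪ T₂ q))) ↔
          (outNbrs G (A ∪ B) (U₁ r) = outNbrs G (A ∪ B) (S₁ p ∪ T₁ q) ∧
            outNbrs G (A ∪ B) (U₂ r) = outNbrs G (A ∪ B) (S₂ p ∪ T₂ q)) := by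
        intro r hr
        obtain ⟨-, -, t3, t4⟩ := h.table r hr
        rw [m5, t3, t4, code_injective.eq_iff, code_injective.eq_iff]
      refine Run.seq_le (T₁ := 13) (Q := fun τ => ∃ U₁ U₂ σ₂,
          PairsInv G A B ma mb fs S₁ S₂ T₁ T₂ σ₀ U₁ U₂ (p * mb + q) σ₂ ∧
          GoodEntry G A B S₁ S₂ T₁ T₂ (σ₂.reg 20) U₁ U₂ p q (τ.reg 18) ∧
          τ.reg 20 = σ₂.reg 20 ∧ τ.reg 21 = σ₂.reg 21 ∧ τ.reg 22 = σ₂.reg 22 ∧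
          τ.mem = σ₂.mem ∧ τ.reg 61 = 1) ?_ (by omega) ?_
      · refine Run.ite_le (by omega) (fun hb' => ?_) (fun hb' => ?_)
        · simp only [RamTest.Holds, x60] at hb'
          refine Run.block_le (by simp) ?_
          have hnone : ∀ r < σ.reg 20, ¬ (outNbrs G (A ∪ B) (U₁ r) = outNbrs G (A ∪ B)
              (S₁ p ∪ T₁ q) ∧
              outNbrs G (A ∪ B) (U₂ r) = outNbrs G (A ∪ B) (S₂ p ∪ T₂ q)) := by
            rcases h18 with ⟨-, h18⟩ | ⟨r, -, h18, -⟩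
            · exact fun r hr hc => h18 r hr ((hmatch r hr).2 hc)
            · omega
          have dis : ∀ {P Q : Finset (Fin n)}, P ⊆ A → Q ⊆ B → code (P ∪ Q) = code P + code Q :=
            fun hP hQ => code_union (hAB.mono hP hQ)
          refine ⟨_, _, _, h.append (P := S₁ p ∪ T₁ q) (Q := S₂ p ∪ T₂ q)
            (σ' := exec [.add 9 41 20, .store 12 9 12, .store 13 9 13,
              .add 10 10 14, .store 10 9 10, .add 11 11 15, .store 11 9 11, .store 4 20 21,
              .add 21 21 21, .add 20 20 61, .copy 18 20] τ₆)
            (Finset.union_subset_union (hSA p hpm).1 (hTB q hqm).1)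
            (Finset.union_subset_union (hSA p hpm).2 (hTB q hqm).2) hnone ?_ ?_ ?_ ?_ ?_ ?_ ?_ ?_
                ?_,
            ?_, rfl, rfl, rfl, rfl, ?_⟩
          · simp [x20, x61]
          · simp [x21]
          · simp [x22]
          · simp [m6]
          · simp [m6, x41, x20, x10, x14, dis (hSA p hpm).1 (hTB q hqm).1]
          · simp [m6, x41, x20, x11, x15, dis (hSA p hpm).2 (hTB q hqm).2]
          · simp [m6, x41, x20, x12]
          · simp [m6, x41, x20, x13]
          · simp [m6, x20, x21]
          · simp [x20, x61, GoodEntry, hcomp]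
          · simp [x61]
        · simp only [RamTest.Holds, x60] at hb'
          refine Run.block_le (by simp) ⟨U₁, U₂, σ, h, ?_, x20, x21, x22, m6, x61⟩
          rcases h18 with ⟨h18, -⟩ | ⟨r, hr, h18, hc⟩
          · exact absurd h18 hb'
          · rw [exec_nil, h18]
            exact ⟨by simpa using hcomp, by omega, fun _ => (hmatch r hr).1 hc⟩
      · rintro τ ⟨U₁, U₂, σ₂, hI, hE, e20, e21, e22, em, e61⟩
        refine Run.block_le (by simp; omega) ⟨U₁, U₂, ?_⟩
        refine ⟨hI.next hqm hE ?_ ?_ ?_ ?_ ?_, by simpa using e61⟩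
        · simp [e20]
        · simp [e21]
        · simp [e22]
        · intro a ha; simp [ha, em]
        · simp [em, e22, hI.idx]
    · simp only [RamTest.Holds, d60] at hb
      refine Run.block_le (by simp) ⟨U₁, U₂, h.next hqm (v := 0) ?_ ?_ ?_ ?_ ?_ ?_, ?_⟩
      · simp only [GoodEntry, lt_irrefl, false_iff, zero_le, false_imp_iff, and_true]
        exact fun h => hb (hcompat.2 h)
      · simp [d20]
      · simp [d21]
      · simp [d22]
      · intro a ha; simp [ha, hmem]
      · simp [hmem, d22, d60, h.idx]
      · simp [d61]
  · rintro τ ⟨U₁, U₂, hI, h1⟩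
    refine Run.block_le (by simp; omega) ⟨U₁, U₂, ?_⟩
    simpa [h1] using hI

/-- Fill the table of the unions of pairs. -/
def pairsProg : RamProg :=
  .seq (.block [.const 20 0, .const 21 1, .const 22 0]) (.up 34 24 (.up 35 28 mergeProg))

theorem pairsProg_run {σ : RamState} {M s₀ s₁ : ℕ}
    (hAB : Disjoint A B) (hz : σ.reg 60 = 0) (ho : σ.reg 61 = 1) (hn : σ.reg 62 = n)
    (hfs : σ.reg 41 = fs) (hs₀ : σ.reg 23 = s₀) (hs₁ : σ.reg 27 = s₁)
    (hmask : σ.reg 31 = code (A ∪ B)) (hma : σ.reg 24 = ma) (hmb : σ.reg 28 = mb)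
    (hs₀m : s₀ + ma ≤ fs) (hs₁m : s₁ + mb ≤ fs)
    (hS : StateTable G σ s₀ ma A S₁ S₂) (hT : StateTable G σ s₁ mb B T₁ T₂)
    (hSA : ∀ p < ma, S₁ p ⊆ A ∧ S₂ p ⊆ A) (hTB : ∀ p < mb, T₁ p ⊆ B ∧ T₂ p ⊆ B)
    (hP : ∀ i < n, σ.mem 4 i = 2 ^ i)
    (hM : ∀ m U₁ U₂, DistinctClasses G (A ∪ B) m U₁ U₂ → m ≤ M) :
    Run pairsProg σ (ma * (mb * (66 * n + 11 * M + 102) + 4) + 6) fun σ' =>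
      (∃ U₁ U₂, PairsInv G A B ma mb fs S₁ S₂ T₁ T₂ σ U₁ U₂ (ma * mb) σ') ∧
      Frame [0, 1, 2, 3, 4, 8, 9, 10, 11, 12, 13, 14, 15, 16, 17, 18, 20, 21, 22, 34, 35]
        [4, 10, 11, 12, 13, 16] [] [] σ σ' := by
  refine Run.frame _ _ _ _ rfl ?_
  refine Run.block_seq_le (by simp) (((Run.up (N := ma) (b := mb * (66 * n + 11 * M + 102) + 2)
    [0, 1, 2, 3, 4, 8, 9, 10, 11, 12, 13, 14, 15, 16, 17, 18, 20, 21, 22, 35]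
    [4, 10, 11, 12, 13, 16] [] [] rfl (by decide)
    (fun i τ => ∃ U₁ U₂, PairsInv G A B ma mb fs S₁ S₂ T₁ T₂ σ U₁ U₂ (i * mb) τ)
    ?_ ?_ ?_ ?_ ?_).post fun _ h => h.1).weaken ?_)
  · rintro i τ x ⟨U₁, U₂, h⟩
    exact ⟨U₁, U₂, by simpa using h.pow, by simpa using h.idx, by simpa using h.distinct,
      by simpa [StateTable] using h.table, by simpa using h.pow_lt, by simpa using h.entry, h.st,
          h.pw⟩
  · simpa using ho
  · simpa using hma
  · exact ⟨fun _ => ∅, fun _ => ∅, by simp, by simp, by simp [DistinctClasses],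
      by simp [StateTable], by simp, by simp, by simp, by simp⟩
  · rintro p hp τ hτ hf hI
    refine ((Run.up (N := mb) (b := 66 * n + 11 * M + 100)
      [0, 1, 2, 3, 4, 8, 9, 10, 11, 12, 13, 14, 15, 16, 17, 18, 20, 21, 22]
      [4, 10, 11, 12, 13, 16] [] [] rfl (by decide)
      (fun i τ => ∃ U₁ U₂, PairsInv G A B ma mb fs S₁ S₂ T₁ T₂ σ U₁ U₂ (p * mb + i) τ)
      ?_ ?_ ?_ ?_ ?_).post ?_)
    · rintro i τ x ⟨U₁, U₂, h⟩
      exact ⟨U₁, U₂, by simpa using h.pow, by simpa using h.idx, by simpa using h.distinct,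
        by simpa [StateTable] using h.table, by simpa using h.pow_lt, by simpa using h.entry,
            h.st, h.pw⟩
    · simp [hf.reg, ho]
    · simp [hf.reg, hmb]
    · simpa using hI
    · rintro q hq τ' hτ' hf' ⟨U₁, U₂, h⟩
      refine (mergeProg_run (M := M) (p := p) (q := q) (s₀ := s₀) (s₁ := s₁) hAB
        ?_ ?_ ?_ ?_ ?_ ?_ ?_ ?_ hτ' hp hq (hS.congr hs₀m h.st) (hT.congr hs₁m h.st)
        hSA hTB hP hM h)
      · simp [hf'.reg, hf.reg, hz]
      · simp [hf'.reg, hf.reg, ho]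
      · simp [hf'.reg, hf.reg, hn]
      · simp [hf'.reg, hf.reg, hfs]
      · simp [hf'.reg, hf.reg, hs₀]
      · simp [hf'.reg, hf.reg, hs₁]
      · simp [hf'.reg, hf.reg, hmask]
      · simp [hf'.reg, hτ]
    · rintro τ' ⟨h, -⟩
      rwa [Nat.succ_mul]
  · simp

theorem PairsInv.isJoinTable {U₁ U₂ : ℕ → Finset (Fin n)} {σ : RamState}
    (h : PairsInv G A B ma mb fs S₁ S₂ T₁ T₂ σ₀ U₁ U₂ (ma * mb) σ) :
    IsJoinTable G A B ma mb (σ.reg 20) S₁ S₂ T₁ T₂ U₁ U₂ fun p q => σ.mem 16 (p * mb + q) := by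
  have key : ∀ p < ma, ∀ q < mb, p * mb + q < ma * mb := by
    intro p hp q hq
    have : (p + 1) * mb ≤ ma * mb := Nat.mul_le_mul_right _ hp
    rw [Nat.succ_mul] at this
    omega
  exact ⟨fun r hr => (h.distinct.1 r hr).1, fun r hr => (h.distinct.1 r hr).2,
    fun p hp q hq => (h.entry p hp q hq (key p hp q hq)).1,
    fun p hp q hq => (h.entry p hp q hq (key p hp q hq)).2.1,
    fun p hp q hq h0 => ((h.entry p hp q hq (key p hp q hq)).2.2 h0).1,
    fun p hp q hq h0 => ((h.entry p hp q hq (key p hp q hq)).2.2 h0).2⟩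

end Pairs

/-! ### The candidates of a join -/

/-- Clear the cells `0, …, m` of array `19`. -/
def clearProg : RamProg :=
  .seq (.block [.add 8 20 61]) (.up 9 8 (.block [.store 19 9 60]))

theorem clearProg_run {σ : RamState} {m : ℕ} (hz : σ.reg 60 = 0) (ho : σ.reg 61 = 1)
    (hm : σ.reg 20 = m) :
    Run clearProg σ (m * 4 + 8) fun σ' => (∀ j ≤ m, σ'.mem 19 j = 0) ∧
      Frame [0, 8, 9] [19] [] [] σ σ' := by
  refine Run.frame _ _ _ _ rfl ?_
  refine Run.block_seq_le (by simp) (((Run.up (N := m + 1) (b := 2) [0] [19] [] [] rfl (by decide)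
    (fun i τ => ∀ j < i, τ.mem 19 j = 0) ?_ ?_ ?_ ?_ ?_).post ?_).weaken ?_)
  · intro i σ x h; simpa using h
  · simpa using ho
  · simp [hm, ho]
  · simp
  · rintro i hi τ hτ hf h
    have h60 : τ.reg 60 = 0 := by simp [hf.reg, hz]
    refine Run.block_le (by simp) fun j hj => ?_
    by_cases hji : j = i
    · simp [hτ, hji, h60]
    · simp [hτ, hji, h j (by omega)]
  · rintro τ ⟨h, -⟩ j hj
    exact h j (by omega)
  · simp; omega

/-- Multiply the bit vectors in the arrays `17` and `18` into array `19`, using the table in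
array `16`. -/
def toggleProg : RamProg :=
  .seq (.block [.const 10 0]) (.up 11 24 (.up 12 28 (.seq (.block [.load 13 16 10, .load 14 17 11,
    .load 15 18 12, .add 10 10 61]) (.ite (.eq 14 61) (.ite (.eq 15 61)
      (.block [.load 16 19 13, .sub 16 61 16, .store 19 13 16]) (.block [])) (.block [])))))

/-- Parities are kept as `0` or `1` and flipped by subtraction from `1`. Table entries are shifted
by one, so coordinate `j` gathers in cell `j + 1` and the incompatible pairs in cell `0`. -/
theorem toggleProg_run {σ : RamState} {m ma mb x y : ℕ} (ho : σ.reg 61 = 1)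
    (hma : σ.reg 24 = ma) (hmb : σ.reg 28 = mb)
    (hx : ∀ i < ma, σ.mem 17 i = (x.testBit i).toNat)
    (hy : ∀ i < mb, σ.mem 18 i = (y.testBit i).toNat) (hT : ∀ j ≤ m, σ.mem 19 j = 0) :
    Run toggleProg σ (ma * (mb * 13 + 4) + 4) fun σ' =>
      (∀ j ≤ m, σ'.mem 19 j ≤ 1 ∧ (σ'.mem 19 j : ZMod 2) =
        ∑ p ∈ Finset.range ma, ∑ q ∈ Finset.range mb,
          if σ.mem 16 (p * mb + q) = j then bitVec x p * bitVec y q else 0) ∧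
      Frame [0, 10, 11, 12, 13, 14, 15, 16] [19] [] [] σ σ' := by
  refine Run.frame _ _ _ _ rfl ?_
  refine Run.block_seq_le (by simp) (((Run.up (N := ma) (b := mb * 13 + 2)
    [0, 10, 12, 13, 14, 15, 16] [19] [] [] rfl (by decide)
    (fun i τ => τ.reg 10 = i * mb ∧ ∀ j ≤ m, τ.mem 19 j ≤ 1 ∧ (τ.mem 19 j : ZMod 2) =
        ∑ p ∈ Finset.range i, ∑ q ∈ Finset.range mb,
          if σ.mem 16 (p * mb + q) = j then bitVec x p * bitVec y q else 0)
    ?_ ?_ ?_ ?_ ?_).post fun _ h => h.1.2).weaken ?_)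
  · intro i σ x h; simpa using h
  · simpa using ho
  · simpa using hma
  · simp +contextual [hT]
  · rintro p hp τ hτ hf ⟨h10, h⟩
    refine ((Run.up (N := mb) (b := 11)
      [0, 10, 13, 14, 15, 16] [19] [] [] rfl (by decide)
      (fun i τ' => τ'.reg 10 = p * mb + i ∧ ∀ j ≤ m, τ'.mem 19 j ≤ 1 ∧ (τ'.mem 19 j : ZMod 2) =
          (τ.mem 19 j : ZMod 2) + ∑ q ∈ Finset.range i,
            if σ.mem 16 (p * mb + q) = j then bitVec x p * bitVec y q else 0)
      ?_ ?_ ?_ ?_ ?_).post ?_)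
    · intro i σ x h; simpa using h
    · simp [hf.reg, ho]
    · simp [hf.reg, hmb]
    · simpa [h10] using fun j hj => (h j hj).1
    · rintro q hq τ' hτ' hf' ⟨h10', h'⟩
      have m16 : τ'.mem 16 = σ.mem 16 := by simp [hf.mem, hf'.mem]
      have m17 : τ'.mem 17 = σ.mem 17 := by simp [hf.mem, hf'.mem]
      have m18 : τ'.mem 18 = σ.mem 18 := by simp [hf.mem, hf'.mem]
      have r11 : τ'.reg 11 = p := by simp [hf'.reg, hτ]
      have h61 : τ'.reg 61 = 1 := by simp [hf.reg, hf'.reg, ho]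
      have skip : bitVec x p * bitVec y q = 0 → ∀ j ≤ m, τ'.mem 19 j ≤ 1 ∧
          (τ'.mem 19 j : ZMod 2) = (τ.mem 19 j : ZMod 2) + ∑ q ∈ Finset.range (q + 1),
            if σ.mem 16 (p * mb + q) = j then bitVec x p * bitVec y q else 0 := by
        intro h0 j hj
        rw [Finset.sum_range_succ, h0, ite_self, add_zero]
        exact h' j hj
      refine Run.block_seq_le (by simp) (Run.ite_le (by simp) (fun hb => ?_) (fun hb => ?_))
      · simp [RamTest.Holds, h61, m17, r11, hx p hp] at hb
        refine Run.ite_le (by simp) (fun hb' => ?_) (fun hb' => ?_)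
        · simp [RamTest.Holds, h61, m18, hτ', hy q hq] at hb'
          refine Run.block_le (by simp) ⟨by simp [h10', h61]; ring, fun j hj => ?_⟩
          have hbb : bitVec x p * bitVec y q = 1 := by simp [bitVec, hb, hb']
          rw [Finset.sum_range_succ, hbb]
          obtain ⟨h1, h2⟩ := h' j hj
          by_cases hji : σ.mem 16 (p * mb + q) = j
          · have : τ'.mem 19 j = 0 ∨ τ'.mem 19 j = 1 := by omega
            rw [← add_assoc, ← h2, if_pos hji]
            rcases this with h0 | h0
            · simp [h10', h61, m16, hji, h0]
            · simp [h10', h61, m16, hji, h0]; decide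
          · rw [← add_assoc, ← h2, if_neg hji, add_zero]
            have : j ≠ σ.mem 16 (p * mb + q) := Ne.symm hji
            simp [h10', m16, this, h1]
        · simp [RamTest.Holds, h61, m18, hτ', hy q hq] at hb'
          refine Run.block_le (by simp) ⟨by simp [h10', h61]; ring, ?_⟩
          simpa using skip (by simp [bitVec, hb'])
      · simp [RamTest.Holds, h61, m17, r11, hx p hp] at hb
        refine Run.block_le (by simp) ⟨by simp [h10', h61]; ring, ?_⟩
        simpa using skip (by simp [bitVec, hb])
    · rintro τ' ⟨⟨h10', h'⟩, -⟩
      refine ⟨by rw [h10', Nat.succ_mul], fun j hj => ⟨(h' j hj).1, ?_⟩⟩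
      rw [(h' j hj).2, (h j hj).2, ← Finset.sum_range_succ
        (fun p => ∑ q ∈ Finset.range mb,
          if σ.mem 16 (p * mb + q) = j then bitVec x p * bitVec y q else 0)]
  · simp

/-- Make a candidate of the union of the elements in the registers `34` and `35`. -/
def candProg : RamProg :=
  .seq (.block [.add 9 29 35, .load 0 15 9, .copy 2 28]) <| .seq (unpackProg 18) <|
  .seq clearProg <| .seq toggleProg <| .seq packProg <|
  .block [.add 8 25 34, .add 9 29 35, .store 21 22 3, .store 22 22 3, .load 16 14 8, .load 17 14 9,
    .add 16 16 17, .store 20 22 16, .wload 0 1 8, .wload 1 1 9, .wadd 0 0 1, .wstore 2 22 0,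
    .add 22 22 61]

/-- Cell `c` of the arrays of candidates describes the union of two elements. -/
def IsCandidate (ma mb m ea eb : ℕ) (σ₀ : RamState) (i j c : ℕ) (σ : RamState) : Prop :=
  bitVec (σ.mem 21 c) = joinForm ma mb (fun p q => σ₀.mem 16 (p * mb + q))
    (bitVec (σ₀.mem 15 (ea + i))) (bitVec (σ₀.mem 15 (eb + j))) ∧
  σ.mem 21 c < 2 ^ m ∧ σ.mem 22 c = σ.mem 21 c ∧
  σ.mem 20 c = σ₀.mem 14 (ea + i) + σ₀.mem 14 (eb + j) ∧
  σ.wmem 2 c = σ₀.wmem 1 (ea + i) + σ₀.wmem 1 (eb + j)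

section Candidates

variable {ma mb m ea eb La Lb : ℕ} {σ₀ : RamState}

/-- The bilinear form is evaluated on unpacked vectors and the result is packed again. Coordinates
from `m` on vanish on both sides, because table entries are at most `m`. -/
theorem candProg_run {σ : RamState} {i j c : ℕ} (hz : σ.reg 60 = 0) (ho : σ.reg 61 = 1)
    (hm : σ.reg 20 = m) (hma : σ.reg 24 = ma) (hmb : σ.reg 28 = mb) (hea : σ.reg 25 = ea)
    (heb : σ.reg 29 = eb) (hi : σ.reg 34 = i) (hj : σ.reg 35 = j) (hc : σ.reg 22 = c)
    (hPb : ∀ i < mb, σ.mem 4 i = 2 ^ i) (hPm : ∀ i < m, σ.mem 4 i = 2 ^ i)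
    (h14 : σ.mem 14 = σ₀.mem 14) (h15 : σ.mem 15 = σ₀.mem 15) (h16 : σ.mem 16 = σ₀.mem 16)
    (hw : σ.wmem 1 = σ₀.wmem 1)
    (hX : ∀ p < ma, σ.mem 17 p = ((σ₀.mem 15 (ea + i)).testBit p).toNat)
    (hY : σ₀.mem 15 (eb + j) < 2 ^ mb)
    (hJ : ∀ p < ma, ∀ q < mb, σ₀.mem 16 (p * mb + q) ≤ m) :
    Run candProg σ (mb * 8 + m * 13 + ma * (mb * 13 + 4) + 40) fun σ' =>
      (IsCandidate ma mb m ea eb σ₀ i j c σ' ∧ σ'.reg 22 = c + 1 ∧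
        (∀ a, a = 20 ∨ a = 21 ∨ a = 22 → ∀ k ≠ c, σ'.mem a k = σ.mem a k) ∧
        ∀ k ≠ c, σ'.wmem 2 k = σ.wmem 2 k) ∧
      Frame [0, 2, 3, 4, 5, 8, 9, 10, 11, 12, 13, 14, 15, 16, 17, 22] [18, 19, 20, 21, 22]
        [0, 1] [2] σ σ' := by
  refine Run.frame _ _ _ _ rfl ?_
  refine Run.block_seq_le (by simp) (Run.seq_le _ (unpackProg_run (by norm_num)
    (x := σ₀.mem 15 (eb + j)) (k := mb) ?_ ?_ ?_ ?_ hY ?_) (by simp; omega) ?_)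
  · simp [hz]
  · simp [ho]
  · simp [heb, hj, h15]
  · simp [hmb]
  · simpa using hPb
  rintro τ₁ ⟨h18, f1⟩
  refine Run.seq_le _ (clearProg_run (m := m) ?_ ?_ ?_) (by simp; omega) ?_
  · simp [f1.reg, hz]
  · simp [f1.reg, ho]
  · simp [f1.reg, hm]
  rintro τ₂ ⟨h19, f2⟩
  refine Run.seq_le _ (toggleProg_run (m := m) (ma := ma) (mb := mb) (x := σ₀.mem 15 (ea + i))
    (y := σ₀.mem 15 (eb + j)) ?_ ?_ ?_ ?_ ?_ h19) (by simp; omega) ?_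
  · simp [f2.reg, f1.reg, ho]
  · simp [f2.reg, f1.reg, hma]
  · simp [f2.reg, f1.reg, hmb]
  · simpa [f2.mem, f1.mem] using hX
  · simpa [f2.mem] using h18
  rintro τ₃ ⟨h3, f3⟩
  refine Run.seq_le _ (packProg_run (m := m) (b := fun r => decide (τ₃.mem 19 (r + 1) = 1))
    ?_ ?_ ?_ ?_) (by simp; omega) ?_
  · simp [f3.reg, f2.reg, f1.reg, ho]
  · simp [f3.reg, f2.reg, f1.reg, hm]
  · intro r hr
    have := (h3 (r + 1) hr).1
    interval_cases h : τ₃.mem 19 (r + 1) <;> simp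
  · simpa [f3.mem, f2.mem, f1.mem] using hPm
  rintro τ₄ ⟨⟨h4, h4'⟩, f4⟩
  refine Run.block_le (by simp; omega) ⟨⟨?_, ?_, ?_, ?_, ?_⟩, ?_, ?_, ?_⟩
  · simp [f4.reg, f3.reg, f2.reg, f1.reg, hc]
    ext r
    rw [joinForm_apply, bitVec]
    have m16 : τ₂.mem 16 = σ₀.mem 16 := by simp [f2.mem, f1.mem, h16]
    rcases lt_or_ge r m with hr | hr
    · have h5 := h3 (r + 1) hr
      rw [m16] at h5
      rw [h4' r hr, ← h5.2]
      have := h5.1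
      interval_cases h : τ₃.mem 19 (r + 1) <;> simp
    · rw [Nat.testBit_lt_two_pow (h4.trans_le (Nat.pow_le_pow_right (by norm_num) hr))]
      symm
      simp only [Bool.false_eq_true, if_false]
      refine Finset.sum_eq_zero fun p hp => Finset.sum_eq_zero fun q hq => if_neg ?_
      have := hJ p (Finset.mem_range.1 hp) q (Finset.mem_range.1 hq)
      omega
  · simp [f4.reg, f3.reg, f2.reg, f1.reg, hc, h4]
  · simp [f4.reg, f3.reg, f2.reg, f1.reg, hc]
  · simp [f4.reg, f3.reg, f2.reg, f1.reg, f4.mem, f3.mem, f2.mem, f1.mem, hc, hea, heb, hi, hj, h14]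
  · simp [f4.reg, f3.reg, f2.reg, f1.reg, f4.wmem, f3.wmem, f2.wmem, f1.wmem, hc, hea, heb, hi, hj,
      hw]
  · simp [f4.reg, f3.reg, f2.reg, f1.reg, hc, ho]
  · rintro a (rfl | rfl | rfl) k hk <;>
      simp [f4.reg, f3.reg, f2.reg, f1.reg, f4.mem, f3.mem, f2.mem, f1.mem, hc, hk]
  · rintro k hk
    simp [f4.reg, f3.reg, f2.reg, f1.reg, f4.wmem, f3.wmem, f2.wmem, f1.wmem, hc, hk]

/-- Compute all candidates. -/
def candsProg : RamProg :=
  .seq (.block [.const 22 0]) (.up 34 26 (.seq (.block [.add 8 25 34, .load 0 15 8, .copy 2 24])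
    (.seq (unpackProg 17) (.up 35 30 candProg))))

theorem candsProg_run {σ : RamState} (hz : σ.reg 60 = 0) (ho : σ.reg 61 = 1)
    (hm : σ.reg 20 = m) (hma : σ.reg 24 = ma) (hmb : σ.reg 28 = mb) (hea : σ.reg 25 = ea)
    (heb : σ.reg 29 = eb) (hLa : σ.reg 26 = La) (hLb : σ.reg 30 = Lb)
    (hPa : ∀ i < ma, σ.mem 4 i = 2 ^ i) (hPb : ∀ i < mb, σ.mem 4 i = 2 ^ i)
    (hPm : ∀ i < m, σ.mem 4 i = 2 ^ i)
    (hX : ∀ i < La, σ.mem 15 (ea + i) < 2 ^ ma) (hY : ∀ j < Lb, σ.mem 15 (eb + j) < 2 ^ mb)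
    (hJ : ∀ p < ma, ∀ q < mb, σ.mem 16 (p * mb + q) ≤ m) :
    Run candsProg σ (La * (ma * 8 + Lb * (mb * 8 + m * 13 + ma * (mb * 13 + 4) + 40 + 2) + 9) + 4)
      fun σ' =>
      (σ'.reg 22 = La * Lb ∧
        ∀ i < La, ∀ j < Lb, IsCandidate ma mb m ea eb σ i j (i * Lb + j) σ') ∧
      Frame [0, 2, 3, 4, 5, 8, 9, 10, 11, 12, 13, 14, 15, 16, 17, 22, 34, 35]
        [17, 18, 19, 20, 21, 22] [0, 1] [2] σ σ' := by
  have hidx : ∀ i < La, ∀ j < Lb, i * Lb + j < La * Lb := by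
    intro p hp q hq
    have : (p + 1) * Lb ≤ La * Lb := Nat.mul_le_mul_right _ hp
    rw [Nat.succ_mul] at this
    omega
  refine Run.frame _ _ _ _ rfl ?_
  refine Run.block_seq_le (by simp) (((Run.up (N := La)
    (b := ma * 8 + Lb * (mb * 8 + m * 13 + ma * (mb * 13 + 4) + 40 + 2) + 7)
    [0, 2, 3, 4, 5, 8, 9, 10, 11, 12, 13, 14, 15, 16, 17, 22, 35]
    [17, 18, 19, 20, 21, 22] [0, 1] [2] rfl (by decide)
    (fun t τ => τ.reg 22 = t * Lb ∧ ∀ i < La, ∀ j < Lb, i * Lb + j < t * Lb →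
      IsCandidate ma mb m ea eb σ i j (i * Lb + j) τ)
    ?_ ?_ ?_ ?_ ?_).post ?_).weaken ?_)
  · intro i σ x h; simpa [IsCandidate] using h
  · simpa using ho
  · simpa using hLa
  · simp
  · rintro i hi τ hτ hf ⟨h22, h⟩
    refine Run.block_seq_le (by simp) (Run.seq_le _ (unpackProg_run (by norm_num)
      (x := σ.mem 15 (ea + i)) (k := ma) ?_ ?_ ?_ ?_ (hX i hi) ?_) (by simp; omega) ?_)
    · simp [hf.reg, hz]
    · simp [hf.reg, ho]
    · simp [hf.reg, hf.mem, hea, hτ]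
    · simp [hf.reg, hma]
    · simpa [hf.mem] using hPa
    rintro τ₁ ⟨h17, f1⟩
    refine ((Run.up (N := Lb) (b := mb * 8 + m * 13 + ma * (mb * 13 + 4) + 40)
      [0, 2, 3, 4, 5, 8, 9, 10, 11, 12, 13, 14, 15, 16, 17, 22]
      [18, 19, 20, 21, 22] [0, 1] [2] rfl (by decide)
      (fun t τ => τ.reg 22 = i * Lb + t ∧ ∀ i' < La, ∀ j < Lb, i' * Lb + j < i * Lb + t →
        IsCandidate ma mb m ea eb σ i' j (i' * Lb + j) τ)
      ?_ ?_ ?_ ?_ ?_).post ?_).weaken (by simp; omega)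
    · intro i σ x h; simpa [IsCandidate] using h
    · simp [f1.reg, hf.reg, ho]
    · simp [f1.reg, hf.reg, hLb]
    · refine ⟨by simp [f1.reg, h22], fun i' hi' j hj hlt => ?_⟩
      have := h i' hi' j hj hlt
      simpa [IsCandidate, f1.mem, f1.wmem] using this
    · rintro j hj τ₂ hτ₂ f2 ⟨h22', h'⟩
      refine (candProg_run (m := m) (ma := ma) (mb := mb) (ea := ea) (eb := eb) (i := i) (j := j)
        (σ₀ := σ) ?_ ?_ ?_ ?_ ?_ ?_ ?_ ?_ hτ₂ h22' ?_ ?_ ?_ ?_ ?_ ?_ ?_ (hY j hj) hJ).post ?_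
      · simp [f2.reg, f1.reg, hf.reg, hz]
      · simp [f2.reg, f1.reg, hf.reg, ho]
      · simp [f2.reg, f1.reg, hf.reg, hm]
      · simp [f2.reg, f1.reg, hf.reg, hma]
      · simp [f2.reg, f1.reg, hf.reg, hmb]
      · simp [f2.reg, f1.reg, hf.reg, hea]
      · simp [f2.reg, f1.reg, hf.reg, heb]
      · simp [f2.reg, f1.reg, hτ]
      · simpa [f2.mem, f1.mem, hf.mem] using hPb
      · simpa [f2.mem, f1.mem, hf.mem] using hPm
      · simp [f2.mem, f1.mem, hf.mem]
      · simp [f2.mem, f1.mem, hf.mem]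
      · simp [f2.mem, f1.mem, hf.mem]
      · simp [f2.wmem, f1.wmem, hf.wmem]
      · simpa [f2.mem] using h17
      rintro τ₃ ⟨⟨hc, h22₃, hm₃, hw₃⟩, -⟩
      refine ⟨by omega, fun i' hi' j' hj' hlt => ?_⟩
      rcases idx_lt hj' hlt hj with hlt | ⟨rfl, rfl⟩
      · have hne : i' * Lb + j' ≠ i * Lb + j := by omega
        have := h' i' hi' j' hj' hlt
        unfold IsCandidate at this ⊢
        rwa [hm₃ 20 (by simp) _ hne, hm₃ 21 (by simp) _ hne, hm₃ 22 (by simp) _ hne, hw₃ _ hne]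
      · exact hc
    · rintro τ₂ ⟨h, -⟩
      rwa [Nat.succ_mul]
  · rintro τ ⟨⟨h22, h⟩, -⟩
    exact ⟨h22, fun i hi j hj => h i hi j hj (hidx i hi j hj)⟩
  · simp

end Candidates

/-! ### Gaussian elimination -/

/-- Both numbers have leading bit `i`, which cancels. -/
theorem xor_lt_of_le {i x y : ℕ} (hx : 2 ^ i ≤ x) (hx' : x < 2 ^ (i + 1)) (hy : 2 ^ i ≤ y)
    (hy' : y < 2 ^ (i + 1)) : x ^^^ y < 2 ^ i := by
  obtain ⟨a, rfl⟩ := Nat.exists_eq_add_of_le hx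
  obtain ⟨b, rfl⟩ := Nat.exists_eq_add_of_le hy
  rw [pow_succ] at hx' hy'
  have ha : a < 2 ^ i := by omega
  have hb : b < 2 ^ i := by omega
  have h := add_eq_xor_add_two_mul_and (2 ^ i + a) (2 ^ i + b)
  have h' := add_eq_xor_add_two_mul_and a b
  rw [and_two_pow_add ha hb] at h
  have := Nat.xor_lt_two_pow ha hb
  omega

theorem xor_eq_sub (x y : ℕ) : x ^^^ y = x + y - (x &&& y) - (x &&& y) := by
  have h := add_eq_xor_add_two_mul_and x y
  omega

/-- Find a candidate of minimum weight among those that are not smaller than register `9`. -/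
def selectProg : RamProg :=
  .up 11 22 (.seq (.block [.load 12 22 11]) (.ite (.lt 12 9) (.block [])
    (.seq (.block [.wload 1 2 11]) (.ite (.eq 10 60)
      (.block [.const 10 1, .wcopy 0 1, .copy 13 11])
      (.ite (.wlt 1 0) (.block [.wcopy 0 1, .copy 13 11]) (.block []))))))

theorem selectProg_run {σ : RamState} {N b : ℕ} (hz : σ.reg 60 = 0) (ho : σ.reg 61 = 1)
    (hN : σ.reg 22 = N) (hb : σ.reg 9 = b) (h10 : σ.reg 10 = 0) :
    Run selectProg σ (N * 14 + 2) fun σ' =>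
      ((σ'.reg 10 = 0 ∧ ∀ c < N, σ.mem 22 c < b) ∨
        (σ'.reg 10 = 1 ∧ σ'.reg 13 < N ∧ b ≤ σ.mem 22 (σ'.reg 13) ∧
          σ'.wreg 0 = σ.wmem 2 (σ'.reg 13) ∧
          ∀ c < N, b ≤ σ.mem 22 c → σ'.wreg 0 ≤ σ.wmem 2 c)) ∧
      Frame [0, 10, 11, 12, 13] [] [0, 1] [] σ σ' := by
  refine Run.frame _ _ _ _ rfl ?_
  refine ((Run.up (N := N) (b := 12) [0, 10, 12, 13] [] [0, 1] [] rfl (by decide)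
    (fun i τ => (τ.reg 10 = 0 ∧ ∀ c < i, σ.mem 22 c < b) ∨
        (τ.reg 10 = 1 ∧ τ.reg 13 < i ∧ b ≤ σ.mem 22 (τ.reg 13) ∧
          τ.wreg 0 = σ.wmem 2 (τ.reg 13) ∧
          ∀ c < i, b ≤ σ.mem 22 c → τ.wreg 0 ≤ σ.wmem 2 c))
    ?_ ho hN ?_ ?_).post fun _ h => h.1)
  · intro i σ x h; simpa using h
  · simp [h10]
  · rintro i hi τ hτ hf h
    have m22 : τ.mem 22 = σ.mem 22 := by simp [hf.mem]
    have w2 : τ.wmem 2 = σ.wmem 2 := by simp [hf.wmem]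
    have r9 : τ.reg 9 = b := by simp [hf.reg, hb]
    have r60 : τ.reg 60 = 0 := by simp [hf.reg, hz]
    refine Run.block_seq_le (by simp) (Run.ite_le (by simp) (fun hlt => ?_) (fun hlt => ?_))
    · simp [RamTest.Holds, m22, r9, hτ] at hlt
      refine Run.block_le (by simp) ?_
      simp only [exec_nil, exec_cons, RamInstr.apply_load, RamState.setReg_reg,
          RamState.setReg_wreg]
      rcases h with ⟨h0, h⟩ | ⟨h0, h1, h2, h3, h4⟩
      · refine Or.inl ⟨by simpa using h0, fun c hc => ?_⟩
        rcases Nat.lt_succ_iff_lt_or_eq.1 hc with hc | rfl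
        exacts [h c hc, hlt]
      · refine Or.inr ⟨by simpa using h0, by simp; omega, by simpa using h2, by simpa using h3,
          fun c hc hbc => ?_⟩
        rcases Nat.lt_succ_iff_lt_or_eq.1 hc with hc | rfl
        exacts [h4 c hc hbc, by omega]
    · simp [RamTest.Holds, m22, r9, hτ] at hlt
      refine Run.block_seq_le (by simp) (Run.ite_le (by simp) (fun h10 => ?_) (fun h10 => ?_))
      · simp [RamTest.Holds, r60] at h10
        refine Run.block_le (by simp) (Or.inr ?_)
        simp [hτ, hlt, w2]
        rcases h with ⟨h0, h⟩ | ⟨h0, -⟩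
        · intro c hc hbc
          rcases Nat.lt_or_eq_of_le hc with hc | rfl
          · exact absurd (h c hc) (by omega)
          · exact le_rfl
        · omega
      · simp [RamTest.Holds, r60] at h10
        obtain ⟨h0, h1, h2, h3, h4⟩ := h.resolve_left fun h => h10 h.1
        refine Run.ite_le (by simp) (fun hw => ?_) (fun hw => ?_)
        · simp [RamTest.Holds, hτ, w2] at hw
          refine Run.block_le (by simp) (Or.inr ?_)
          simp [hτ, hlt, w2, h0]
          intro c hc hbc
          rcases Nat.lt_or_eq_of_le hc with hc | rfl
          · exact hw.le.trans (h4 c hc hbc)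
          · exact le_rfl
        · simp [RamTest.Holds, hτ, w2] at hw
          refine Run.block_le (by simp) (Or.inr ?_)
          simp [h0, h2, h3]
          refine ⟨by omega, fun c hc hbc => ?_⟩
          rw [← h3]
          rcases Nat.lt_or_eq_of_le hc with hc | rfl
          · exact h4 c hc hbc
          · exact hw

/-- Add the vector in register `16` to all vectors that are not smaller than register `9`. -/
def elimProg : RamProg :=
  .up 11 22 (.seq (.block [.load 12 22 11]) (.ite (.lt 12 9) (.block [])
    (.seq (.block [.copy 0 12, .copy 1 16, .copy 2 20]) (.seq andProg
      (.block [.add 12 12 16, .sub 12 12 3, .sub 12 12 3, .store 22 11 12])))))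

theorem elimProg_run {σ : RamState} {N b m y : ℕ} (hz : σ.reg 60 = 0) (ho : σ.reg 61 = 1)
    (hN : σ.reg 22 = N) (hb : σ.reg 9 = b) (hy : σ.reg 16 = y) (hm : σ.reg 20 = m)
    (hlt : ∀ c < N, σ.mem 22 c < 2 ^ m) (hym : y < 2 ^ m) (hP : ∀ i < m, σ.mem 4 i = 2 ^ i) :
    Run elimProg σ (N * (m * 11 + 17) + 2) fun σ' =>
      (∀ c < N, σ'.mem 22 c = if σ.mem 22 c < b then σ.mem 22 c else σ.mem 22 c ^^^ y) ∧
      Frame [0, 1, 2, 3, 4, 11, 12] [22] [] [] σ σ' := by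
  refine Run.frame _ _ _ _ rfl ?_
  refine ((Run.up (N := N) (b := m * 11 + 15) [0, 1, 2, 3, 4, 12] [22] [] [] rfl (by decide)
    (fun i τ => ∀ c < N, τ.mem 22 c = if c < i ∧ ¬ σ.mem 22 c < b then σ.mem 22 c ^^^ y
      else σ.mem 22 c) ?_ ho hN ?_ ?_).post ?_)
  · intro i σ x h; simpa using h
  · simp
  · rintro i hi τ hτ hf h
    have m22 : τ.mem 22 i = σ.mem 22 i := by simp [h i hi]
    have r9 : τ.reg 9 = b := by simp [hf.reg, hb]
    refine Run.block_seq_le (by simp) (Run.ite_le (by simp) (fun hl => ?_) (fun hl => ?_))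
    · simp [RamTest.Holds, m22, r9, hτ] at hl
      refine Run.block_le (by simp) fun c hc => ?_
      simp only [exec_nil, exec_cons, RamInstr.apply_load, RamState.setReg_mem, h c hc]
      by_cases hci : c = i
      · subst hci; simp [hl]
      · have : c < i + 1 ↔ c < i := by omega
        simp [this]
    · simp [RamTest.Holds, m22, r9, hτ] at hl
      refine Run.block_seq_le (by simp) (Run.seq_le _ (andProg_run (x := σ.mem 22 i) (y := y)
        (k := m) ?_ ?_ ?_ ?_ ?_ (hlt i hi) hym ?_) (by simp) ?_)
      · simp [hf.reg, hz]
      · simp [hf.reg, ho]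
      · simp [hτ, m22]
      · simp [hf.reg, hy]
      · simp [hf.reg, hm]
      · simpa [hf.mem] using hP
      rintro τ₁ ⟨h3, f1⟩
      refine Run.block_le (by simp) fun c hc => ?_
      by_cases hci : c = i
      · subst hci
        simp [f1.reg, hf.reg, hτ, h3, m22, hy, ← xor_eq_sub]
        intro; omega
      · have : c < i + 1 ↔ c < i := by omega
        simp [f1.reg, f1.mem, hτ, hci, this, h c hc]
  · rintro τ ⟨h, -⟩ c hc
    rw [h c hc]
    split_ifs <;> simp_all

/-- Output a candidate of minimum weight that has the bit in register `8`, and eliminate this bit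
from all candidates. -/
def pivotProg : RamProg :=
  .seq (.block [.load 9 4 8, .const 10 0]) <| .seq selectProg <|
  .ite (.eq 10 61) (.seq (.block [.add 14 42 21, .load 15 20 13, .store 14 14 15, .load 15 21 13,
    .store 15 14 15, .wstore 1 14 0, .add 21 21 61, .load 16 22 13]) elimProg) (.block [])

section Reduce

variable (fe m N : ℕ) (σ₀ : RamState)

/-- The contents of the memory when `i` bits are left. -/
structure ReduceInv (i : ℕ) (σ : RamState) : Prop where
  le : σ.reg 21 + i ≤ m
  lt : ∀ c < N, σ.mem 22 c < 2 ^ i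
  out : ∀ e < σ.reg 21, ∃ c < N, σ.mem 14 (fe + e) = σ₀.mem 20 c ∧
    σ.mem 15 (fe + e) = σ₀.mem 21 c ∧ σ.wmem 1 (fe + e) = σ₀.wmem 2 c
  span : ∀ c < N, bitVec (σ₀.mem 21 c) - bitVec (σ.mem 22 c) ∈ Submodule.span (ZMod 2)
    {x | ∃ e < σ.reg 21, σ.wmem 1 (fe + e) ≤ σ₀.wmem 2 c ∧ bitVec (σ.mem 15 (fe + e)) = x}
  el : ∀ a, 14 ≤ a → a < 16 → ∀ i < fe, σ.mem a i = σ₀.mem a i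
  wt : ∀ i < fe, σ.wmem 1 i = σ₀.wmem 1 i

variable {fe m N σ₀}

/-- All working vectors are below `2 ^ (i + 1)`, so having bit `i` means not being below `2 ^ i`.
The pivot is a lightest candidate with this bit, and what is output is its original vector, which
belongs to an actual set. There is at most one output for each bit. -/
theorem pivotProg_run {σ : RamState} {i : ℕ} (hz : σ.reg 60 = 0) (ho : σ.reg 61 = 1)
    (hN : σ.reg 22 = N) (hm : σ.reg 20 = m) (hfe : σ.reg 42 = fe) (hi : σ.reg 8 = i)
    (him : i < m)
    (hP : ∀ i < m, σ.mem 4 i = 2 ^ i) (h20 : σ.mem 20 = σ₀.mem 20) (h21 : σ.mem 21 = σ₀.mem 21)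
    (hw : σ.wmem 2 = σ₀.wmem 2) (h : ReduceInv fe m N σ₀ (i + 1) σ) :
    Run pivotProg σ (N * (m * 11 + 31) + 20) (ReduceInv fe m N σ₀ i) := by
  have hT : N * (m * 11 + 31) = N * 14 + N * (m * 11 + 17) := by ring
  rw [hT]
  refine Run.block_seq_le (by simp) (Run.seq_le _ (selectProg_run (N := N) (b := 2 ^ i)
    ?_ ?_ ?_ ?_ ?_) (by simp; omega) ?_)
  · simp [hz]
  · simp [ho]
  · simp [hN]
  · simp [hi, hP i him]
  · simp
  rintro τ ⟨hs, f⟩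
  have m22 : τ.mem 22 = σ.mem 22 := by simp [f.mem]
  refine Run.ite_le (by simp; omega) (fun hb => ?_) (fun hb => ?_)
  · simp [RamTest.Holds, f.reg, ho] at hb
    obtain ⟨-, hpN, hpb, hpw, hmin⟩ := hs.resolve_left (by omega)
    simp at hpb hpw hmin
    set p := τ.reg 13 with hp
    set τ₁ := exec [.add 14 42 21, .load 15 20 13, .store 14 14 15, .load 15 21 13,
      .store 15 14 15, .wstore 1 14 0, .add 21 21 61, .load 16 22 13] τ with hτ₁
    have y14 : τ₁.mem 14 = Function.update (σ.mem 14) (fe + σ.reg 21) (σ₀.mem 20 p) := by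
      simp [hτ₁, f.reg, f.mem, hfe, h20, hp]
    have y15 : τ₁.mem 15 = Function.update (σ.mem 15) (fe + σ.reg 21) (σ₀.mem 21 p) := by
      simp [hτ₁, f.reg, f.mem, hfe, h21, hp]
    have yw : τ₁.wmem 1 = Function.update (σ.wmem 1) (fe + σ.reg 21) (σ₀.wmem 2 p) := by
      simp [hτ₁, f.reg, f.wmem, hfe, hpw, hw]
    have y21 : τ₁.reg 21 = σ.reg 21 + 1 := by simp [hτ₁, f.reg, ho]
    have y16 : τ₁.reg 16 = σ.mem 22 p := by simp [hτ₁, m22, hp]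
    have y22 : τ₁.mem 22 = σ.mem 22 := by simp [hτ₁, m22]
    have hlt : ∀ c < N, σ.mem 22 c < 2 ^ m := fun c hc =>
      (h.lt c hc).trans_le (Nat.pow_le_pow_right (by norm_num) him)
    refine Run.block_seq_le (by simp; omega) ((elimProg_run (N := N) (b := 2 ^ i) (m := m)
      (y := σ.mem 22 p) ?_ ?_ ?_ ?_ y16 ?_ (by simpa [y22] using hlt) (hlt p hpN) ?_).mono
        (by simp; omega) ?_)
    · simp [hτ₁, f.reg, hz]
    · simp [hτ₁, f.reg, ho]
    · simp [hτ₁, f.reg, hN]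
    · simp [hτ₁, f.reg, hi, hP i him]
    · simp [hτ₁, f.reg, hm]
    · simpa [hτ₁, f.mem] using hP
    clear_value τ₁
    rintro τ₂ ⟨he, f2⟩
    rw [y22] at he
    have z21 : τ₂.reg 21 = σ.reg 21 + 1 := by simp [f2.reg, y21]
    have z14 : τ₂.mem 14 = τ₁.mem 14 := by simp [f2.mem]
    have z15 : τ₂.mem 15 = τ₁.mem 15 := by simp [f2.mem]
    have zw : τ₂.wmem 1 = τ₁.wmem 1 := by simp [f2.wmem]
    -- the span of the old elements is contained in the span of the new ones
    have hmono : ∀ w : ℚ, Submodule.span (ZMod 2)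
        {x | ∃ e < σ.reg 21, σ.wmem 1 (fe + e) ≤ w ∧ bitVec (σ.mem 15 (fe + e)) = x} ≤
        Submodule.span (ZMod 2)
        {x | ∃ e < τ₂.reg 21, τ₂.wmem 1 (fe + e) ≤ w ∧ bitVec (τ₂.mem 15 (fe + e)) = x} := by
      intro w
      refine Submodule.span_mono ?_
      rintro x ⟨e, he, hwe, rfl⟩
      refine ⟨e, by omega, ?_, ?_⟩
      · rw [zw, yw, Function.update_of_ne (by omega)]; exact hwe
      · rw [z15, y15, Function.update_of_ne (by omega)]
    -- The working vector of the pivot differs from its original vector by outputs no heavier than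
    -- the pivot. By minimality these, and the pivot, are no heavier than any candidate to which the
    -- working vector is added.
    have hpiv : ∀ w : ℚ, σ₀.wmem 2 p ≤ w → bitVec (σ.mem 22 p) ∈ Submodule.span (ZMod 2)
        {x | ∃ e < τ₂.reg 21, τ₂.wmem 1 (fe + e) ≤ w ∧ bitVec (τ₂.mem 15 (fe + e)) = x} := by
      intro w hpw
      have h1 : bitVec (σ₀.mem 21 p) ∈ Submodule.span (ZMod 2)
          {x | ∃ e < τ₂.reg 21, τ₂.wmem 1 (fe + e) ≤ w ∧ bitVec (τ₂.mem 15 (fe + e)) = x} := by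
        refine Submodule.subset_span ⟨σ.reg 21, by omega, ?_, ?_⟩
        · rw [zw, yw, Function.update_self]; exact hpw
        · rw [z15, y15, Function.update_self]
      have h2 := hmono w (Submodule.span_mono (fun x => ?_) (h.span p hpN))
      · simpa using sub_mem h1 h2
      · rintro ⟨e, he, hwe, hx⟩
        exact ⟨e, he, hwe.trans hpw, hx⟩
    refine ⟨?_, ?_, ?_, ?_, ?_, ?_⟩
    · have := h.le; omega
    · intro c hc
      rw [he c hc]
      split_ifs with hcb
      · exact hcb
      · exact xor_lt_of_le (by omega) (h.lt c hc) hpb (h.lt p hpN)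
    · intro e he
      rw [z21] at he
      rw [z14, z15, zw, y14, y15, yw]
      rcases Nat.lt_succ_iff_lt_or_eq.1 he with he | rfl
      · rw [Function.update_of_ne (by omega), Function.update_of_ne (by omega),
          Function.update_of_ne (by omega)]
        exact h.out e he
      · exact ⟨p, hpN, by simp⟩
    · intro c hc
      have h1 := hmono _ (h.span c hc)
      rw [he c hc]
      split_ifs with hcb
      · exact h1
      · rw [bitVec_xor, ← sub_sub]
        refine sub_mem h1 (hpiv _ ?_)
        have := hmin c hc (by omega)
        rwa [hpw, hw] at this
    · intro a ha ha' j hj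
      rw [← h.el a ha ha' j hj]
      interval_cases a
      · rw [z14, y14, Function.update_of_ne (by omega)]
      · rw [z15, y15, Function.update_of_ne (by omega)]
    · intro j hj
      rw [← h.wt j hj, zw, yw, Function.update_of_ne (by omega)]
  · simp [RamTest.Holds, f.reg, ho] at hb
    obtain ⟨-, hs⟩ := hs.resolve_right fun h => hb h.1
    simp at hs
    refine Run.block_le (by simp; omega) ?_
    have r21 : τ.reg 21 = σ.reg 21 := by simp [f.reg]
    have m14 : τ.mem 14 = σ.mem 14 := by simp [f.mem]
    have m15 : τ.mem 15 = σ.mem 15 := by simp [f.mem]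
    have w1 : τ.wmem 1 = σ.wmem 1 := by simp [f.wmem]
    rw [exec_nil]
    refine ⟨?_, by rwa [m22], ?_, ?_, ?_, ?_⟩
    · have := h.le; omega
    · rw [r21, m14, m15, w1]; exact h.out
    · rw [r21, m22, m15, w1]; exact h.span
    · intro a ha ha' j hj
      rw [← h.el a ha ha' j hj]
      interval_cases a <;> simp [m14, m15]
    · rw [w1]; exact h.wt

/-- Output candidates that generate all candidates. -/
def reduceProg : RamProg :=
  .seq (.block [.const 21 0, .copy 8 20]) (.down 8 pivotProg)

/-- In the end all working vectors are below `2 ^ 0`, hence zero, and the invariant says that every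
original vector is spanned by outputs no heavier than its candidate. -/
theorem reduceProg_run {σ : RamState} (hz : σ.reg 60 = 0) (ho : σ.reg 61 = 1)
    (hN : σ.reg 22 = N) (hm : σ.reg 20 = m) (hfe : σ.reg 42 = fe)
    (hP : ∀ i < m, σ.mem 4 i = 2 ^ i) (hlt : ∀ c < N, σ.mem 21 c < 2 ^ m)
    (heq : ∀ c < N, σ.mem 22 c = σ.mem 21 c) :
    Run reduceProg σ (m * (N * (m * 11 + 31) + 22) + 4) fun σ' =>
      (σ'.reg 21 ≤ m ∧
      (∀ e < σ'.reg 21, ∃ c < N, σ'.mem 14 (fe + e) = σ.mem 20 c ∧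
        σ'.mem 15 (fe + e) = σ.mem 21 c ∧ σ'.wmem 1 (fe + e) = σ.wmem 2 c) ∧
      (∀ c < N, bitVec (σ.mem 21 c) ∈ Submodule.span (ZMod 2)
        {x | ∃ e < σ'.reg 21, σ'.wmem 1 (fe + e) ≤ σ.wmem 2 c ∧
          bitVec (σ'.mem 15 (fe + e)) = x}) ∧
      (∀ a, 14 ≤ a → a < 16 → ∀ i < fe, σ'.mem a i = σ.mem a i) ∧
      ∀ i < fe, σ'.wmem 1 i = σ.wmem 1 i) ∧
      Frame [0, 1, 2, 3, 4, 8, 9, 10, 11, 12, 13, 14, 15, 16, 21] [14, 15, 22] [0, 1] [1] σ σ' := by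
  refine Run.frame _ _ _ _ rfl ?_
  refine Run.block_seq_le (by simp) (((Run.down (N := m) (b := N * (m * 11 + 31) + 20)
    [0, 1, 2, 3, 4, 9, 10, 11, 12, 13, 14, 15, 16, 21] [14, 15, 22] [0, 1] [1] rfl (by decide)
    (ReduceInv fe m N σ) ?_ ?_ ?_ ?_ ?_ ?_).post ?_).weaken ?_)
  · intro i σ x h
    exact ⟨by simpa using h.le, h.lt, by simpa using h.out, by simpa using h.span, h.el, h.wt⟩
  · simpa using hz
  · simpa using ho
  · simpa using hm
  · refine ⟨by simp, ?_, by simp, ?_, by simp, by simp⟩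
    · intro c hc
      simpa [heq c hc] using hlt c hc
    · intro c hc
      simp [heq c hc]
  · rintro i hi τ hτ f h
    refine pivotProg_run ?_ ?_ ?_ ?_ ?_ hτ hi ?_ ?_ ?_ ?_ h
    · simp [f.reg, hz]
    · simp [f.reg, ho]
    · simp [f.reg, hN]
    · simp [f.reg, hm]
    · simp [f.reg, hfe]
    · simpa [f.mem] using hP
    · simp [f.mem]
    · simp [f.mem]
    · simp [f.wmem]
  · rintro τ ⟨h, -⟩
    refine ⟨by simpa using h.le, h.out, fun c hc => ?_, h.el, h.wt⟩
    have h1 := h.span c hc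
    have h0 : τ.mem 22 c = 0 := by simpa using h.lt c hc
    rwa [h0, bitVec_zero, sub_zero] at h1
  · simp

end Reduce

/-! ### Joining two nodes -/

/-- The slot `d` of the stack describes a node with the set `A` of vertices. -/
structure NodeData {n : ℕ} (G : SimpleGraph (Fin n)) (w : Fin n → ℚ) (r : Fin n)
    (K A : Finset (Fin n)) (M fs fe d : ℕ) (κ : Finset (Fin n) → Finset (Fin n) → ℕ)
    (S₁ S₂ X : ℕ → Finset (Fin n)) (σ : RamState) : Prop where
  mask : σ.mem 9 d = code A
  classifier : IsClassifier G A (σ.mem 6 d) S₁ S₂ κ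
  table : StateTable G σ (σ.mem 5 d) (σ.mem 6 d) A S₁ S₂
  pow : ∀ i < σ.mem 6 d, σ.mem 4 i = 2 ^ i
  represents : Represents G w r K A κ (σ.mem 8 d) X
  elem : ∀ e < σ.mem 8 d, σ.mem 14 (σ.mem 7 d + e) = code (X e) ∧
    σ.mem 15 (σ.mem 7 d + e) < 2 ^ σ.mem 6 d ∧
    bitVec (σ.mem 15 (σ.mem 7 d + e)) = cutVec G r κ (X e) ∧
    σ.wmem 1 (σ.mem 7 d + e) = ∑ v ∈ X e, w v
  state_le : σ.mem 5 d + σ.mem 6 d ≤ fs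
  elem_le : σ.mem 7 d + σ.mem 8 d ≤ fe
  size_state : σ.mem 6 d ≤ M
  size_elem : σ.mem 8 d ≤ M
  distinct : DistinctClasses G A (σ.mem 6 d) S₁ S₂ ∧ σ.mem 8 d ≤ σ.mem 6 d ∨ A.card = 1

/-- The slot `d` of the stack describes some node with the set `A` of vertices. -/
def NodeOK {n : ℕ} (G : SimpleGraph (Fin n)) (w : Fin n → ℚ) (r : Fin n)
    (K A : Finset (Fin n)) (M fs fe d : ℕ) (σ : RamState) : Prop :=
  ∃ κ S₁ S₂ X, NodeData G w r K A M fs fe d κ S₁ S₂ X σ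

/-- The data of a node lie below the recorded bounds, so later allocations cannot damage them. This
keeps the left child intact while the right subtree is processed. -/
theorem NodeOK.grow {n : ℕ} {G : SimpleGraph (Fin n)} {w : Fin n → ℚ} {r : Fin n}
    {K A : Finset (Fin n)} {M fs fe d sp fs' fe' : ℕ} {σ σ' : RamState}
    (h : NodeOK G w r K A M fs fe d σ) (hg : Grow fs fe sp σ σ') (hd : d < sp) (hs : fs ≤ fs')
    (he : fe ≤ fe') : NodeOK G w r K A M fs' fe' d σ' := by
  obtain ⟨κ, S₁, S₂, X, h⟩ := h
  have e5 := hg.sl 5 (by omega) (by omega) d hd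
  have e6 := hg.sl 6 (by omega) (by omega) d hd
  have e7 := hg.sl 7 (by omega) (by omega) d hd
  have e8 := hg.sl 8 (by omega) (by omega) d hd
  have e9 := hg.sl 9 (by omega) (by omega) d hd
  refine ⟨κ, S₁, S₂, X, ?_, ?_, ?_, ?_, ?_, ?_, ?_, ?_, ?_, ?_, ?_⟩
  · rw [e9]; exact h.mask
  · rw [e6]; exact h.classifier
  · rw [e5, e6]; exact h.table.congr h.state_le hg.st
  · rw [e6]; exact fun i hi => hg.pw i (h.pow i hi)
  · rw [e8]; exact h.represents
  · rw [e6, e7, e8]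
    intro e he
    have hlt : σ.mem 7 d + e < fe := by have := h.elem_le; omega
    rw [hg.el 14 (by omega) (by omega) _ hlt, hg.el 15 (by omega) (by omega) _ hlt, hg.wt _ hlt]
    exact h.elem e he
  · rw [e5, e6]; exact h.state_le.trans hs
  · rw [e7, e8]; exact h.elem_le.trans he
  · rw [e6]; exact h.size_state
  · rw [e8]; exact h.size_elem
  · rw [e6, e8]; exact h.distinct

/-- Replace the two topmost nodes of the stack by their parent. -/
def joinProg : RamProg :=
  .seq (.block [.const 8 2, .sub 32 40 8, .sub 33 40 61, .load 23 5 32, .load 24 6 32,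
    .load 25 7 32, .load 26 8 32, .load 31 9 32, .load 27 5 33, .load 28 6 33, .load 29 7 33,
    .load 30 8 33, .load 9 9 33, .add 31 31 9]) <|
  .seq pairsProg <| .seq candsProg <| .seq reduceProg <|
  .block [.store 5 32 41, .store 6 32 20, .store 7 32 42, .store 8 32 21, .store 9 32 31,
    .add 41 41 20, .add 42 42 21, .sub 40 40 61]

/-- A bound for the running time of `joinProg`. -/
def joinCost (n M : ℕ) : ℕ :=
  (M * (M * (66 * n + 11 * M + 102) + 4) + 6) +
  (M * (M * 8 + M * (M * 8 + M * 13 + M * (M * 13 + 4) + 40 + 2) + 9) + 4) +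
  (M * (M * M * (M * 11 + 31) + 22) + 4) + 24

/-- New classes and elements are appended from `fs` and `fe` on, so the data of the children remain
readable throughout; of the stack only slot `d` is overwritten. The time is bounded through `M`,
which dominates the sizes at both children and at the parent. -/
theorem joinProg_run {n : ℕ} {G : SimpleGraph (Fin n)} {w : Fin n → ℚ} {r : Fin n}
    {K A B : Finset (Fin n)} {M fs fe d : ℕ} {σ : RamState}
    (hz : σ.reg 60 = 0) (ho : σ.reg 61 = 1) (hn : σ.reg 62 = n) (hsp : σ.reg 40 = d + 2)
    (hfs : σ.reg 41 = fs) (hfe : σ.reg 42 = fe) (hP : ∀ i < n, σ.mem 4 i = 2 ^ i)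
    (hAB : Disjoint A B) (hM : ∀ m U₁ U₂, DistinctClasses G (A ∪ B) m U₁ U₂ → m ≤ M)
    (hA : NodeOK G w r K A M fs fe d σ) (hB : NodeOK G w r K B M fs fe (d + 1) σ) :
    Run joinProg σ (joinCost n M) fun σ' =>
      (NodeOK G w r K (A ∪ B) M (σ'.reg 41) (σ'.reg 42) d σ' ∧ σ'.reg 40 = d + 1 ∧
        fs ≤ σ'.reg 41 ∧ fe ≤ σ'.reg 42 ∧ Grow fs fe d σ σ') ∧
      Frame [0, 1, 2, 3, 4, 5, 8, 9, 10, 11, 12, 13, 14, 15, 16, 17, 18, 20, 21, 22, 23, 24, 25,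
        26, 27, 28, 29, 30, 31, 32, 33, 34, 35, 40, 41, 42]
        [4, 5, 6, 7, 8, 9, 10, 11, 12, 13, 14, 15, 16, 17, 18, 19, 20, 21, 22] [0, 1] [1, 2]
        σ σ' := by
  obtain ⟨κa, S₁, S₂, X, hA⟩ := hA
  obtain ⟨κb, T₁, T₂, Y, hB⟩ := hB
  obtain ⟨s₀, hs₀⟩ : ∃ s₀, σ.mem 5 d = s₀ := ⟨_, rfl⟩
  obtain ⟨ma, hma⟩ : ∃ s₀, σ.mem 6 d = s₀ := ⟨_, rfl⟩
  obtain ⟨ea, hea⟩ : ∃ s₀, σ.mem 7 d = s₀ := ⟨_, rfl⟩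
  obtain ⟨La, hLa⟩ : ∃ s₀, σ.mem 8 d = s₀ := ⟨_, rfl⟩
  obtain ⟨s₁, hs₁⟩ : ∃ s₀, σ.mem 5 (d + 1) = s₀ := ⟨_, rfl⟩
  obtain ⟨mb, hmb⟩ : ∃ s₀, σ.mem 6 (d + 1) = s₀ := ⟨_, rfl⟩
  obtain ⟨eb, heb⟩ : ∃ s₀, σ.mem 7 (d + 1) = s₀ := ⟨_, rfl⟩
  obtain ⟨Lb, hLb⟩ : ∃ s₀, σ.mem 8 (d + 1) = s₀ := ⟨_, rfl⟩
  obtain ⟨a1, a2, a3, a4, a5, a6, a7, a8, a9, a10, -⟩ := hA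
  obtain ⟨b1, b2, b3, b4, b5, b6, b7, b8, b9, b10, -⟩ := hB
  rw [hs₀] at a3 a7
  rw [hma] at a2 a3 a4 a6 a7 a9
  rw [hea] at a6 a8
  rw [hLa] at a5 a6 a8 a10
  rw [hs₁] at b3 b7
  rw [hmb] at b2 b3 b4 b6 b7 b9
  rw [heb] at b6 b8
  rw [hLb] at b5 b6 b8 b10
  refine Run.frame _ _ _ _ rfl ?_
  have c1 : ma * (mb * (66 * n + 11 * M + 102) + 4) + 6 ≤
      M * (M * (66 * n + 11 * M + 102) + 4) + 6 := by gcongr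
  unfold joinCost
  refine Run.block_seq_le (by simp) (Run.seq_le _ (pairsProg_run (n := n) (G := G) (A := A)
    (B := B) (ma := ma) (mb := mb) (fs := fs) (S₁ := S₁) (S₂ := S₂) (T₁ := T₁) (T₂ := T₂) (M := M)
    (s₀ := s₀) (s₁ := s₁) hAB ?_ ?_ ?_ ?_ ?_ ?_ ?_ ?_ ?_ a7 b7 ?_ ?_
    (fun p hp => ⟨a2.subset₁ p hp, a2.subset₂ p hp⟩)
    (fun p hp => ⟨b2.subset₁ p hp, b2.subset₂ p hp⟩) ?_ hM) (by simp; omega) ?_)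
  · simp [hz]
  · simp [ho]
  · simp [hn]
  · simp [hfs]
  · simp [hsp, hs₀]
  · simp [hsp, hs₁, ho]
  · simp [hsp, ho, a1, b1, code_union hAB]
  · simp [hsp, hma]
  · simp [hsp, ho, hmb]
  · simpa [StateTable] using a3
  · simpa [StateTable] using b3
  · simpa using hP
  rintro τ ⟨⟨U₁, U₂, hI⟩, f1⟩
  have hJ := hI.isJoinTable
  have hmM := hM _ _ _ hI.distinct
  obtain ⟨m, hm⟩ : ∃ m, τ.reg 20 = m := ⟨_, rfl⟩
  rw [hm] at hJ hmM
  have r40 : τ.reg 40 = d + 2 := by simp [f1.reg, hsp]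
  have r41 : τ.reg 41 = fs := by simp [f1.reg, hfs]
  have r42 : τ.reg 42 = fe := by simp [f1.reg, hfe]
  have r60 : τ.reg 60 = 0 := by simp [f1.reg, hz]
  have r61 : τ.reg 61 = 1 := by simp [f1.reg, ho]
  have r62 : τ.reg 62 = n := by simp [f1.reg, hn]
  have r24 : τ.reg 24 = ma := by simp [f1.reg, hsp, hma]
  have r25 : τ.reg 25 = ea := by simp [f1.reg, hsp, hea]
  have r26 : τ.reg 26 = La := by simp [f1.reg, hsp, hLa]
  have r28 : τ.reg 28 = mb := by simp [f1.reg, hsp, ho, hmb]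
  have r29 : τ.reg 29 = eb := by simp [f1.reg, hsp, ho, heb]
  have r30 : τ.reg 30 = Lb := by simp [f1.reg, hsp, ho, hLb]
  have r31 : τ.reg 31 = code (A ∪ B) := by simp [f1.reg, hsp, ho, a1, b1, code_union hAB]
  have r32 : τ.reg 32 = d := by simp [f1.reg, hsp]
  have m14 : τ.mem 14 = σ.mem 14 := by simp [f1.mem]
  have m15 : τ.mem 15 = σ.mem 15 := by simp [f1.mem]
  have w1 : τ.wmem 1 = σ.wmem 1 := by simp [f1.wmem]
  have hsl : ∀ a, 5 ≤ a → a < 10 → τ.mem a = σ.mem a := by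
    intro a ha ha'
    interval_cases a <;> simp [f1.mem]
  have hst : ∀ a, 10 ≤ a → a < 14 → ∀ i < fs, τ.mem a i = σ.mem a i := by
    intro a ha ha' i hi
    simpa using hI.st a ha ha' i hi
  have hpw : ∀ i, σ.mem 4 i = 2 ^ i → τ.mem 4 i = 2 ^ i := by
    intro i hi
    exact hI.pw i (by simpa using hi)
  have hdist := hI.distinct
  have htab := hI.table
  have hpm := hI.pow_lt
  rw [hm] at hdist htab hpm
  clear hI f1
  have c2 : La * (ma * 8 + Lb * (mb * 8 + m * 13 + ma * (mb * 13 + 4) + 40 + 2) + 9) + 4 ≤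
      M * (M * 8 + M * (M * 8 + M * 13 + M * (M * 13 + 4) + 40 + 2) + 9) + 4 := by gcongr
  refine Run.seq_le _ (candsProg_run (m := m) r60 r61 hm r24 r28 r25 r29 r26 r30
    (fun i hi => hpw i (a4 i hi)) (fun i hi => hpw i (b4 i hi)) hpm
    (fun i hi => by rw [m15]; exact (a6 i hi).2.1) (fun i hi => by rw [m15]; exact (b6 i hi).2.1)
    hJ.le) (by simp; omega) ?_
  rintro τ₁ ⟨⟨g22, hc⟩, f2⟩
  have c3 : m * (La * Lb * (m * 11 + 31) + 22) + 4 ≤ M * (M * M * (M * 11 + 31) + 22) + 4 := by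
    gcongr
  have hex : ∀ c < La * Lb, ∃ i < La, ∃ j < Lb, c = i * Lb + j := by
    intro c hc
    have hpos : 0 < Lb := Nat.pos_of_ne_zero fun h => by simp [h] at hc
    exact ⟨c / Lb, Nat.div_lt_of_lt_mul (by rwa [mul_comm] at hc), c % Lb, Nat.mod_lt _ hpos,
      by rw [mul_comm]; exact (Nat.div_add_mod c Lb).symm⟩
  have hidx : ∀ i < La, ∀ j < Lb, i * Lb + j < La * Lb := by
    intro p hp q hq
    have : (p + 1) * Lb ≤ La * Lb := Nat.mul_le_mul_right _ hp
    rw [Nat.succ_mul] at this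
    omega
  refine Run.seq_le _ (reduceProg_run (m := m) (N := La * Lb) (fe := fe) ?_ ?_ g22 ?_ ?_ ?_ ?_ ?_)
    (by simp; omega) ?_
  · simp [f2.reg, r60]
  · simp [f2.reg, r61]
  · simp [f2.reg, hm]
  · simp [f2.reg, r42]
  · simpa [f2.mem] using hpm
  · intro c hcN
    obtain ⟨i, hi, j, hj, rfl⟩ := hex c hcN
    exact (hc i hi j hj).2.1
  · intro c hcN
    obtain ⟨i, hi, j, hj, rfl⟩ := hex c hcN
    exact (hc i hi j hj).2.2.1
  rintro τ₂ ⟨⟨hL, hout, hspan, hel, hwt⟩, f3⟩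
  obtain ⟨L, hLe⟩ : ∃ L, τ₂.reg 21 = L := ⟨_, rfl⟩
  rw [hLe] at hL hout hspan
  have q20 : τ₂.reg 20 = m := by simp [f3.reg, f2.reg, hm]
  have q31 : τ₂.reg 31 = code (A ∪ B) := by simp [f3.reg, f2.reg, r31]
  have q32 : τ₂.reg 32 = d := by simp [f3.reg, f2.reg, r32]
  have q40 : τ₂.reg 40 = d + 2 := by simp [f3.reg, f2.reg, r40]
  have q41 : τ₂.reg 41 = fs := by simp [f3.reg, f2.reg, r41]
  have q42 : τ₂.reg 42 = fe := by simp [f3.reg, f2.reg, r42]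
  have q61 : τ₂.reg 61 = 1 := by simp [f3.reg, f2.reg, r61]
  -- the sets of the output
  have hcand : ∀ i < La, ∀ j < Lb,
      bitVec (τ₁.mem 21 (i * Lb + j)) = cutVec G r (joinClass A B
        (fun p q => τ.mem 16 (p * mb + q)) κa κb) (X i ∪ Y j) ∧
      τ₁.mem 20 (i * Lb + j) = code (X i ∪ Y j) ∧
      τ₁.wmem 2 (i * Lb + j) = ∑ v ∈ X i ∪ Y j, w v := by
    intro i hi j hj
    obtain ⟨h1, -, -, h4, h5⟩ := hc i hi j hj
    obtain ⟨x1, -, x3, x4⟩ := a6 i hi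
    obtain ⟨y1, -, y3, y4⟩ := b6 j hj
    have hd := hAB.mono (a5.subset i hi) (b5.subset j hj)
    refine ⟨?_, ?_, ?_⟩
    · rw [h1, m15, x3, y3, hJ.cutVec_union a2 b2 hAB r (a5.subset i hi) (b5.subset j hj)]
    · rw [h4, m14, x1, y1, code_union hd]
    · rw [h5, w1, x4, y4, Finset.sum_union hd]
  -- The dummy value `∅` for `e ≥ L` makes the choice of sets total.
  have hZ : ∀ e, ∃ Z : Finset (Fin n), e < L → ∃ i < La, ∃ j < Lb, Z = X i ∪ Y j ∧
      τ₂.mem 14 (fe + e) = code Z ∧ bitVec (τ₂.mem 15 (fe + e)) = cutVec G r (joinClass A B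
        (fun p q => τ.mem 16 (p * mb + q)) κa κb) Z ∧ τ₂.mem 15 (fe + e) < 2 ^ m ∧
      τ₂.wmem 1 (fe + e) = ∑ v ∈ Z, w v := by
    intro e
    by_cases he : e < L
    · obtain ⟨c, hcN, h1, h2, h3⟩ := hout e he
      obtain ⟨i, hi, j, hj, rfl⟩ := hex c hcN
      obtain ⟨x1, x2, x3⟩ := hcand i hi j hj
      refine ⟨X i ∪ Y j, fun _ => ⟨i, hi, j, hj, rfl, ?_, ?_, ?_, ?_⟩⟩
      · rw [h1, x2]
      · rw [h2, x1]
      · rw [h2]; exact (hc i hi j hj).2.1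
      · rw [h3, x3]
    · exact ⟨∅, fun h => absurd h he⟩
  choose Z hZ using hZ
  refine Run.block_le (by simp; omega) ?_
  have p14 : ∀ i < fe, τ₂.mem 14 i = σ.mem 14 i := fun i hi => by
    rw [hel 14 (by omega) (by omega) i hi, ← m14]; simp [f2.mem]
  have p15 : ∀ i < fe, τ₂.mem 15 i = σ.mem 15 i := fun i hi => by
    rw [hel 15 (by omega) (by omega) i hi, ← m15]; simp [f2.mem]
  have pw1 : ∀ i < fe, τ₂.wmem 1 i = σ.wmem 1 i := fun i hi => by
    rw [hwt i hi, ← w1]; simp [f2.wmem]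
  have p4 : τ₂.mem 4 = τ.mem 4 := by simp [f3.mem, f2.mem]
  have pst : ∀ a, 10 ≤ a → a < 14 → τ₂.mem a = τ.mem a := by
    intro a ha ha'
    interval_cases a <;> simp [f3.mem, f2.mem]
  have psl : ∀ a, 5 ≤ a → a < 10 → τ₂.mem a = σ.mem a := by
    intro a ha ha'
    rw [← hsl a ha ha']
    interval_cases a <;> simp [f3.mem, f2.mem]
  refine ⟨⟨joinClass A B (fun p q => τ.mem 16 (p * mb + q)) κa κb, U₁, U₂, Z,
    ?_, ?_, ?_, ?_, ?_, ?_, ?_, ?_, ?_, ?_, ?_⟩, ?_, ?_, ?_, ?_, ?_, ?_, ?_, ?_⟩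
  · simp [q32, q31]
  · simpa [q32, q20] using hJ.isClassifier a2 b2 hAB
  · have : StateTable G τ₂ fs m (A ∪ B) U₁ U₂ :=
      htab.congr le_rfl fun a ha ha' i _ => by rw [pst a ha ha']
    simpa [q32, q20, q41, StateTable] using this
  · simpa [q32, q20, p4] using hpm
  · have : Represents G w r K (A ∪ B) (joinClass A B (fun p q => τ.mem 16 (p * mb + q)) κa κb)
        L Z := by
      refine Represents.join hJ a2 b2 hAB a5 b5 ?_ ?_
      · intro e he
        obtain ⟨i, hi, j, hj, h, -⟩ := hZ e he
        exact ⟨i, hi, j, hj, h⟩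
      · intro i hi j hj
        have h1 := hspan (i * Lb + j) (hidx i hi j hj)
        obtain ⟨x1, x2, x3⟩ := hcand i hi j hj
        rw [x1, x3, hJ.cutVec_union a2 b2 hAB r (a5.subset i hi) (b5.subset j hj)] at h1
        refine Submodule.span_mono ?_ h1
        rintro x ⟨e, he, hwe, rfl⟩
        obtain ⟨-, -, -, -, -, -, z1, -, z2⟩ := hZ e he
        exact ⟨e, he, by rwa [← z2], z1.symm⟩
    simpa [q32, hLe] using this
  · simp [q32, hLe, q20, q42]
    intro e he
    obtain ⟨-, -, -, -, -, z1, z2, z3, z4⟩ := hZ e he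
    exact ⟨z1, z3, z2, z4⟩
  · simp [q32, q20, q41]
  · simp [q32, q42, hLe]
  · simp [q32, q20, hmM]
  · simp [q32, hLe, hL.trans hmM]
  -- At an inner node the classes are pairwise distinct and the elements no more numerous; at the
  -- root this will leave at most one of each.
  · refine Or.inl ⟨?_, ?_⟩
    · simpa [q32, q20] using hdist
    · simpa [q32, q20, hLe] using hL
  · simp [q40, q61]
  · simp [q41]
  · simp [q42]
  · intro a ha ha' i hi
    rw [← hst a ha ha' i hi, ← pst a ha ha']
    interval_cases a <;> simp
  · intro a ha ha' i hi
    interval_cases a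
    · simpa using p14 i hi
    · simpa using p15 i hi
  · simpa using pw1
  · intro a ha ha' i hi
    have hne : i ≠ d := by omega
    rw [← psl a ha ha']
    interval_cases a <;> simp [q32, hne]
  · intro i hi
    simpa [p4] using hpw i hi

/-! ### Leaves -/

section LeafMath

variable {n : ℕ} (G : SimpleGraph (Fin n)) (w : Fin n → ℚ) (r v : Fin n)

/-- The classes of the pairs of subsets of `{v}`. -/
def leafClass (P Q : Finset (Fin n)) : ℕ := if v ∈ P then 1 else if v ∈ Q then 2 else 0

/-- The first sets of the three pairs of subsets of `{v}`. -/
def leafFst (p : ℕ) : Finset (Fin n) := if p = 1 then {v} else ∅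

/-- The second sets of the three pairs of subsets of `{v}`. -/
def leafSnd (p : ℕ) : Finset (Fin n) := if p = 2 then {v} else ∅

/-- The three classes are the disjoint pairs `(∅, ∅)`, `({v}, ∅)` and `(∅, {v})`. They are kept
apart even if `v` is isolated, which is why leaves need the separate bound `3 ≤ M`. -/
theorem isClassifier_leaf : IsClassifier G {v} 3 (leafFst v) (leafSnd v) (leafClass v) := by
  have key : ∀ P ⊆ ({v} : Finset (Fin n)), ∀ Q ⊆ ({v} : Finset (Fin n)), Disjoint P Q →
      leafClass v P Q < 3 ∧ leafFst v (leafClass v P Q) = P ∧ leafSnd v (leafClass v P Q) = Q := by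
    intro P hP Q hQ hd
    rcases Finset.subset_singleton_iff.1 hP with rfl | rfl <;>
      rcases Finset.subset_singleton_iff.1 hQ with rfl | rfl <;>
      simp_all [leafClass, leafFst, leafSnd]
  refine ⟨fun p _ => ?_, fun p _ => ?_, fun P hP Q hQ hd _ => (key P hP Q hQ hd).1,
    fun P hP Q hQ hd _ => ?_, fun P hP Q hQ hd _ => ?_⟩
  · unfold leafFst; split_ifs <;> simp
  · unfold leafSnd; split_ifs <;> simp
  · rw [(key P hP Q hQ hd).2.1]
  · rw [(key P hP Q hQ hd).2.2]

theorem cutVec_leaf_empty : cutVec G r (leafClass v) ∅ = bitVec 1 := by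
  have : cuts G r ∅ = {∅} := by
    ext P
    rw [mem_cuts]
    simp [NoEdge]
  ext i
  rw [cutVec, this]
  simp only [Finset.sum_singleton, leafClass, Pi.single_apply, bitVec]
  rcases i with _ | i
  · simp
  · simp [Nat.testBit_succ]

/-- The cut with `v` on the first side has class `1`; the cut with `v` on the second side has class
`2` and is forbidden when `v = r`. Hence `2 ^ 1` or `2 ^ 1 + 2 ^ 2`. -/
theorem cutVec_leaf_singleton :
    cutVec G r (leafClass v) {v} = bitVec (if v = r then 2 else 6) := by
  have hb : ∀ i, bitVec 2 i = if i = 1 then 1 else 0 := by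
    rintro (_ | _ | i) <;> simp [bitVec, Nat.testBit_succ]
  have hb' : ∀ i, bitVec 6 i = (if i = 1 then 1 else 0) + if i = 2 then 1 else 0 := by
    rintro (_ | _ | _ | i) <;> simp [bitVec, Nat.testBit_succ]
  by_cases hvr : v = r
  · have : cuts G r {v} = {{v}} := by
      ext P
      rw [mem_cuts]
      constructor
      · rintro ⟨h1, h2, h3⟩
        rcases Finset.subset_singleton_iff.1 h1 with rfl | rfl
        · simp [hvr] at h3
        · simp
      · intro h
        rw [Finset.mem_singleton] at h
        subst h
        simp [NoEdge]
    ext i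
    rw [cutVec, this, if_pos hvr, hb]
    simp only [Finset.sum_singleton, leafClass, Pi.single_apply, Finset.mem_singleton, if_true]
  · have : cuts G r {v} = {{v}, ∅} := by
      ext P
      rw [mem_cuts]
      constructor
      · rintro ⟨h1, h2, h3⟩
        rcases Finset.subset_singleton_iff.1 h1 with rfl | rfl <;> simp
      · intro h
        simp only [Finset.mem_insert, Finset.mem_singleton] at h
        rcases h with rfl | rfl
        · simp [NoEdge]
        · simp [NoEdge, Ne.symm hvr]
    ext i
    rw [cutVec, this, if_neg hvr, hb', Finset.sum_pair (by simp)]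
    simp [leafClass, Pi.single_apply]

/-- The sets that represent the subsets of `{v}`. -/
def leafSets (K : Finset (Fin n)) (e : ℕ) : Finset (Fin n) := if v ∈ K ∨ e = 1 then {v} else ∅

/-- Every admissible subset of `{v}` is listed itself: only `{v}` if `v` is required, and both
subsets otherwise. -/
theorem represents_leaf (K : Finset (Fin n)) :
    Represents G w r K {v} (leafClass v) (if v ∈ K then 1 else 2) (leafSets v K) := by
  refine ⟨fun e _ => ?_, fun e _ => ?_, fun Y hY hK => Submodule.subset_span ?_⟩
  · unfold leafSets; split_ifs <;> simp
  · unfold leafSets; split_ifs with h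
    · exact Finset.inter_subset_right
    · push Not at h
      rw [Finset.inter_singleton_of_notMem h.1]
  · by_cases hv : v ∈ K
    · have : Y = {v} := hY.antisymm (by simpa [hv] using hK)
      exact ⟨0, by simp [hv], by simp [leafSets, hv, this], by simp [leafSets, hv, this]⟩
    · rcases Finset.subset_singleton_iff.1 hY with rfl | rfl
      · exact ⟨0, by simp [hv], by simp [leafSets, hv], by simp [leafSets, hv]⟩
      · exact ⟨1, by simp [hv], by simp [leafSets], by simp [leafSets]⟩

end LeafMath

/-- Register `17` := the set of the neighbors of the vertex in register `18`. -/
def nbrsProg : RamProg :=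
  .seq (.block [.const 8 0]) <| .seq (.up 9 18 (.block [.add 8 8 62])) <|
  .seq (.block [.const 17 0]) (.up 10 62 (.seq (.block [.add 11 8 10, .load 12 0 11])
    (.ite (.eq 12 61) (.block [.load 13 4 10, .add 17 17 13]) (.block []))))

theorem code_filter_lt_succ {n : ℕ} {i : ℕ} (hi : i < n) (p : Fin n → Prop) [DecidablePred p] :
    code (Finset.univ.filter fun u : Fin n => (u : ℕ) < i + 1 ∧ p u) =
      code (Finset.univ.filter fun u : Fin n => (u : ℕ) < i ∧ p u) +
        if p ⟨i, hi⟩ then 2 ^ i else 0 := by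
  have : (Finset.univ.filter fun u : Fin n => (u : ℕ) < i + 1 ∧ p u) =
      (Finset.univ.filter fun u : Fin n => (u : ℕ) < i ∧ p u) ∪
        if p ⟨i, hi⟩ then {⟨i, hi⟩} else ∅ := by
    ext u
    have hu : u = ⟨i, hi⟩ ↔ (u : ℕ) = i := by rw [Fin.ext_iff]
    split_ifs with h
    · simp only [Finset.mem_union, Finset.mem_filter, Finset.mem_univ, true_and,
        Finset.mem_singleton, hu]
      constructor
      · rintro ⟨h1, h2⟩
        by_cases h3 : (u : ℕ) = i
        · exact Or.inr h3
        · exact Or.inl ⟨by omega, h2⟩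
      · rintro (⟨h1, h2⟩ | h1)
        · exact ⟨by omega, h2⟩
        · exact ⟨by omega, by rwa [hu.2 h1]⟩
    · simp only [Finset.mem_filter, Finset.mem_univ, true_and, Finset.union_empty]
      constructor
      · rintro ⟨h1, h2⟩
        refine ⟨?_, h2⟩
        by_contra h3
        exact h (by rwa [hu.2 (by omega)] at h2)
      · rintro ⟨h1, h2⟩
        exact ⟨by omega, h2⟩
  rw [this, code_union]
  · split_ifs <;> simp
  · split_ifs <;> simp

/-- The machine does not multiply, so the row offset `v * n` is found by repeated addition. -/
theorem nbrsProg_run {n : ℕ} {G : SimpleGraph (Fin n)} {v : Fin n} {σ : RamState}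
    (ho : σ.reg 61 = 1) (hn : σ.reg 62 = n) (hv : σ.reg 18 = v) (hP : ∀ i < n, σ.mem 4 i = 2 ^ i)
    (hG : ∀ u : Fin n, σ.mem 0 (v * n + u) = 1 ↔ G.Adj v u) :
    Run nbrsProg σ (n * 15 + 8) fun σ' => σ'.reg 17 = code (outNbrs G {v} {v}) ∧
      Frame [0, 8, 9, 10, 11, 12, 13, 17] [] [] [] σ σ' := by
  classical
  refine Run.frame _ _ _ _ rfl ?_
  have hvn : (v : ℕ) * 4 ≤ n * 4 := by have := v.2; omega
  refine Run.block_seq_le (by simp) (Run.seq_le _ (Run.up (N := v) (b := 2) [0, 8] [] [] []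
    rfl (by decide) (fun i τ => τ.reg 8 = i * n) ?_ ?_ ?_ ?_ ?_) (by simp; omega) ?_)
  · intro i σ x h; simpa using h
  · simpa using ho
  · simpa using hv
  · simp
  · rintro i hi τ hτ hf h
    refine Run.block_le (by simp) ?_
    simp [h, hf.reg, hn, Nat.succ_mul]
  rintro τ ⟨h8, f1⟩
  have f1' : τ.reg 61 = 1 := by simp [f1.reg, ho]
  have f1'' : τ.reg 62 = n := by simp [f1.reg, hn]
  have hm : τ.mem = σ.mem := by ext a i; simp [f1.mem]
  refine Run.block_seq_le (by simp; omega) (((Run.up (N := n) (b := 9) [0, 11, 12, 13, 17] [] [] []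
    rfl (by decide)
    (fun i τ => τ.reg 17 = code (Finset.univ.filter fun u : Fin n => (u : ℕ) < i ∧ G.Adj v u))
    ?_ ?_ ?_ ?_ ?_).post ?_).weaken (by simp; omega))
  · intro i σ x h; simpa using h
  · simpa using f1'
  · simpa using f1''
  · simp
  · rintro i hi τ₁ hτ₁ f2 h
    have h61 : τ₁.reg 61 = 1 := by simp [f2.reg, f1']
    have h8' : τ₁.reg 8 = v * n := by simp [f2.reg, h8]
    have hm' : τ₁.mem = σ.mem := by ext a i; simp [f2.mem, hm]
    refine Run.block_seq_le (by simp) (Run.ite_le (by simp) (fun hb => ?_) (fun hb => ?_))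
    · simp [RamTest.Holds, h61, h8', hm', hτ₁] at hb
      refine Run.block_le (by simp) ?_
      rw [code_filter_lt_succ hi, if_pos ((hG ⟨i, hi⟩).1 hb), ← h]
      simp [hτ₁, hm', hP i hi]
    · simp [RamTest.Holds, h61, h8', hm', hτ₁] at hb
      refine Run.block_le (by simp) ?_
      rw [code_filter_lt_succ hi, if_neg (fun h => hb ((hG ⟨i, hi⟩).2 h)), ← h]
      simp
  · rintro τ₁ ⟨h, -⟩
    rw [h]
    congr 1
    ext u
    simp only [Finset.mem_filter, Finset.mem_univ, true_and, u.2, mem_outNbrs,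
      Finset.mem_singleton, exists_eq_left]
    exact ⟨fun h => ⟨fun hu => h.ne hu.symm, h⟩, fun h => h.2⟩

/-- Push a node for the leaf in register `45`, a vertex number plus one. -/
def leafProg : RamProg :=
  .seq (.block [.sub 18 45 61]) <| .seq nbrsProg <|
  .seq (.block [.load 14 4 18,
    .store 10 41 60, .store 11 41 60, .store 12 41 60, .store 13 41 60,
    .add 9 41 61, .store 10 9 14, .store 11 9 60, .store 12 9 17, .store 13 9 60,
    .add 9 9 61, .store 10 9 60, .store 11 9 14, .store 12 9 60, .store 13 9 17,
    .load 15 1 18, .const 21 0]) <|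
  .seq (.ite (.eq 18 63) (.block [.const 15 1, .const 16 2]) (.block [.const 16 6])) <|
  .seq (.ite (.eq 15 61) (.block [])
    (.block [.store 14 42 60, .store 15 42 61, .wzero 0, .wstore 1 42 0, .const 21 1])) <|
  .block [.add 9 42 21, .store 14 9 14, .store 15 9 16, .wload 0 0 18, .wstore 1 9 0,
    .add 21 21 61, .store 5 40 41, .const 8 3, .store 6 40 8, .store 7 40 42, .store 8 40 21,
    .store 9 40 14, .add 41 41 8, .add 42 42 21, .add 40 40 61]

/-- The stored terminals stay as they are; that `r` is required too is decided by comparing `v` with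
register `63`. `hP3` provides the powers for three classes even if `n < 3`. -/
theorem leafProg_run {n : ℕ} {G : SimpleGraph (Fin n)} {w : Fin n → ℚ} {r v : Fin n}
    {K : Finset (Fin n)} {M fs fe d : ℕ} {σ : RamState}
    (hz : σ.reg 60 = 0) (ho : σ.reg 61 = 1) (hn : σ.reg 62 = n) (hr : σ.reg 63 = r)
    (hv : σ.reg 45 = v + 1) (hsp : σ.reg 40 = d)
    (hfs : σ.reg 41 = fs) (hfe : σ.reg 42 = fe) (hP : ∀ i < n, σ.mem 4 i = 2 ^ i)
    (hP3 : ∀ i < 3, σ.mem 4 i = 2 ^ i)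
    (hG : ∀ u : Fin n, σ.mem 0 (v * n + u) = 1 ↔ G.Adj v u) (hK : σ.mem 1 v = 1 ↔ v ∈ K)
    (hw : σ.wmem 0 v = w v) (hM : 3 ≤ M) :
    Run leafProg σ (n * 15 + 70) fun σ' =>
      (NodeOK G w r (insert r K) {v} M (σ'.reg 41) (σ'.reg 42) d σ' ∧ σ'.reg 40 = d + 1 ∧
        fs ≤ σ'.reg 41 ∧ fe ≤ σ'.reg 42 ∧ Grow fs fe d σ σ') ∧
      Frame [0, 8, 9, 10, 11, 12, 13, 14, 15, 16, 17, 18, 21, 40, 41, 42]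
        [5, 6, 7, 8, 9, 10, 11, 12, 13, 14, 15] [0] [1] σ σ' := by
  refine Run.frame _ _ _ _ rfl ?_
  refine Run.block_seq_le (by simp) (Run.seq_le _ (nbrsProg_run (n := n) (G := G) (v := v)
    ?_ ?_ ?_ ?_ ?_) (by simp) ?_)
  · simp [ho]
  · simp [hn]
  · simp [hv, ho]
  · simpa using hP
  · simpa using hG
  rintro τ ⟨h17, f⟩
  refine Run.block_seq_le (by simp) ?_
  set τ₁ := exec _ τ with hτ₁
  have hne : fs + 1 + 1 ≠ fs + 1 := by omega
  have hne' : fs + 1 + 1 ≠ fs := by omega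
  have r18 : τ₁.reg 18 = v := by simp [hτ₁, f.reg, hv, ho]
  have r14 : τ₁.reg 14 = 2 ^ (v : ℕ) := by simp [hτ₁, f.reg, f.mem, hv, ho, hP v v.2]
  have r15 : τ₁.reg 15 = σ.mem 1 v := by simp [hτ₁, f.reg, f.mem, hv, ho]
  have r21 : τ₁.reg 21 = 0 := by simp [hτ₁]
  have r40 : τ₁.reg 40 = d := by simp [hτ₁, f.reg, hsp]
  have r41 : τ₁.reg 41 = fs := by simp [hτ₁, f.reg, hfs]
  have r42 : τ₁.reg 42 = fe := by simp [hτ₁, f.reg, hfe]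
  have r60 : τ₁.reg 60 = 0 := by simp [hτ₁, f.reg, hz]
  have r61 : τ₁.reg 61 = 1 := by simp [hτ₁, f.reg, ho]
  have r63 : τ₁.reg 63 = r := by simp [hτ₁, f.reg, hr]
  have hO : outNbrs G {v} (∅ : Finset (Fin n)) = ∅ := by simp [outNbrs]
  have tab : StateTable G τ₁ fs 3 {v} (leafFst v) (leafSnd v) := by
    intro p hp
    interval_cases p <;>
      simp [hτ₁, f.reg, f.mem, hfs, hv, ho, hz, hP v v.2, leafFst, leafSnd, h17, hO, add_assoc]
  have hst : ∀ a, 10 ≤ a → a < 14 → ∀ i < fs, τ₁.mem a i = σ.mem a i := by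
    intro a ha ha' i hi
    have h1 : i ≠ fs := by omega
    have h2 : i ≠ fs + 1 := by omega
    have h3 : i ≠ fs + 1 + 1 := by omega
    interval_cases a <;> simp [hτ₁, f.reg, f.mem, hfs, ho, h1, h2, h3]
  have hmem : ∀ a, (a < 10 ∨ 14 ≤ a) → τ₁.mem a = σ.mem a := by
    intro a ha
    have h1 : a ≠ 10 := by omega
    have h2 : a ≠ 11 := by omega
    have h3 : a ≠ 12 := by omega
    have h4 : a ≠ 13 := by omega
    simp [hτ₁, f.mem, h1, h2, h3, h4]
  have hwm : τ₁.wmem = σ.wmem := by ext a i; simp [hτ₁, f.wmem]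
  clear_value τ₁
  clear f h17
  -- the vector of the set `{v}`
  refine Run.seq_le (T₁ := 4) (Q := fun τ₂ => ∃ k, (k = 1 ↔ v ∈ insert r K) ∧
    τ₂ = (τ₁.setReg 15 k).setReg 16 (if v = r then 2 else 6)) ?_ (by simp) ?_
  · refine Run.ite_le (by simp) (fun hb => ?_) (fun hb => ?_)
    · simp [RamTest.Holds, r18, r63] at hb
      have hb' : v = r := Fin.ext hb
      refine Run.block_le (by simp) ⟨1, by simp [hb'], by simp [hb']⟩
    · simp [RamTest.Holds, r18, r63] at hb
      have hb' : v ≠ r := fun h => hb (congrArg Fin.val h)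
      refine Run.block_le (by simp) ⟨σ.mem 1 v, by simp [hb', hK], ?_⟩
      have : τ₁.setReg 15 (σ.mem 1 v) = τ₁ := by
        rw [← r15]; simp [RamState.setReg]
      simp [this, hb']
  rintro τ₂ ⟨k, hk, rfl⟩
  set τ₂ := (τ₁.setReg 15 k).setReg 16 (if v = r then 2 else 6) with hτ₂
  -- `L` counts the elements stored before `{v}`: the empty set if it is admissible. The set `{v}`
  -- then goes to position `fe + L`.
  refine Run.seq_le (T₁ := 7) (Q := fun τ₃ => ∃ L, L = (if v ∈ insert r K then 0 else 1) ∧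
    (∀ i ≠ 21, τ₃.reg i = τ₂.reg i) ∧ τ₃.reg 21 = L ∧ (∀ a, a ≠ 14 → a ≠ 15 → τ₃.mem a = τ₁.mem a) ∧
    (∀ a ≠ 1, τ₃.wmem a = σ.wmem a) ∧ (∀ i < fe, τ₃.mem 14 i = σ.mem 14 i) ∧
    (∀ i < fe, τ₃.mem 15 i = σ.mem 15 i) ∧ (∀ i < fe, τ₃.wmem 1 i = σ.wmem 1 i) ∧
    (0 < L → τ₃.mem 14 fe = 0 ∧ τ₃.mem 15 fe = 1 ∧ τ₃.wmem 1 fe = 0)) ?_ (by simp) ?_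
  · refine Run.ite_le (by simp) (fun hb => ?_) (fun hb => ?_)
    · simp [RamTest.Holds, hτ₂, r61] at hb
      rw [hk] at hb
      refine Run.block_le (by simp) ⟨0, by simp [hb], ?_⟩
      simp only [exec_nil]
      refine ⟨by simp, by simp [hτ₂, r21], fun a _ _ => by simp [hτ₂], fun a _ => by simp [hτ₂,
          hwm],
        fun i _ => by simp [hτ₂, hmem], fun i _ => by simp [hτ₂, hmem],
        fun i _ => by simp [hτ₂, hwm], by simp⟩
    · simp [RamTest.Holds, hτ₂, r61] at hb
      rw [hk] at hb
      refine Run.block_le (by simp) ⟨1, by rw [if_neg hb], ?_⟩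
      refine ⟨fun i hi => by simp [hi], by simp, fun a h h' => by simp [hτ₂, h, h'],
          fun a ha => by simp [hτ₂, hwm, ha],
        fun i hi => ?_, fun i hi => ?_, fun i hi => ?_, fun _ => ?_⟩
      · have : i ≠ fe := by omega
        simp [hτ₂, r42, this, hmem]
      · have : i ≠ fe := by omega
        simp [hτ₂, r42, this, hmem]
      · have : i ≠ fe := by omega
        simp [hτ₂, r42, this, hwm]
      · simp [hτ₂, r42, r60, r61]
  rintro τ₃ ⟨L, hL, g, g21, gm, gw, g14, g15, gw1, gL⟩
  have q9 : ∀ i, i ≠ 21 → i ≠ 15 → i ≠ 16 → τ₃.reg i = τ₁.reg i := fun i h1 h2 h3 => by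
    rw [g i h1]; simp [hτ₂, h2, h3]
  have q14 := (q9 14 (by norm_num) (by norm_num) (by norm_num)).trans r14
  have q18 := (q9 18 (by norm_num) (by norm_num) (by norm_num)).trans r18
  have q40 := (q9 40 (by norm_num) (by norm_num) (by norm_num)).trans r40
  have q41 := (q9 41 (by norm_num) (by norm_num) (by norm_num)).trans r41
  have q42 := (q9 42 (by norm_num) (by norm_num) (by norm_num)).trans r42
  have q60 := (q9 60 (by norm_num) (by norm_num) (by norm_num)).trans r60
  have q61 := (q9 61 (by norm_num) (by norm_num) (by norm_num)).trans r61
  have q16 : τ₃.reg 16 = if v = r then 2 else 6 := by rw [g 16 (by norm_num)]; simp [hτ₂]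
  have s10 : ∀ a, 10 ≤ a → a < 14 → ∀ i < fs, τ₃.mem a i = σ.mem a i := by
    intro a ha ha' i hi
    rw [gm a (by omega) (by omega), hst a ha ha' i hi]
  have smem : ∀ a < 10, τ₃.mem a = σ.mem a := fun a ha => by
    rw [gm a (by omega) (by omega), hmem a (by omega)]
  have stab : StateTable G τ₃ fs 3 {v} (leafFst v) (leafSnd v) :=
    tab.congr le_rfl fun a ha ha' i _ => by rw [gm a (by omega) (by omega)]
  clear gm hst hmem hwm tab
  clear_value τ₂
  refine Run.block_le (by simp) ?_
  refine ⟨⟨leafClass v, leafFst v, leafSnd v, leafSets v (insert r K),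
    ?_, ?_, ?_, ?_, ?_, ?_, ?_, ?_, ?_, ?_, ?_⟩, ?_, ?_, ?_, ?_, ?_, ?_, ?_, ?_⟩
  · simp [q40, q14]
  · simpa [q40] using isClassifier_leaf G v
  · simpa [q40, q41, StateTable] using stab
  · simpa [q40, smem] using hP3
  · have : L + 1 = if v ∈ insert r K then 1 else 2 := by rw [hL]; split_ifs <;> rfl
    simpa [q40, g21, q61, this] using represents_leaf G w r v (insert r K)
  · have hb : (if v = r then 2 else 6) < 8 := by split_ifs <;> norm_num
    have hv' : ∀ e, e = L → leafSets v (insert r K) e = {v} := by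
      rintro e rfl
      rw [leafSets, if_pos]
      rw [hL]
      split_ifs with h
      · exact Or.inl h
      · exact Or.inr rfl
    simp [q40, g21, q61, q42]
    intro e he
    by_cases h : e = L
    · rw [hv' e h, cutVec_leaf_singleton]
      simp [h, q14, q16, hb, q18, gw, hw]
    · have hL0 : 0 < L := by omega
      have he0 : e = 0 := by rw [hL] at he h; split_ifs at he h <;> omega
      have hK0 : v ∉ insert r K := by
        intro hv0; rw [hL, if_pos hv0] at hL0; omega
      obtain ⟨z1, z2, z3⟩ := gL hL0
      have : leafSets v (insert r K) e = ∅ := by rw [leafSets, if_neg]; simp_all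
      rw [this, cutVec_leaf_empty]
      have hne : fe ≠ fe + L := by omega
      simp [he0, Function.update_of_ne hne, z1, z2, z3]
  · simp [q40, q41]
  · simp [q40, q42, g21, q61]
  · simpa [q40] using hM
  · have : L + 1 ≤ M := by rw [hL]; split_ifs <;> omega
    simpa [q40, g21, q61] using this
  · simp
  · simp [q40, q61]
  · simp [q41]
  · simp [q42]
  · intro a ha ha' i hi
    rw [← s10 a ha ha' i hi]
    interval_cases a <;> simp
  · intro a ha ha' i hi
    have hne : i ≠ fe + L := by omega
    interval_cases a
    · simpa [q42, g21, hne] using g14 i hi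
    · simpa [q42, g21, hne] using g15 i hi
  · intro i hi
    have hne : i ≠ fe + L := by omega
    simpa [q42, g21, hne] using gw1 i hi
  · intro a ha ha' i hi
    have hne : i ≠ d := by omega
    rw [← smem a ha']
    interval_cases a <;> simp [q40, hne]
  · intro i hi
    simpa [smem] using hi

/-! ### Running through a layout -/

theorem Frame.mono {R A W B R' A' W' B' : List ℕ} {σ σ' : RamState} (h : Frame R A W B σ σ')
    (hR : R ⊆ R') (hA : A ⊆ A') (hW : W ⊆ W') (hB : B ⊆ B') : Frame R' A' W' B' σ σ' :=
  ⟨fun r hr => h.reg r fun h => hr (hR h), fun r hr => h.mem r fun h => hr (hA h),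
    fun r hr => h.wreg r fun h => hr (hW h), fun r hr => h.wmem r fun h => hr (hB h)⟩

theorem Grow.mono {fs fe sp sp' : ℕ} {σ σ' : RamState} (h : Grow fs fe sp σ σ') (hsp : sp' ≤ sp) :
    Grow fs fe sp' σ σ' :=
  ⟨h.st, h.el, h.wt, fun a ha ha' i hi => h.sl a ha ha' i (by omega), h.pw⟩

/-- The state holds the instance, the constants and the powers of two. -/
structure Ready {n : ℕ} (G : SimpleGraph (Fin n)) (K : Finset (Fin n)) (w : Fin n → ℚ)
    (l : List ℕ) (σ : RamState) : Prop where
  zero : σ.reg 60 = 0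
  one : σ.reg 61 = 1
  size : σ.reg 62 = n
  len : σ.reg 68 = l.length
  adj : ∀ v u : Fin n, σ.mem 0 (v * n + u) = 1 ↔ G.Adj v u
  term : ∀ v : Fin n, σ.mem 1 v = 1 ↔ v ∈ K
  token : ∀ i, σ.mem 2 i = l.getD i 0
  weight : ∀ v : Fin n, σ.wmem 0 v = w v
  pow : ∀ i < n + 3, σ.mem 4 i = 2 ^ i

/-- The registers that change during a run through a layout. -/
abbrev layoutRegs : List ℕ :=
  [0, 1, 2, 3, 4, 5, 8, 9, 10, 11, 12, 13, 14, 15, 16, 17, 18, 20, 21, 22, 23, 24, 25,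
    26, 27, 28, 29, 30, 31, 32, 33, 34, 35, 40, 41, 42, 44, 45]

/-- The arrays that change during a run through a layout. -/
abbrev layoutArrays : List ℕ :=
  [4, 5, 6, 7, 8, 9, 10, 11, 12, 13, 14, 15, 16, 17, 18, 19, 20, 21, 22]

/-- The registers that change during a round. -/
abbrev roundRegs : List ℕ := 69 :: 70 :: layoutRegs

theorem Ready.frame {n : ℕ} {G : SimpleGraph (Fin n)} {K : Finset (Fin n)} {w : Fin n → ℚ}
    {l : List ℕ} {σ σ' : RamState} (h : Ready G K w l σ)
    (f : Frame roundRegs layoutArrays [0, 1, 20] [1, 2] σ σ')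
    (hp : ∀ i, σ.mem 4 i = 2 ^ i → σ'.mem 4 i = 2 ^ i) : Ready G K w l σ' where
  zero := by simp [f.reg, h.zero]
  one := by simp [f.reg, h.one]
  size := by simp [f.reg, h.size]
  len := by simp [f.reg, h.len]
  adj := by simpa [f.mem] using h.adj
  term := by simpa [f.mem] using h.term
  token := by simpa [f.mem] using h.token
  weight := by simpa [f.wmem] using h.weight
  pow i hi := hp i (h.pow i hi)

/-- Process the next node of the layout. -/
def tokenProg : RamProg :=
  .seq (.block [.load 45 2 44, .add 44 44 61]) (.ite (.eq 45 60) joinProg leafProg)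

/-- Process all nodes of the layout. -/
def layoutProg : RamProg := .loop (.lt 44 68) tokenProg

/-- A bound for the running time of `tokenProg`. -/
def tokenCost (n M : ℕ) : ℕ := joinCost n M + n * 15 + 74

theorem LayoutTree.coe_toFinset_leaves {n : ℕ} (T : LayoutTree (Fin n)) :
    (T.leaves.toFinset : Set (Fin n)) = T.leafSet := by
  ext v; simp [LayoutTree.leafSet]

theorem LayoutTree.le_width {n : ℕ} (f : Set (Fin n) → ℕ) (T : LayoutTree (Fin n)) :
    f T.leafSet ≤ T.width f := by
  cases T
  · exact le_rfl
  · exact le_max_left _ _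

/-- One loop reads the entire listing, so a subtree is not a subprogram. The statement is therefore
in continuation form: once the tokens of `T` are read, the same loop goes on with one more node on
the stack, and `t` bounds the remaining time. In this form induction on the tree works: left
subtree, right subtree, then the token `0`. -/
theorem layoutProg_run {n : ℕ} {G : SimpleGraph (Fin n)} {w : Fin n → ℚ} {r : Fin n}
    {K : Finset (Fin n)} {M s : ℕ} {f : Set (Fin n) → ℕ} {l : List ℕ} (hM3 : 3 ≤ M)
    (hf : ∀ A : Finset (Fin n), f A ≤ s → ∀ m U₁ U₂, DistinctClasses G A m U₁ U₂ → m ≤ M)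
    (T : LayoutTree (Fin n)) :
    ∀ (σ : RamState) (k d t : ℕ) (Q : RamState → Prop), Ready G K w l σ → σ.reg 63 = r →
      T.postorder <+: l.drop k → T.leaves.Nodup → T.width f ≤ s →
      σ.reg 44 = k → σ.reg 40 = d →
      (∀ σ', Ready G K w l σ' → Frame layoutRegs layoutArrays [0, 1] [1, 2] σ σ' →
        NodeOK G w r (insert r K) T.leaves.toFinset M (σ'.reg 41) (σ'.reg 42) d σ' →
        σ'.reg 44 = k + T.postorder.length → σ'.reg 40 = d + 1 → σ.reg 41 ≤ σ'.reg 41 →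
        σ.reg 42 ≤ σ'.reg 42 → Grow (σ.reg 41) (σ.reg 42) d σ σ' → Run layoutProg σ' t Q) →
      Run layoutProg σ (T.postorder.length * (tokenCost n M + 1) + t) Q := by
  induction T with
  | leaf v =>
    intro σ k d t Q hR hr hpre hnd hw hk hd hQ
    have hlen : k < l.length := by
      have := hpre.length_le
      simp [LayoutTree.postorder] at this
      omega
    have htok : l.getD k 0 = v + 1 := by
      have := hpre.getElem (i := 0) (by simp [LayoutTree.postorder])
      simp [LayoutTree.postorder] at this
      simp [hlen, ← this]
    rw [List.getD_eq_getElem?_getD] at htok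
    have hstep : Run tokenProg σ (tokenCost n M) fun σ' =>
        (NodeOK G w r (insert r K) {v} M (σ'.reg 41) (σ'.reg 42) d σ' ∧ σ'.reg 44 = k + 1 ∧
          σ'.reg 40 = d + 1 ∧ σ.reg 41 ≤ σ'.reg 41 ∧ σ.reg 42 ≤ σ'.reg 42 ∧
          Grow (σ.reg 41) (σ.reg 42) d σ σ') ∧
        Frame layoutRegs layoutArrays [0, 1] [1, 2] σ σ' := by
      refine Run.frame _ _ _ _ rfl ?_
      unfold tokenCost
      refine Run.block_seq_le (by simp) (Run.ite_le (by simp) (fun hb => ?_) fun _ => ?_)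
      · simp [RamTest.Holds, hk, hR.token, htok, hR.zero] at hb
      · refine ((leafProg_run (G := G) (w := w) (r := r) (v := v) (K := K) (M := M)
          (fs := σ.reg 41) (fe := σ.reg 42) (d := d) ?_ ?_ ?_ ?_ ?_ ?_ ?_ ?_ ?_ ?_ ?_ ?_ ?_
          hM3).post ?_).weaken (by simp)
        · simp [hR.zero]
        · simp [hR.one]
        · simp [hR.size]
        · simp [hr]
        · simp [hk, hR.token, htok]
        · simp [hd]
        · simp
        · simp
        · simpa using fun i hi => hR.pow i (by omega)
        · simpa using fun i hi => hR.pow i (by omega)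
        · simpa using hR.adj v
        · simpa using hR.term v
        · simpa using hR.weight v
        · rintro σ' ⟨⟨h1, h2, h3, h4, h5⟩, h6⟩
          refine ⟨h1, ?_, h2, h3, h4, ?_⟩
          · simp [h6.reg, hk, hR.one]
          · exact ⟨h5.st, h5.el, h5.wt, h5.sl, h5.pw⟩
    refine (Run.loop_step (T₁ := tokenCost n M) (T₂ := t) ?_ (hstep.post ?_)).weaken ?_
    · simp [RamTest.Holds, hk, hR.len, hlen]
    · rintro σ' ⟨⟨h1, h2, h3, h4, h5, h6⟩, h7⟩
      exact hQ σ' (hR.frame (h7.mono (by simp) (by simp) (by simp) (by simp)) h6.pw) h7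
          (by simpa [LayoutTree.leaves] using h1)
        (by simpa [LayoutTree.postorder] using h2) h3 h4 h5 h6
    · simp [LayoutTree.postorder]
  | node T₁ T₂ ih₁ ih₂ =>
    intro σ k d t Q hR hr hpre hnd hw hk hd hQ
    simp only [LayoutTree.postorder, List.append_assoc] at hpre
    simp only [LayoutTree.leaves, List.nodup_append] at hnd
    simp only [LayoutTree.width, max_le_iff] at hw
    have hpre₁ : T₁.postorder <+: l.drop k := (List.prefix_append _ _).trans hpre
    have hpre₂ : T₂.postorder ++ [0] <+: l.drop (k + T₁.postorder.length) := by
      have := hpre.drop T₁.postorder.length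
      simpa [List.drop_drop] using this
    have hpre₃ : [0] <+: l.drop (k + T₁.postorder.length + T₂.postorder.length) := by
      have := hpre₂.drop T₂.postorder.length
      simpa [List.drop_drop] using this
    have hlen : k + T₁.postorder.length + T₂.postorder.length < l.length := by
      have := hpre₃.length_le
      simp at this
      omega
    have htok : l.getD (k + T₁.postorder.length + T₂.postorder.length) 0 = 0 := by
      have := hpre₃.getElem (i := 0) (by simp)
      simp at this
      simp [hlen, ← this]
    rw [List.getD_eq_getElem?_getD] at htok
    refine (ih₁ σ k d (T₂.postorder.length * (tokenCost n M + 1) + (tokenCost n M + 1 + t)) Q hR hr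
      hpre₁ hnd.1 hw.2.1 hk hd ?_).weaken ?_
    swap
    · simp [LayoutTree.postorder, add_mul]; omega
    intro τ hRτ fτ hN₁ τ44 τ40 τ41 τ42 gτ
    refine ih₂ τ (k + T₁.postorder.length) (d + 1) _ Q hRτ (by simp [fτ.reg, hr])
      ((List.prefix_append _ _).trans hpre₂) hnd.2.1 hw.2.2 τ44 τ40 ?_
    intro ρ hRρ fρ hN₂ ρ44 ρ40 ρ41 ρ42 gρ
    -- The right subtree ran with stack height `d + 1`, so slot `d` still describes the left child.
    have hN₁' := hN₁.grow gρ (by omega) ρ41 ρ42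
    have hdis : Disjoint T₁.leaves.toFinset T₂.leaves.toFinset := by
      rw [Finset.disjoint_left]
      intro v h1 h2
      exact hnd.2.2 v (by simpa using h1) v (by simpa using h2) rfl
    have hun : T₁.leaves.toFinset ∪ T₂.leaves.toFinset = (T₁.node T₂).leaves.toFinset := by
      simp [LayoutTree.leaves]
    have hstep : Run tokenProg ρ (tokenCost n M) fun σ' =>
        (NodeOK G w r (insert r K) (T₁.node T₂).leaves.toFinset M (σ'.reg 41) (σ'.reg 42) d σ' ∧
          σ'.reg 44 = k + T₁.postorder.length + T₂.postorder.length + 1 ∧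
          σ'.reg 40 = d + 1 ∧ ρ.reg 41 ≤ σ'.reg 41 ∧ ρ.reg 42 ≤ σ'.reg 42 ∧
          Grow (ρ.reg 41) (ρ.reg 42) d ρ σ') ∧
        Frame layoutRegs layoutArrays [0, 1] [1, 2] ρ σ' := by
      refine Run.frame _ _ _ _ rfl ?_
      unfold tokenCost
      refine Run.block_seq_le (by simp) (Run.ite_le (by simp) (fun _ => ?_) fun hb => ?_)
      · refine ((joinProg_run (G := G) (w := w) (r := r) (K := insert r K)
          (A := T₁.leaves.toFinset) (B := T₂.leaves.toFinset) (M := M)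
          (fs := ρ.reg 41) (fe := ρ.reg 42) (d := d) ?_ ?_ ?_ ?_ ?_ ?_ ?_ hdis
          ?_ ?_ ?_).post ?_).weaken (by simp; omega)
        · simp [hRρ.zero]
        · simp [hRρ.one]
        · simp [hRρ.size]
        · simp [ρ40]
        · simp
        · simp
        · simpa using fun i hi => hRρ.pow i (by omega)
        · refine hf _ ?_
          rw [hun, LayoutTree.coe_toFinset_leaves]
          exact hw.1
        · exact hN₁'.grow (sp := d + 1) (fs := ρ.reg 41) (fe := ρ.reg 42)
            ⟨by simp, by simp, by simp, by simp, by simp⟩ (by omega) le_rfl le_rfl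
        · exact hN₂.grow (sp := d + 2) (fs := ρ.reg 41) (fe := ρ.reg 42)
            ⟨by simp, by simp, by simp, by simp, by simp⟩ (by omega) le_rfl le_rfl
        · rintro σ' ⟨⟨h1, h2, h3, h4, h5⟩, h6⟩
          rw [hun] at h1
          refine ⟨h1, ?_, h2, h3, h4, ?_⟩
          · simp [h6.reg, ρ44, hRρ.one]
          · exact ⟨h5.st, h5.el, h5.wt, h5.sl, h5.pw⟩
      · exact absurd (by simp [RamTest.Holds, ρ44, hRρ.token, htok, hRρ.zero]) hb
    refine (Run.loop_step (T₁ := tokenCost n M) (T₂ := t) ?_ (hstep.post ?_)).weaken ?_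
    · simp [RamTest.Holds, ρ44, hRρ.len, hlen]
    · rintro σ' ⟨⟨h1, h2, h3, h4, h5, h6⟩, h7⟩
      exact hQ σ' (hRρ.frame (h7.mono (by simp) (by simp) (by simp) (by simp)) h6.pw)
          ((fτ.trans fρ).trans h7) h1
        (by simp [LayoutTree.postorder, h2]; omega) h3 (τ41.trans (ρ41.trans h4))
        (τ42.trans (ρ42.trans h5))
        (gτ.trans ((gρ.mono (Nat.le_succ d)).trans h6 ρ41 ρ42 le_rfl) τ41 τ42 le_rfl)
    · omega

/-! ### The whole algorithm -/

theorem LayoutTree.length_postorder {n : ℕ} (T : LayoutTree (Fin n)) :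
    T.postorder.length + 1 = 2 * T.leaves.length := by
  induction T with
  | leaf v => rfl
  | node T₁ T₂ ih₁ ih₂ => simp [LayoutTree.postorder, LayoutTree.leaves]; omega

theorem LayoutTree.IsLayout.toFinset_leaves {n : ℕ} {T : LayoutTree (Fin n)} (h : T.IsLayout) :
    T.leaves.toFinset = Finset.univ := by
  ext v; simp [h.2 v]

theorem LayoutTree.IsLayout.length_postorder {n : ℕ} {T : LayoutTree (Fin n)} (h : T.IsLayout) :
    T.postorder.length + 1 = 2 * n := by
  rw [T.length_postorder, ← List.toFinset_card_of_nodup h.1, h.toFinset_leaves]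
  simp

/-! ### Reading off the answer at the root -/

section Root

variable {n : ℕ} {G : SimpleGraph (Fin n)} {w : Fin n → ℚ} {r : Fin n} {K : Finset (Fin n)}
  {M fs fe d : ℕ} {κ : Finset (Fin n) → Finset (Fin n) → ℕ} {S₁ S₂ X : ℕ → Finset (Fin n)}
  {σ : RamState}

/-- Nothing lies outside the set of all vertices, so distinctness leaves at most one class and hence
at most one element. In the other case there is a single vertex, and every listed set contains the
required `r`. -/
theorem NodeData.sets_eq (h : NodeData G w r (insert r K) Finset.univ M fs fe d κ S₁ S₂ X σ)
    {e : ℕ} (he : e < σ.mem 8 d) : X e = X 0 ∧ (σ.mem 6 d ≤ 1 ∨ X 0 = {r}) := by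
  rcases h.distinct with ⟨⟨-, hd⟩, hL⟩ | h1
  · have hO : ∀ S : Finset (Fin n), outNbrs G Finset.univ S = ∅ := by
      intro S; ext u; simp [mem_outNbrs]
    have hm : σ.mem 6 d ≤ 1 := by
      by_contra hcon
      have := hd 0 (by omega) 1 (by omega) (by simp [hO]) (by simp [hO])
      omega
    obtain rfl : e = 0 := by omega
    exact ⟨rfl, Or.inl hm⟩
  · have hX : ∀ e < σ.mem 8 d, X e = {r} := by
      intro e he
      have hr : r ∈ X e := h.represents.required e he (by simp)
      obtain ⟨a, ha⟩ := Finset.card_eq_one.1 h1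
      ext x
      have hx : x ∈ ({a} : Finset (Fin n)) := ha ▸ Finset.mem_univ x
      have hr' : r ∈ ({a} : Finset (Fin n)) := ha ▸ Finset.mem_univ r
      rw [Finset.mem_singleton] at hx hr'
      simp only [hx, ← hr', hr, Finset.mem_singleton]
    rw [hX e he, hX 0 (by omega)]
    exact ⟨rfl, Or.inr rfl⟩

/-- If there is only one class, the vector is the parity of the number of cuts. For `X 0 = {r}`
connectivity is clear, and a zero vector would have an even number of cuts. -/
theorem NodeData.pos_iff (h : NodeData G w r (insert r K) Finset.univ M fs fe d κ S₁ S₂ X σ)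
    (hL : 0 < σ.mem 8 d) :
    0 < σ.mem 15 (σ.mem 7 d) ↔ (G.induce (X 0 : Set (Fin n))).Connected := by
  obtain ⟨-, h2, h3, -⟩ := h.elem 0 hL
  rw [add_zero] at h2 h3
  have hr : r ∈ X 0 := h.represents.required 0 hL (by simp)
  rw [← card_cuts_ne_zero_iff hr, ← h.classifier.sum_cutVec r (Finset.subset_univ _), ← h3]
  constructor
  · intro hu
    rcases (h.sets_eq hL).2 with hm | hX
    · obtain ⟨m, hm'⟩ : ∃ m, σ.mem 6 d = m := ⟨_, rfl⟩
      rw [hm'] at hm h2 ⊢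
      obtain ⟨u, hu'⟩ : ∃ m, σ.mem 15 (σ.mem 7 d) = m := ⟨_, rfl⟩
      rw [hu'] at h2 hu ⊢
      interval_cases m
      · omega
      · obtain rfl : u = 1 := by omega
        rw [Finset.sum_range_one]
        simp [bitVec]
    · rw [h3, h.classifier.sum_cutVec r (Finset.subset_univ _), card_cuts_ne_zero_iff hr]
      rw [hX, Finset.coe_singleton]
      exact (SimpleGraph.connected_iff _).2 ⟨.of_subsingleton, inferInstance⟩
  · intro hs
    by_contra hu
    apply hs
    have : σ.mem 15 (σ.mem 7 d) = 0 := by omega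
    simp [this, bitVec]

/-- A solution through `r` would yield a listed set with an odd number of cuts. That set is `X 0`,
which would be connected and have a nonzero vector. -/
theorem NodeData.not_isSteinerSet
    (h : NodeData G w r (insert r K) Finset.univ M fs fe d κ S₁ S₂ X σ)
    (hL : σ.mem 8 d = 0 ∨ σ.mem 15 (σ.mem 7 d) = 0) {Y : Finset (Fin n)}
    (hY : IsSteinerSet G K Y) : r ∉ Y := by
  intro hr
  obtain ⟨e, he, -, hc⟩ := h.represents.exists_connected h.classifier (Finset.subset_univ Y)
    (Finset.insert_subset hr hY.1) (Finset.mem_insert_self r K) hY.2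
  have hL' : σ.mem 15 (σ.mem 7 d) = 0 := by
    rcases hL with hL | hL
    · omega
    · exact hL
  have hr' : r ∈ X 0 := h.represents.required 0 (by omega) (by simp)
  rw [(h.sets_eq he).1, card_cuts_ne_zero_iff hr', ← h.pos_iff (by omega)] at hc
  omega

theorem NodeData.isSteinerSet
    (h : NodeData G w r (insert r K) Finset.univ M fs fe d κ S₁ S₂ X σ)
    (hL : 0 < σ.mem 8 d) (hu : 0 < σ.mem 15 (σ.mem 7 d)) :
    IsSteinerSet G K (X 0) ∧ r ∈ X 0 ∧ ∀ Y, IsSteinerSet G K Y → r ∈ Y →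
      ∑ v ∈ X 0, w v ≤ ∑ v ∈ Y, w v := by
  have h1 := h.represents.required 0 hL
  rw [Finset.inter_univ] at h1
  refine ⟨⟨(Finset.subset_insert r K).trans h1, (h.pos_iff hL).1 hu⟩, h1 (by simp), ?_⟩
  intro Y hY hr
  obtain ⟨e, he, hw, -⟩ := h.represents.exists_connected h.classifier (Finset.subset_univ Y)
    (Finset.insert_subset hr hY.1) (Finset.mem_insert_self r K) hY.2
  rwa [(h.sets_eq he).1] at hw

end Root

/-- The best solution that contains one of the first `i` vertices. -/
def BestUpTo {n : ℕ} (G : SimpleGraph (Fin n)) (K : Finset (Fin n)) (w : Fin n → ℚ) (i : ℕ)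
    (σ : RamState) : Prop :=
  (σ.reg 69 = 0 ∧ ∀ Y, IsSteinerSet G K Y → ∀ v ∈ Y, i ≤ v) ∨
  (σ.reg 69 = 1 ∧ ∃ S, IsSteinerSet G K S ∧ σ.reg 70 = code S ∧ σ.wreg 20 = ∑ v ∈ S, w v ∧
    ∀ Y, IsSteinerSet G K Y → ∀ v ∈ Y, (v : ℕ) < i → ∑ v ∈ S, w v ≤ ∑ v ∈ Y, w v)

/-- Compare the solution at the bottom of the stack with the best one so far. -/
def compareProg : RamProg :=
  .seq (.block [.load 8 8 60, .load 9 7 60]) <|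
  .ite (.lt 60 8)
    (.seq (.block [.load 10 15 9, .load 11 14 9, .wload 0 1 9])
      (.ite (.lt 60 10)
        (.ite (.eq 69 60) (.block [.copy 70 11, .wcopy 20 0, .copy 69 61])
          (.ite (.wlt 0 20) (.block [.copy 70 11, .wcopy 20 0, .copy 69 61]) (.block [])))
        (.block [])))
    (.block [])

/-- By `sets_eq` only element `0` needs inspection. The flag in register `69` says whether any
solution is known, which avoids an infinite weight. -/
theorem compareProg_run {n : ℕ} {G : SimpleGraph (Fin n)} {w : Fin n → ℚ} {r : Fin n}
    {K : Finset (Fin n)} {M fs fe : ℕ} {σ : RamState} (hz : σ.reg 60 = 0) (ho : σ.reg 61 = 1)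
    (h : NodeOK G w r (insert r K) Finset.univ M fs fe 0 σ) (hb : BestUpTo G K w r σ) :
    Run compareProg σ 20 fun σ' => BestUpTo G K w (r + 1) σ' := by
  obtain ⟨κ, S₁, S₂, X, h⟩ := h
  have hno : σ.mem 8 0 = 0 ∨ σ.mem 15 (σ.mem 7 0) = 0 → ∀ σ', σ'.reg 69 = σ.reg 69 →
      σ'.reg 70 = σ.reg 70 → σ'.wreg 20 = σ.wreg 20 → BestUpTo G K w (r + 1) σ' := by
    intro hL σ' h69 h70 hw
    unfold BestUpTo
    rw [h69, h70, hw]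
    have hne : ∀ Y, IsSteinerSet G K Y → ∀ v ∈ Y, (v : ℕ) ≠ r := by
      intro Y hY v hv hvr
      exact h.not_isSteinerSet hL hY (Fin.ext hvr ▸ hv)
    refine hb.imp (fun hb => ⟨hb.1, fun Y hY v hv => ?_⟩) (fun ⟨h1, S, h2, h3, h4, h5⟩ =>
      ⟨h1, S, h2, h3, h4, fun Y hY v hv hvr => h5 Y hY v hv ?_⟩)
    · have := hb.2 Y hY v hv
      have := hne Y hY v hv
      omega
    · have := hne Y hY v hv
      omega
  refine Run.block_seq_le (by simp) (Run.ite_le (by simp) (fun hL => ?_) fun hL => ?_)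
  swap
  · refine Run.block_le (by simp) (hno (Or.inl ?_) _ (by simp) (by simp) (by simp))
    simpa [RamTest.Holds, hz] using hL
  simp [RamTest.Holds, hz] at hL
  refine Run.block_seq_le (by simp) (Run.ite_le (by simp) (fun hu => ?_) fun hu => ?_)
  swap
  · refine Run.block_le (by simp) (hno (Or.inr ?_) _ (by simp) (by simp) (by simp))
    simpa [RamTest.Holds, hz] using hu
  simp [RamTest.Holds, hz] at hu
  obtain ⟨s1, s2, s3⟩ := h.isSteinerSet hL hu
  obtain ⟨e1, -, -, e2⟩ := h.elem 0 hL
  rw [add_zero] at e1 e2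
  have hnew : (∀ Y, IsSteinerSet G K Y → ∀ v ∈ Y, (v : ℕ) < r →
      ∑ v ∈ X 0, w v ≤ ∑ v ∈ Y, w v) → ∀ σ', σ'.reg 69 = 1 →
      σ'.reg 70 = code (X 0) → σ'.wreg 20 = ∑ v ∈ X 0, w v → BestUpTo G K w (r + 1) σ' := by
    intro hlt σ' h1 h2 h3
    refine Or.inr ⟨h1, X 0, s1, h2, h3, fun Y hY v hv hvr => ?_⟩
    rcases Nat.lt_succ_iff_lt_or_eq.1 hvr with hvr | hvr
    · exact hlt Y hY v hv hvr
    · exact s3 Y hY (Fin.ext hvr ▸ hv)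
  refine Run.ite_le (by simp) (fun h69 => ?_) fun h69 => ?_
  · simp [RamTest.Holds, hz] at h69
    refine Run.block_le (by simp) (hnew ?_ _ (by simp [ho]) (by simp [hz, e1]) (by simp [hz, e2]))
    rcases hb with hb | hb
    · intro Y hY v hv hvr
      have := hb.2 Y hY v hv
      omega
    · omega
  simp [RamTest.Holds, hz] at h69
  obtain ⟨hb1, S, b1, b2, b3, b4⟩ := hb.resolve_left fun h => h69 h.1
  refine Run.ite_le (by simp) (fun hw => ?_) fun hw => ?_
  · simp [RamTest.Holds, hz, e2, b3] at hw
    refine Run.block_le (by simp) (hnew ?_ _ (by simp [ho]) (by simp [hz, e1]) (by simp [hz, e2]))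
    exact fun Y hY v hv hvr => hw.le.trans (b4 Y hY v hv hvr)
  · simp [RamTest.Holds, hz, e2, b3] at hw
    refine Run.block_le (by simp) (Or.inr ⟨by simpa using hb1, S, b1, by simpa using b2,
      by simpa using b3, fun Y hY v hv hvr => ?_⟩)
    rcases Nat.lt_succ_iff_lt_or_eq.1 hvr with hvr | hvr
    · exact b4 Y hY v hv hvr
    · exact hw.trans (s3 Y hY (Fin.ext hvr ▸ hv))

/-- Find the best solution that contains the vertex in register `63`, and compare it with the best
one so far. -/
def roundProg : RamProg :=
  .seq (.block [.const 40 0, .const 41 0, .const 42 0, .const 44 0]) (.seq layoutProg compareProg)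

/-- A bound for the running time of `roundProg`. -/
def roundCost (n M : ℕ) : ℕ := 2 * n * (tokenCost n M + 1) + 26

/-- Resetting the stack and the allocation pointers lets each round reuse the memory. The best
solution so far survives because its registers are outside the frame of the run through the layout.
-/
theorem roundProg_run {n : ℕ} {G : SimpleGraph (Fin n)} {w : Fin n → ℚ} {r : Fin n}
    {K : Finset (Fin n)} {T : LayoutTree (Fin n)} {M s : ℕ} {f : Set (Fin n) → ℕ} {σ : RamState}
    (hT : T.IsLayout) (hM3 : 3 ≤ M)
    (hf : ∀ A : Finset (Fin n), f A ≤ s → ∀ m U₁ U₂, DistinctClasses G A m U₁ U₂ → m ≤ M)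
    (hs : T.width f ≤ s) (hR : Ready G K w T.postorder σ) (hr : σ.reg 63 = r)
    (hb : BestUpTo G K w r σ) :
    Run roundProg σ (roundCost n M) fun σ' => Ready G K w T.postorder σ' ∧
      BestUpTo G K w (r + 1) σ' := by
  have hn := hT.length_postorder
  have hcost : T.postorder.length * (tokenCost n M + 1) ≤ 2 * n * (tokenCost n M + 1) := by
    gcongr; omega
  unfold roundCost
  set τ := exec [.const 40 0, .const 41 0, .const 42 0, .const 44 0] σ with hτ
  have fτ : Frame layoutRegs layoutArrays [0, 1] [1, 2] σ τ := by
    constructor <;> intro i hi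
    · simp at hi
      simp [hτ, hi]
    all_goals simp [hτ]
  have hRτ : Ready G K w T.postorder τ :=
    hR.frame (fτ.mono (by simp) (by simp) (by simp) (by simp)) (by simp [hτ])
  refine Run.block_seq_le (by simp) (Run.seq_le
    (Q := fun σ' => NodeOK G w r (insert r K) Finset.univ M (σ'.reg 41) (σ'.reg 42) 0 σ' ∧
      Ready G K w T.postorder σ' ∧ Frame layoutRegs layoutArrays [0, 1] [1, 2] τ σ') _
    (layoutProg_run (w := w) (r := r) (K := K) hM3 hf T τ 0 0 1 _ hRτ (by simp [hτ, hr])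
      (by simp) hT.1 hs (by simp [hτ]) (by simp [hτ]) ?_) (by simp; omega) ?_)
  · intro σ' h1 h2 h3 h4 h5 h6 h7 h8
    rw [hT.toFinset_leaves] at h3
    -- The continuation of the whole listing is just the failing test of the loop, hence the time
    -- `1`.
    refine Run.loop_end ?_ ⟨h3, h1, h2⟩
    simp [RamTest.Holds, h4, h1.len]
  · rintro σ' ⟨h1, h2, h3⟩
    have f := fτ.trans h3
    have hb' : BestUpTo G K w r σ' := by
      unfold BestUpTo
      rw [f.reg 69 (by simp), f.reg 70 (by simp), f.wreg 20 (by simp)]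
      exact hb
    refine (((compareProg_run h2.zero h2.one h1 hb').frame [0, 8, 9, 10, 11, 69, 70] [] [0, 20] []
      rfl).weaken (by simp; omega)).post ?_
    rintro ρ ⟨h4, h5⟩
    exact ⟨h2.frame (h5.mono (by simp) (by simp) (by simp) (by simp))
      (fun i hi => by simpa [h5.mem] using hi), h4⟩

/-- Set up the constants and the powers of two. -/
def setupProg : RamProg :=
  .seq (.block [.copy 62 0, .const 60 0, .const 61 1, .add 68 62 62, .sub 68 68 61, .const 8 3,
    .add 64 62 8, .const 9 1])
    (.up 65 64 (.block [.store 4 65 9, .add 9 9 9]))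

-- The `n + 3` powers of two suffice for sets of vertices and for the vectors of three bits at the
-- leaves; further powers are added as classes appear.
open Classical in
theorem setupProg_run {n : ℕ} (G : SimpleGraph (Fin n)) (K : Finset (Fin n)) (w : Fin n → ℚ)
    {T : LayoutTree (Fin n)} (hT : T.IsLayout) :
    Run setupProg (steinerInput G K w T) (n * 5 + 40) fun σ => Ready G K w T.postorder σ ∧
      σ.reg 69 = 0 := by
  have hn := hT.length_postorder
  refine Run.block_seq_le (by simp) (((Run.up (N := n + 3) (b := 3) [0, 9] [4] [] []
    rfl (by decide) (fun i τ => τ.reg 9 = 2 ^ i ∧ ∀ j < i, τ.mem 4 j = 2 ^ j)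
    ?_ ?_ ?_ ?_ ?_).post ?_).weaken (by simp; omega))
  · intro i σ x h; simpa using h
  · simp
  · simp [steinerInput]
  · simp
  · rintro i hi σ hσ hf ⟨h9, h4⟩
    refine Run.block_le (by simp) ⟨?_, ?_⟩
    · simp [h9, pow_succ, mul_two]
    · intro j hj
      rcases Nat.lt_succ_iff_lt_or_eq.1 hj with hj | rfl
      · have : j ≠ i := by omega
        simp [hσ, this, h4 j hj]
      · simp [hσ, h9]
  · rintro σ ⟨⟨-, h4⟩, f⟩
    refine ⟨⟨?_, ?_, ?_, ?_, ?_, ?_, ?_, ?_, h4⟩, ?_⟩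
    · simp [f.reg]
    · simp [f.reg]
    · simp [f.reg, steinerInput]
    · simp [f.reg, steinerInput]
      omega
    · intro v u
      simp [f.mem, steinerInput]
      constructor
      · rintro ⟨i, j, h, ha⟩
        obtain ⟨h1, h2⟩ := idx_inj u.2 j.2 h
        rwa [Fin.ext h1, Fin.ext h2]
      · exact fun h => ⟨v, u, rfl, h⟩
    · intro v
      simp [f.mem, steinerInput]
      constructor
      · rintro ⟨i, h, hi⟩
        rwa [Fin.ext h]
      · exact fun h => ⟨v, rfl, h⟩
    · intro i
      simp [f.mem, steinerInput]
    · intro v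
      simp [f.wmem, steinerInput]
    · simp [f.reg, steinerInput]

/-- The algorithm. -/
def steinerProg : RamProg :=
  .seq setupProg <| .seq (.up 63 62 roundProg) <|
  .seq (.ite (.eq 69 61) (.seq (.block [.copy 0 70, .copy 2 62]) (unpackProg 3)) (.block [])) <|
  .block [.copy 0 69]

/-- A bound for the running time of `steinerProg`. -/
def steinerCost (n M : ℕ) : ℕ := n * (roundCost n M + 2) + n * 13 + 60

/-- Every solution is nonempty, so it competes in the round of any of its vertices; this also covers
an empty set of terminals. -/
theorem steinerProg_run {n : ℕ} (G : SimpleGraph (Fin n)) (K : Finset (Fin n)) (w : Fin n → ℚ)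
    {T : LayoutTree (Fin n)} {M s : ℕ} {f : Set (Fin n) → ℕ} (hT : T.IsLayout) (hM3 : 3 ≤ M)
    (hf : ∀ A : Finset (Fin n), f A ≤ s → ∀ m U₁ U₂, DistinctClasses G A m U₁ U₂ → m ≤ M)
    (hs : T.width f ≤ s) :
    Run steinerProg (steinerInput G K w T) (steinerCost n M) (IsSteinerOutput G K w) := by
  unfold steinerCost
  refine Run.seq_le _ (setupProg_run G K w hT) (by omega) ?_
  rintro σ ⟨hR, h69⟩
  refine Run.seq_le _ (Run.up (N := n) (b := roundCost n M) roundRegs layoutArrays [0, 1, 20] [1, 2]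
    rfl (by decide) (fun i σ => Ready G K w T.postorder σ ∧ BestUpTo G K w i σ) ?_
    hR.one hR.size ?_ ?_) (by omega) ?_
  · rintro i σ x ⟨h1, h2⟩
    exact ⟨⟨by simp [h1.zero], by simp [h1.one], by simp [h1.size], by simp [h1.len],
      by simpa using h1.adj, by simpa using h1.term, by simpa using h1.token,
      by simpa using h1.weight, by simpa using h1.pow⟩, by simpa [BestUpTo] using h2⟩
  · exact ⟨hR, Or.inl ⟨h69, by simp⟩⟩
  · rintro i hi σ' h63 - ⟨h1, h2⟩
    exact roundProg_run (r := ⟨i, hi⟩) hT hM3 hf hs h1 h63 h2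
  rintro τ ⟨⟨h1, h2⟩, -⟩
  refine Run.seq_le (T₁ := n * 8 + 5) (Q := fun τ' => τ'.reg 69 = τ.reg 69 ∧
    (τ.reg 69 = 1 → ∀ i < n, τ'.mem 3 i = ((τ.reg 70).testBit i).toNat)) ?_ (by omega) ?_
  · refine Run.ite_le (by simp) (fun hb => ?_) fun hb => ?_
    · simp [RamTest.Holds, h1.one] at hb
      obtain ⟨-, S, -, h70, -⟩ := h2.resolve_left (by simp [hb])
      refine Run.block_seq_le (by simp) (((unpackProg_run (by decide) (x := τ.reg 70)
        (k := n) ?_ ?_ ?_ ?_ ?_ ?_).post ?_).weaken (by simp))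
      · simp [h1.zero]
      · simp [h1.one]
      · simp
      · simp [h1.size]
      · rw [h70]; exact code_lt S
      · simpa using fun i hi => h1.pow i (by omega)
      · rintro τ' ⟨h3, h4⟩
        exact ⟨by simp [h4.reg], fun _ => h3⟩
    · simp [RamTest.Holds, h1.one] at hb
      exact Run.block_le (by simp) ⟨by simp, fun h => absurd h hb⟩
  rintro τ' ⟨h3, h4⟩
  refine Run.block_le (by simp; omega) ?_
  rcases h2 with ⟨h69, hno⟩ | ⟨h69, S, h5, h6, h7, h8⟩
  · refine Or.inr ⟨by simp [h3, h69], ?_⟩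
    rintro ⟨S, hS⟩
    obtain ⟨⟨v, hv⟩⟩ := hS.2.nonempty
    have := hno S hS v hv
    omega
  · refine Or.inl ⟨by simp [h3, h69], S, ⟨h5, fun Y hY => ?_⟩, fun v => ?_⟩
    · obtain ⟨⟨v, hv⟩⟩ := hY.2.nonempty
      exact h8 Y hY v hv v.2
    · have := h4 h69 v v.2
      rw [h6, testBit_code] at this
      simp [this]
      split_ifs <;> simp_all

/-! ### The number of classes -/

/-- For `d = 1` the equivalence records which outside vertices have a neighbor in the set, so
equivalent sets have equal outside neighbors. Distinct pairs thus inject into pairs of equivalence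
classes. -/
theorem DistinctClasses.le_nec_sq {n : ℕ} {G : SimpleGraph (Fin n)} {A : Finset (Fin n)} {m : ℕ}
    {U₁ U₂ : ℕ → Finset (Fin n)} (h : DistinctClasses G A m U₁ U₂) : m ≤ nec G 1 A ^ 2 := by
  let q (S : Finset (Fin n)) (hS : S ⊆ A) : Quotient (neighborEquiv G 1 (A : Set (Fin n))) :=
    Quotient.mk _ ⟨S, Finset.coe_subset.2 hS⟩
  have hq : ∀ S hS S' hS', q S hS = q S' hS' → outNbrs G A S = outNbrs G A S' := by
    intro S hS S' hS' he
    have hr : ∀ u ∈ (A : Set (Fin n))ᶜ, min 1 ((S : Set (Fin n)) ∩ G.neighborSet u).ncard =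
        min 1 ((S' : Set (Fin n)) ∩ G.neighborSet u).ncard := Quotient.exact he
    have hpos : ∀ (R : Finset (Fin n)) (u : Fin n), (∃ x ∈ R, G.Adj x u) ↔
        min 1 ((R : Set (Fin n)) ∩ G.neighborSet u).ncard = 1 := by
      intro R u
      rw [min_eq_left_iff, Nat.one_le_iff_ne_zero, ← Nat.pos_iff_ne_zero,
        Set.ncard_pos (Set.toFinite _)]
      exact ⟨fun ⟨x, hx, ha⟩ => ⟨x, hx, ha.symm⟩, fun ⟨x, hx, ha⟩ => ⟨x, hx, ha.symm⟩⟩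
    ext u
    rw [mem_outNbrs, mem_outNbrs]
    refine and_congr_right fun hu => ?_
    rw [hpos, hpos, hr u (by simpa using hu)]
  let F (i : Fin m) := (q (U₁ i) (h.1 i i.2).1, q (U₂ i) (h.1 i i.2).2)
  have hF : Function.Injective F := by
    intro i j hij
    rw [Prod.mk.injEq] at hij
    exact Fin.ext (h.2 i i.2 j j.2 (hq _ (h.1 i i.2).1 _ (h.1 j j.2).1 hij.1)
      (hq _ (h.1 i i.2).2 _ (h.1 j j.2).2 hij.2))
  have := Nat.card_le_card_of_injective F hF
  rwa [Nat.card_prod, Nat.card_eq_fintype_card, Fintype.card_fin, ← sq] at this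

theorem one_le_nec {n : ℕ} (G : SimpleGraph (Fin n)) (A : Set (Fin n)) : 1 ≤ nec G 1 A := by
  have : Nonempty (Quotient (neighborEquiv G 1 A)) := ⟨Quotient.mk _ ⟨∅, Set.empty_subset _⟩⟩
  exact Nat.one_le_iff_ne_zero.2 Nat.card_pos.ne'

/-! ### The exponent of matrix multiplication is at least two -/

section MatMul

variable (F : Type*) [Field F] (m : ℕ)

/-- The matrix product is a sum of `r` products of linear forms. -/
def HasMatMulRank (r : ℕ) : Prop :=
  ∃ (f g : Fin r → Module.Dual F (Matrix (Fin m) (Fin m) F))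
    (C : Fin r → Matrix (Fin m) (Fin m) F),
    ∀ A B : Matrix (Fin m) (Fin m) F, A * B = ∑ i, (f i A * g i B) • C i

/-- The schoolbook algorithm, with one product for each triple of indices. It makes the infima that
define rank and exponent range over nonempty sets. -/
theorem hasMatMulRank_cube : HasMatMulRank F m (m ^ 3) := by
  let e : Fin (m ^ 3) ≃ Fin m × Fin m × Fin m := Fintype.equivOfCardEq (by simp; ring)
  refine ⟨fun t => Matrix.entryLinearMap F F (e t).1 (e t).2.1,
    fun t => Matrix.entryLinearMap F F (e t).2.1 (e t).2.2,
    fun t => Matrix.single (e t).1 (e t).2.2 1, fun A B => ?_⟩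
  rw [Equiv.sum_comp e fun t => (Matrix.entryLinearMap F F t.1 t.2.1 A *
    Matrix.entryLinearMap F F t.2.1 t.2.2 B) • Matrix.single t.1 t.2.2 (1 : F)]
  ext i k
  simp [Fintype.sum_prod_type, Matrix.sum_apply, Matrix.mul_apply, Matrix.single_apply]
  symm
  rw [Finset.sum_eq_single i (fun x _ hx => by simp [hx]) (by simp)]
  exact Finset.sum_congr rfl fun j _ => by simp

-- Multiplying by the identity shows that the matrices `C i` span a space of dimension `m ^ 2`.
variable {F m} in
theorem HasMatMulRank.sq_le {r : ℕ} (h : HasMatMulRank F m r) : m ^ 2 ≤ r := by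
  obtain ⟨f, g, C, h⟩ := h
  have hs : Submodule.span F (Set.range C) = ⊤ := by
    rw [eq_top_iff]
    intro A _
    rw [← mul_one A, h A 1]
    exact Submodule.sum_mem _ fun i _ => Submodule.smul_mem _ _ (Submodule.subset_span ⟨i, rfl⟩)
  have := finrank_range_le_card (R := F) C
  rw [Set.finrank, hs, finrank_top, Module.finrank_matrix] at this
  simpa [sq] using this

theorem sq_le_matMulRank : m ^ 2 ≤ matMulRank F m :=
  HasMatMulRank.sq_le (Nat.sInf_mem (s := {r | HasMatMulRank F m r}) ⟨_, hasMatMulRank_cube F m⟩)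

theorem matMulRank_le_cube : matMulRank F m ≤ m ^ 3 :=
  Nat.sInf_le (s := {r | HasMatMulRank F m r}) (hasMatMulRank_cube F m)

/-- An exponent `τ < 2` would bound `m ^ (2 - τ)`. The admissible exponent `3` is needed as well,
because the real infimum of the empty set is `0`. -/
theorem two_le_matMulExponent : 2 ≤ matMulExponent F := by
  refine le_csInf ⟨3, ?_⟩ fun τ hτ => ?_
  · refine Asymptotics.IsBigO.of_bound 1 (Filter.Eventually.of_forall fun m => ?_)
    have : (matMulRank F m : ℝ) ≤ (m : ℝ) ^ 3 := by exact_mod_cast matMulRank_le_cube F m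
    rw [one_mul, Real.norm_natCast, show (3 : ℝ) = ((3 : ℕ) : ℝ) by norm_num, Real.rpow_natCast]
    exact this.trans (Real.le_norm_self _)
  · by_contra hcon
    push Not at hcon
    have h1 : (fun m : ℕ => (m : ℝ) ^ (2 : ℝ)) =O[Filter.atTop] fun m : ℕ => (m : ℝ) ^ τ := by
      refine Asymptotics.IsBigO.trans ?_ hτ
      refine Asymptotics.IsBigO.of_bound 1 (Filter.Eventually.of_forall fun m => ?_)
      have : ((m : ℝ) ^ 2) ≤ (matMulRank F m : ℝ) := by exact_mod_cast sq_le_matMulRank F m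
      rw [one_mul, Real.norm_natCast, show (2 : ℝ) = ((2 : ℕ) : ℝ) by norm_num, Real.rpow_natCast,
        Real.norm_of_nonneg (by positivity)]
      exact this
    obtain ⟨c, hc⟩ := h1.bound
    have h2 := ((tendsto_rpow_atTop (sub_pos.2 hcon)).comp
      (tendsto_natCast_atTop_atTop (R := ℝ))).eventually_gt_atTop c
    obtain ⟨m, hm, hm', hm1⟩ := (hc.and (h2.and (Filter.eventually_ge_atTop 1))).exists
    have hpos : (0 : ℝ) < m := by exact_mod_cast hm1
    have hτ := Real.rpow_pos_of_pos hpos τ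
    rw [Real.norm_of_nonneg (by positivity), Real.norm_of_nonneg hτ.le,
      show (2 : ℝ) = (2 - τ) + τ by ring, Real.rpow_add hpos] at hm
    exact absurd (le_of_mul_le_mul_right hm hτ) (not_le.2 hm')

end MatMul

/-- Expanded, the cost has degree `4` in `M` and `3` in `n`, and its coefficients add up to less
than `1100`. The leading terms are `M ^ 4 * n ^ 2`, from the joins of vectors and the elimination,
and `M ^ 2 * n ^ 3`, from the operations on sets of vertices. -/
theorem steinerCost_le {n M : ℕ} (hn : 1 ≤ n) (hM : 1 ≤ M) :
    steinerCost n M ≤ 1100 * (M ^ 4 * n ^ 3) := by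
  have h : ∀ i j, i ≤ 4 → j ≤ 3 → M ^ i * n ^ j ≤ M ^ 4 * n ^ 3 := fun i j hi hj =>
    Nat.mul_le_mul (Nat.pow_le_pow_right hM hi) (Nat.pow_le_pow_right hn hj)
  have h00 := h 0 0 (by norm_num) (by norm_num)
  have h01 := h 0 1 (by norm_num) (by norm_num)
  have h02 := h 0 2 (by norm_num) (by norm_num)
  have h03 := h 0 3 (by norm_num) (by norm_num)
  have h12 := h 1 2 (by norm_num) (by norm_num)
  have h22 := h 2 2 (by norm_num) (by norm_num)
  have h23 := h 2 3 (by norm_num) (by norm_num)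
  have h32 := h 3 2 (by norm_num) (by norm_num)
  have h42 := h 4 2 (by norm_num) (by norm_num)
  unfold steinerCost roundCost tokenCost joinCost
  linarith

theorem corollary4p4 (F : Type*) [Field F] :
    ∃ (P : RamProg) (C : ℝ), ∀ (n : ℕ) (G : SimpleGraph (Fin n)) (K : Finset (Fin n))
      (w : Fin n → ℚ) (T : LayoutTree (Fin n)), T.IsLayout →
      ∃ (t : ℕ) (σ : RamState), RamExec P (steinerInput G K w T) t σ ∧
        IsSteinerOutput G K w σ ∧
        (t : ℝ) ≤ C * (T.width (snec G 1) : ℝ) ^ (2 * matMulExponent F + 5) *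
          Real.log ((T.width (snec G 1) : ℝ) + 1) * (n : ℝ) ^ 3 := by
  -- `1100` comes from `steinerCost_le`, `81 = 3 ^ 4` from the choice `M = 3 * s ^ 2`, and `2` from
  -- the lower bound `1 / 2` for the logarithm.
  refine ⟨steinerProg, 2 * 1100 * 81, fun n G K w T hT => ?_⟩
  obtain ⟨s, hs⟩ : ∃ s, T.width (snec G 1) = s := ⟨_, rfl⟩
  have hn : 1 ≤ n := by have := hT.length_postorder; omega
  have hs1 : 1 ≤ s := by
    rw [← hs]
    exact ((one_le_nec G T.leafSet).trans (le_max_left _ _)).trans (T.le_width (snec G 1))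
  have hM : 1 ≤ s ^ 2 := Nat.one_le_pow _ _ hs1
  -- Pairs of classes number at most `s ^ 2`; the factor `3` makes room for the three classes of a
  -- leaf. Only the half of `snec` that concerns the set itself enters.
  obtain ⟨t, σ, h1, h2, h3⟩ := steinerProg_run G K w (M := 3 * s ^ 2) (s := s) hT (by omega)
    (fun A hA m U₁ U₂ hd => hd.le_nec_sq.trans
      ((Nat.pow_le_pow_left ((le_max_left _ _).trans hA) 2).trans (by omega))) hs.le
  refine ⟨t, σ, h1, h3, ?_⟩
  rw [hs]
  have hs1' : (1 : ℝ) ≤ s := by exact_mod_cast hs1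
  have ht : (t : ℝ) ≤ 1100 * 81 * (s : ℝ) ^ 8 * (n : ℝ) ^ 3 := by
    have := h2.trans (steinerCost_le hn (M := 3 * s ^ 2) (by omega))
    have h : (t : ℝ) ≤ 1100 * ((3 * (s : ℝ) ^ 2) ^ 4 * (n : ℝ) ^ 3) := by exact_mod_cast this
    exact h.trans (le_of_eq (by ring))
  -- The exponent on the right is at least `2 * 2 + 5 = 9`, and `s ≥ 1`.
  have hpow : (s : ℝ) ^ 8 ≤ (s : ℝ) ^ (2 * matMulExponent F + 5) := by
    rw [← Real.rpow_natCast]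
    refine Real.rpow_le_rpow_of_exponent_le hs1' ?_
    have := two_le_matMulExponent F
    push_cast
    linarith
  have hlog : 1 / 2 ≤ Real.log ((s : ℝ) + 1) := by
    have := Real.log_le_log (by norm_num : (0 : ℝ) < 2) (by linarith : (2 : ℝ) ≤ s + 1)
    have := Real.log_two_gt_d9
    linarith
  calc (t : ℝ) ≤ 1100 * 81 * (s : ℝ) ^ 8 * (n : ℝ) ^ 3 := ht
    _ = 2 * 1100 * 81 * (s : ℝ) ^ 8 * (1 / 2) * (n : ℝ) ^ 3 := by ring
    _ ≤ _ := by gcongr
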